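/- Consider the untyped higher-order call-by-value language with shared heap, allocation, parallel composition and $\mathsf{atomic}$, with Brookes-style trace semantics $[\![e]\!]\in T\mathbb V$: sets of pairs of a trace $(h_1,k_1)\cdots(h_n,k_n)$, $n\ge 1$, of heaps (with non-shrinking domains) and a result value, closed under stuttering, mumbling, down-closure and suprema of chains, where $\mathbb V$ is the least solution of $\mathbb V\simeq \mathbb{VB}+(\mathbb V\to T\mathbb V)+\mathbb V^*$ ($\mathbb{VB}$: integers, booleans, locations and tuples of these; tuples of storable values are identified with the corresponding elements of $\mathbb V^*$). Allocation uses an arbitrary function choosing fresh locations. A concurrent abstract location $\mathfrak l$ consists of two partial equivalence relations on heaps, $\sim_{\mathfrak l}$ and a finer one $\simeq_{\mathfrak l}$ with the same support, and a transitive step relation $\to_{\mathfrak l}$ on the support of $\sim_{\mathfrak l}$, reflexive there. A world $w$ is a set of these; $h\models w$ is the largest predicate such that $h\models w$ implies $h\sim_{\mathfrak l}h$ for all $\mathfrak l\in w$ and, whenever $\mathfrak l\in w$ and $h\to_{\mathfrak l}h_1$, also $h_1\models w$ and $h\simeq_{\mathfrak l'}h_1$ for all $\mathfrak l'\in w\setminus\{\mathfrak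 l\}$. An effect $\varepsilon$ is a set of elementary effects $\mathrm{rd}_{\mathfrak l},\mathrm{wr}_{\mathfrak l},\mathrm{co}_{\mathfrak l}$ ($\mathfrak l\in w$). Let $\to_\varepsilon$ be the transitive closure of the steps $\to_{\mathfrak l}$ with $\mathrm{wr}_{\mathfrak l}\in\varepsilon$ and the silent steps ${\to_{\mathfrak l}}\cap{\simeq_{\mathfrak l}}$ with $\mathfrak l\in w$. The tile $[\varepsilon](h,h',k,k')$ holds iff $h\models w\Rightarrow h\to_\varepsilon k$, $h'\models w\Rightarrow h'\to_\varepsilon k'$, and, if $h\sim_{\mathfrak l}h'$ for all $\mathrm{rd}_{\mathfrak l}\in\varepsilon$, then for each $\mathfrak l$ with $\mathrm{wr}_{\mathfrak l}\in\varepsilon$, $\mathrm{co}_{\mathfrak l}\notin\varepsilon$: $(h\simeq_{\mathfrak l}k\wedge h'\simeq_{\mathfrak l}k')\vee k\sim_{\mathfrak l}k'$. For a relation $E$ on $\mathbb V$, $(U,U')\in T_0(E,\varepsilon_1,\varepsilon_2,\varepsilon_3)$ iff the proponent wins the following game: for $\langle(h_1,k_1)\cdots(h_n,k_n),a\rangle\in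 U$ with $h_1\models w$ and $h_1'\models w$ with $h_1\sim_{\mathfrak l}h_1'$ for all $\mathrm{rd}_{\mathfrak l}\in\varepsilon_3$, both chosen by the opponent, the proponent plays $k_1'$ with $[\varepsilon_1](h_1,h_1',k_1,k_1')$, the opponent $h_2'$ with $[\varepsilon_2](k_1,k_1',h_2,h_2')$, the proponent $k_2'$ with $[\varepsilon_1](h_2,h_2',k_2,k_2')$, and so on up to $k_n'$; at the end $[\varepsilon_3](h_1,h_1',k_n,k_n')$ and, for some $a'$ with $a\mathrel E a'$, $\langle(h_1',k_1')\cdots(h_n',k_n'),a'\rangle\in U'$ must hold. $T(\dots)$ is the least superset of $T_0(\dots)$ closed under suprema of chains. Types are interpreted by $[\![\mathsf{unit}]\!]=\{((),())\}$, $[\![\mathsf{int}]\!]$ the equality of integers, products componentwise, and $v\mathrel{[\![\tau\xrightarrow{\varepsilon_1\mid\varepsilon_2\mid\varepsilon_3}\sigma]\!]}v'$ iff $v,v'$ are functions sending $[\![\tau]\!]$-related arguments to $T([\![\sigma]\!],\varepsilon_1,\varepsilon_2,\varepsilon_3)$-related computations. The Michael–Scott queue with root location $X$: in a heap $h$, $h(X)=X_0$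 is a location (the sentinel), $h(X_i)=(\mathit{elem}_i,\mathit{next}_i)$ with $\mathit{next}_i=X_{i+1}$ for $i<n$ and $\mathit{next}_n=\mathit{null}$, and the entries $\mathit{elem}_1,\dots,\mathit{elem}_n$ are integers; $\mathit{null}$ is some fixed integer. The abstract location $\mathfrak{msq}(X)$ is given by: $h\sim h'$ iff both contain such a queue with the same entries in the same order; $h\simeq h'$ iff moreover $h$ and $h'$ agree on every location that in $h$ or in $h'$ is $X$ or is reachable from, or co-reachable to, the sentinel along $\mathit{next}$ pointers; $h\to h_1$ iff both contain a queue and $h_1$ arises from $h$ by finitely many steps, each of which either only moves $h(X)$ to the next node or only attaches a new node with an integer entry, at a fresh location, to the end of the queue. Let $$\begin{aligned}\mathsf{dequeue}\,()={}&\mathsf{let\ rec}\ \mathsf{try}\,()=\mathsf{let}\ n_0=\,!X\ \mathsf{in\ if}\ (!n_0).\mathit{next}=\mathit{null}\ \mathsf{then}\ \mathit{null}\ \mathsf{else}\\&\ \mathsf{let}\ n_1=(!n_0).\mathit{next}\ \mathsf{in\ if}\ \mathsf{cas}(X,n_0,n_1)\ \mathsf{then}\ (!n_1).\mathit{elem}\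 \mathsf{else}\ \mathsf{try}\,()\ \ \mathsf{in}\ \mathsf{try}\,(),\\ \mathsf{enqueue}\,x={}&\mathsf{let\ rec}\ \mathsf{try}\,p=\mathsf{if}\ (!p).\mathit{next}=\mathit{null}\ \mathsf{then}\\&\ \ \mathsf{if\ atomic}(\mathsf{if}\ (!p).\mathit{next}=\mathit{null}\ \mathsf{then}\ (!p).\mathit{next}:=\mathsf{ref}(x,\mathit{null});\mathsf{true}\ \mathsf{else\ false})\\&\ \ \mathsf{then}\ ()\ \mathsf{else}\ \mathsf{try}((!p).\mathit{next})\ \ \mathsf{else}\ \mathsf{try}((!p).\mathit{next})\ \ \mathsf{in}\ \mathsf{try}(!X),\end{aligned}$$ let $\mathsf{atomic}\{f\}=\lambda x.\,\mathsf{atomic}(f\,x)$, and let $\mathit{MSQ}=\{\mathrm{rd}_{\mathfrak{msq}(X)},\mathrm{wr}_{\mathfrak{msq}(X)}\}$. **Theorem.** Let $w$ be any world with $\mathfrak{msq}(X)\in w$ in which silent steps never shrink the domain of the heap: $h\to_{\mathfrak l}k$ and $h\simeq_{\mathfrak l}k$ imply $\mathrm{dom}\,h\subseteq\mathrm{dom}\,k$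 for all $\mathfrak l\in w$. Then $(\mathit{MSQ},\mathit{MSQ},\mathit{MSQ})$ is an effect specification in $w$ (the three effects are well-formed, and the second is contained in the third), and: 1. For all $v,v'\in\{\mathsf{dequeue},\mathsf{atomic}\{\mathsf{dequeue}\}\}$, $([\![v]\!],[\![v']\!])\in[\![\mathsf{unit}\xrightarrow{\mathit{MSQ}\mid\mathit{MSQ}\mid\mathit{MSQ}}\mathsf{int}]\!]$. So both have this type, and they approximate each other at it, while the environment may concurrently read and write the queue. 2. For all $v,v'\in\{\mathsf{enqueue},\mathsf{atomic}\{\mathsf{enqueue}\}\}$, $([\![v]\!],[\![v']\!])\in[\![\mathsf{int}\xrightarrow{\mathit{MSQ}\mid\mathit{MSQ}\mid\mathit{MSQ}}\mathsf{unit}]\!]$. 3. (Linearizability) Let $\mathit{op}_1,\dots,\mathit{op}_n$ ($n\ge1$) each be $\mathsf{dequeue}\,()$ or $\mathsf{enqueue}\,m$ for an integer $m$, let $e=\mathit{op}_1\parallel\cdots\parallel\mathit{op}_n$, bracketed in any way, let $e'=\mathsf{atomic}(\mathit{op}_1)\parallel\cdots\parallel\mathsf{atomic}(\mathit{op}_n)$,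 bracketed in the same way, and let $\tau$ be the corresponding product of the result types ($\mathsf{int}$ for a dequeue, $\mathsf{unit}$ for an enqueue). For all $d,d'\in\{e,e'\}$, $([\![d]\!],[\![d']\!])\in T([\![\tau]\!],\mathit{MSQ},\mathit{MSQ},\mathit{MSQ})$; in particular $e$ and $e'$ approximate each other. -/

import Mathlib

/-! ### Locations, R-values, heaps -/

/-- Physical locations: a countably infinite set. -/
abbrev Loc := ℕ

/-- Atomic R-values. -/
inductive Atom where
  | int (n : ℤ)
  | bool (b : Bool)
  | loc (x : Loc)

/-- Storable values: integers, booleans, locations, and tuples of storable values. -/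
inductive RVal where
  | atom (a : Atom)
  | tup (n : ℕ) (vs : Fin n → RVal)

namespace RVal

def int (n : ℤ) : RVal := atom (Atom.int n)
def bool (b : Bool) : RVal := atom (Atom.bool b)
def loc (x : Loc) : RVal := atom (Atom.loc x)
def pair (v w : RVal) : RVal := tup 2 ![v, w]
def unit : RVal := tup 0 ![]

end RVal

/-- A heap is a finite partial map from locations to storable values. -/
structure Heap where
  get : Loc → Option RVal
  finite : {x | get x ≠ none}.Finite

namespace Heap

def dom (h : Heap) : Set Loc := {x | h.get x ≠ none}

/-- `h[x ↦ v]`. -/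
def set (h : Heap) (x : Loc) (v : RVal) : Heap where
  get := Function.update h.get x (some v)
  finite := by
    refine (h.finite.insert x).subset ?_
    intro y hy
    by_cases hxy : y = x
    · exact Or.inl hxy
    · right
      simpa [Function.update_of_ne hxy] using hy

end Heap

/-- An allocator: `new(h, v)` chooses the fresh location that is to hold `v`. -/
structure Allocator where
  new : Heap → RVal → Loc
  fresh : ∀ h v, new h v ∉ h.dom

/-! ### Traces -/

/-- Traces `(h₁,k₁)…(hₙ,kₙ)` with `n ≥ 1`, in which domains of heaps never shrink along
`h₁, k₁, h₂, k₂, …`. -/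
structure Trace where
  list : List (Heap × Heap)
  ne : list ≠ []
  mono : (list.flatMap fun p => [p.1, p.2]).Pairwise fun h k => h.dom ⊆ k.dom

/-- `SM t t'`: the trace `t'` arises from `t` by one stuttering or one mumbling. -/
inductive SM : Trace → Trace → Prop where
  | stutter (t t' : Trace) (u v : List (Heap × Heap)) (h : Heap)
      (ht : t.list = u ++ v) (ht' : t'.list = u ++ (h, h) :: v) : SM t t'
  | mumble (t t' : Trace) (u v : List (Heap × Heap)) (h q k : Heap)
      (ht : t.list = u ++ (h, q) :: (q, k) :: v) (ht' : t'.list = u ++ (h, k) :: v) : SM t t'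

/-- `Interleave t₁ t₂ t₃`: the list `t₃` is an interleaving of `t₁` and `t₂`. -/
inductive Interleave {α : Type} : List α → List α → List α → Prop where
  | nil : Interleave [] [] []
  | left (a : α) {t₁ t₂ t₃ : List α} : Interleave t₁ t₂ t₃ → Interleave (a :: t₁) t₂ (a :: t₃)
  | right (a : α) {t₁ t₂ t₃ : List α} : Interleave t₁ t₂ t₃ → Interleave t₁ (a :: t₂) (a :: t₃)

/-- The conditions [S&M], [Down] and [Sup]. -/
structure IsTClosed {A : Type} [PartialOrder A] (U : Set (Trace × A)) : Prop where
  sm : ∀ t t' a, SM t t' → (t, a) ∈ U → (t', a) ∈ U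
  down : ∀ t a b, b ≤ a → (t, a) ∈ U → (t, b) ∈ U
  sup : ∀ (t : Trace) (c : ℕ → A) (a : A), Monotone c → IsLUB (Set.range c) a →
    (∀ i, (t, c i) ∈ U) → (t, a) ∈ U

/-- The trace monad `T A`, ordered by inclusion. -/
abbrev TM (A : Type) [PartialOrder A] := {U : Set (Trace × A) // IsTClosed U}

/-- `U†`, the least element of `T A` that contains `U`. -/
def dagger {A : Type} [PartialOrder A] (U : Set (Trace × A)) : TM A :=
  ⟨⋂₀ {V | IsTClosed V ∧ U ⊆ V},
    { sm := fun t t' a hs h V hV => hV.1.sm t t' a hs (h V hV)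
      down := fun t a b hb h V hV => hV.1.down t a b hb (h V hV)
      sup := fun t c a hc ha h V hV => hV.1.sup t c a hc ha fun i => h i V hV }⟩

/-- `rtn(a) = {⟨(h,h),a⟩}†`. -/
def rtn {A : Type} [PartialOrder A] (a : A) : TM A :=
  dagger {p | ∃ h, p.1.list = [(h, h)] ∧ p.2 = a}

/-- `bnd(f,g) = {⟨uv,b⟩ ∣ ⟨u,a⟩ ∈ g, ⟨v,b⟩ ∈ f(a)}†`. -/
def bnd {A B : Type} [PartialOrder A] [PartialOrder B] (f : A → TM B) (g : TM A) : TM B :=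
  dagger {p | ∃ u v a, (u, a) ∈ g.1 ∧ (v, p.2) ∈ (f a).1 ∧ p.1.list = u.list ++ v.list}

/-- `fromstate(c) = {⟨(h,k),a⟩ ∣ c(h) = (k,a)}†` for a partial state transformer `c`. -/
def fromState {A : Type} [PartialOrder A] (c : Heap → Option (Heap × A)) : TM A :=
  dagger {p | ∃ h k, c h = some (k, p.2) ∧ p.1.list = [(h, k)]}

/-- `at(U) = {⟨(h,k),a⟩ ∣ ⟨(h,k),a⟩ ∈ U}†`. -/
def atomically {A : Type} [PartialOrder A] (U : TM A) : TM A :=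
  dagger {p | p ∈ U.1 ∧ ∃ h k, p.1.list = [(h, k)]}

/-! ### Semantic values

The predomain `V ≃ VB + (V → T V) + V*` is built as the ideal completion of its compact elements.
Tuples of R-values are identified with tuples of values whose components are R-values, so that
the first summand contributes the atoms only.  The compact elements are the atoms, the finite tuples of
compact elements and the finite joins of step functions `d ⇒ ⟨t,e⟩`; the step function `d ⇒ ⟨t,e⟩` sends `x` to
`{⟨t,e⟩}†` if `d ≤ x`, and to `∅` otherwise. -/

/-- Compact elements; `fn n d t e` is the join of the step functions `d i ⇒ ⟨t i, e i⟩`. -/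
inductive Cpt where
  | atom (a : Atom)
  | tup (n : ℕ) (vs : Fin n → Cpt)
  | fn (n : ℕ) (d : Fin n → Cpt) (t : Fin n → Trace) (e : Fin n → Cpt)

/-- The order on compact elements. A join of step functions is below another one iff each of its
step functions `d ⇒ ⟨t,e⟩` is below some step function `d' ⇒ ⟨t',e'⟩` of the other one, i.e. `d' ≤ d`,
`t` arises from `t'` by stuttering and mumbling, and `e ≤ e'`. -/
inductive Cpt.Le : Cpt → Cpt → Prop where
  | atom (a : Atom) : Cpt.Le (.atom a) (.atom a)
  | tup (n : ℕ) (a b : Fin n → Cpt) (h : ∀ i, Cpt.Le (a i) (b i)) :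
      Cpt.Le (.tup n a) (.tup n b)
  | fn (m n : ℕ) (d : Fin m → Cpt) (t : Fin m → Trace) (e : Fin m → Cpt)
      (d' : Fin n → Cpt) (t' : Fin n → Trace) (e' : Fin n → Cpt) (φ : Fin m → Fin n)
      (hd : ∀ i, Cpt.Le (d' (φ i)) (d i))
      (ht : ∀ i, Relation.ReflTransGen SM (t' (φ i)) (t i))
      (he : ∀ i, Cpt.Le (e i) (e' (φ i))) :
      Cpt.Le (.fn m d t e) (.fn n d' t' e')

theorem Cpt.Le.rfl' (a : Cpt) : Cpt.Le a a := by
  induction a with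
  | atom a => exact .atom a
  | tup n vs ih => exact .tup n vs vs ih
  | fn n d t e ihd ihe => exact .fn n n d t e d t e id ihd (fun _ => .refl) ihe

theorem Cpt.Le.trans' (b : Cpt) : ∀ a c, Cpt.Le a b → Cpt.Le b c → Cpt.Le a c := by
  induction b with
  | atom x =>
    intro a c h₁ h₂
    cases h₁; exact h₂
  | tup n vs ih =>
    intro a c h₁ h₂
    cases h₁ with
    | tup _ a' _ h =>
      cases h₂ with
      | tup _ _ c' h' => exact .tup n a' c' fun i => ih i _ _ (h i) (h' i)
  | fn n d t e ihd ihe =>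
    intro a c h₁ h₂
    cases h₁ with
    | fn m _ d₁ t₁ e₁ _ _ _ φ hd ht he =>
      cases h₂ with
      | fn _ k _ _ _ d₂ t₂ e₂ ψ hd' ht' he' =>
        exact .fn m k d₁ t₁ e₁ d₂ t₂ e₂ (fun i => ψ (φ i))
          (fun i => ihd (φ i) _ _ (hd' (φ i)) (hd i))
          (fun i => (ht' (φ i)).trans (ht i))
          (fun i => ihe (φ i) _ _ (he i) (he' (φ i)))

instance : Preorder Cpt where
  le := Cpt.Le
  le_refl := Cpt.Le.rfl'
  le_trans a b c := Cpt.Le.trans' b a c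

/-- Semantic values. -/
abbrev V := Order.Ideal Cpt

namespace V

/-- The ideal generated by a non-empty directed set of compact elements. -/
def gen (S : Set Cpt) (hne : S.Nonempty) (hdir : DirectedOn (· ≤ ·) S) : V where
  carrier := {c | ∃ s ∈ S, c ≤ s}
  lower' := fun _ _ hba ⟨s, hs, has⟩ => ⟨s, hs, le_trans hba has⟩
  nonempty' := hne.imp fun s hs => ⟨s, hs, le_rfl⟩
  directed' := by
    rintro a ⟨s, hs, has⟩ b ⟨s', hs', hbs'⟩
    obtain ⟨r, hr, h₁, h₂⟩ := hdir s hs s' hs'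
    exact ⟨r, ⟨r, hr, le_rfl⟩, le_trans has h₁, le_trans hbs' h₂⟩

def ofAtom (a : Atom) : V := Order.Ideal.principal (Cpt.atom a)
def int (n : ℤ) : V := ofAtom (Atom.int n)
def bool (b : Bool) : V := ofAtom (Atom.bool b)
def loc (x : Loc) : V := ofAtom (Atom.loc x)

/-- The tuple with components `ds`. -/
def tup (n : ℕ) (ds : Fin n → V) : V :=
  gen {c | ∃ a : Fin n → Cpt, (∀ i, a i ∈ ds i) ∧ c = Cpt.tup n a}
    (by
      choose a ha using fun i => (ds i).nonempty
      exact ⟨_, a, ha, rfl⟩)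
    (by
      rintro _ ⟨a, ha, rfl⟩ _ ⟨b, hb, rfl⟩
      choose r hr h₁ h₂ using fun i => (ds i).directed (a i) (ha i) (b i) (hb i)
      exact ⟨_, ⟨r, hr, rfl⟩, Cpt.Le.tup n a r h₁, Cpt.Le.tup n b r h₂⟩)

def pair (v w : V) : V := tup 2 ![v, w]
def unit : V := tup 0 ![]

/-- The function value `fun(f)`, generated by the finite joins of step functions below `f`. -/
def fn (f : V → TM V) : V :=
  gen {c | ∃ (n : ℕ) (d : Fin n → Cpt) (t : Fin n → Trace) (e : Fin n → Cpt),
        (∀ i, (t i, Order.Ideal.principal (e i)) ∈ (f (Order.Ideal.principal (d i))).1) ∧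
        c = Cpt.fn n d t e}
    ⟨_, 0, Fin.elim0, Fin.elim0, Fin.elim0, fun i => i.elim0, rfl⟩
    (by
      rintro _ ⟨m, d, t, e, h, rfl⟩ _ ⟨n, d', t', e', h', rfl⟩
      refine ⟨_, ⟨m + n, Fin.append d d', Fin.append t t', Fin.append e e', ?_, rfl⟩, ?_, ?_⟩
      · intro i
        induction i using Fin.addCases with
        | left i => simpa using h i
        | right i => simpa using h' i
      · refine Cpt.Le.fn _ _ _ _ _ _ _ _ (Fin.castAdd n) ?_ ?_ ?_ <;> intro i <;> simp
        · exact Cpt.Le.rfl' _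
        · exact .refl
        · exact Cpt.Le.rfl' _
      · refine Cpt.Le.fn _ _ _ _ _ _ _ _ (Fin.natAdd m) ?_ ?_ ?_ <;> intro i <;> simp
        · exact Cpt.Le.rfl' _
        · exact .refl
        · exact Cpt.Le.rfl' _)

/-- `v` is a function value. -/
def IsFun (v : V) : Prop := ∃ n d t e, Cpt.fn n d t e ∈ v

/-- Application of a value to a value; it is `∅` if `v` is not a function value. -/
def app (v x : V) : TM V :=
  dagger {p | ∃ (n : ℕ) (d : Fin n → Cpt) (t : Fin n → Trace) (e : Fin n → Cpt) (i : Fin n),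
    Cpt.fn n d t e ∈ v ∧ d i ∈ x ∧ p = (t i, Order.Ideal.principal (e i))}

end V

/-! `V` solves the domain equation: every value is an atom, a tuple or a function value, and `fn` and `app`
are mutually inverse between continuous functions and function values. -/

instance : Countable Atom :=
  Function.Injective.countable (f := fun a : Atom => match a with
    | .int n => (Sum.inl n : ℤ ⊕ (Bool ⊕ ℕ)) | .bool b => .inr (.inl b) | .loc x => .inr (.inr x))
    (by rintro (_ | _ | _) (_ | _ | _) h <;> simp_all)

abbrev RVal.Arity : Atom ⊕ ℕ → Type
  | .inl _ => Fin 0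
  | .inr n => Fin n

instance : ∀ a, Fintype (RVal.Arity a)
  | .inl _ => inferInstanceAs (Fintype (Fin 0))
  | .inr n => inferInstanceAs (Fintype (Fin n))

instance : ∀ a, Encodable (RVal.Arity a)
  | .inl _ => inferInstanceAs (Encodable (Fin 0))
  | .inr n => inferInstanceAs (Encodable (Fin n))

def RVal.toW : RVal → WType RVal.Arity
  | .atom a => ⟨.inl a, Fin.elim0⟩
  | .tup n vs => ⟨.inr n, fun i => (vs i).toW⟩

theorem RVal.toW_injective : Function.Injective RVal.toW := by
  intro a
  induction a with
  | atom a => intro b h; cases b <;> simp_all [RVal.toW]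
  | tup n vs ih =>
    intro b h
    cases b with
    | atom a => simp_all [RVal.toW]
    | tup m ws =>
      simp only [RVal.toW, WType.mk.injEq, Sum.inr.injEq] at h
      obtain ⟨rfl, h⟩ := h
      congr 1
      funext i
      exact ih i (congrFun (eq_of_heq h) i)

instance : Countable RVal := by
  have := Encodable.ofCountable Atom
  exact RVal.toW_injective.countable

instance : Countable Heap := by
  classical
  have : Function.Injective fun h : Heap =>
      h.finite.toFinset.image (fun x => (x, h.get x)) := by
    rintro ⟨g, hg⟩ ⟨g', hg'⟩ h
    have e : ∀ x v, (g x = some v ↔ g' x = some v) := by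
      intro x v
      have := congrArg (fun s => (x, some v) ∈ s) h
      simp only [Finset.mem_image, Set.Finite.mem_toFinset, Set.mem_ofPred_eq, Prod.mk.injEq, eq_iff_iff] at this
      constructor
      · intro hx
        obtain ⟨y, _, rfl, h⟩ := this.1 ⟨x, by simp [hx], rfl, hx⟩
        exact h
      · intro hx
        obtain ⟨y, _, rfl, h⟩ := this.2 ⟨x, by simp [hx], rfl, hx⟩
        exact h
    congr
    funext x
    exact Option.ext (e x)
  exact this.countable

instance : Countable Trace :=
  Function.Injective.countable (f := Trace.list) (by rintro ⟨a, _, _⟩ ⟨b, _, _⟩ h; simpa using h)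
abbrev Cpt.Arity : Atom ⊕ (ℕ ⊕ (Σ n, Fin n → Trace)) → Type
  | .inl _ => Fin 0
  | .inr (.inl n) => Fin n
  | .inr (.inr ⟨n, _⟩) => Fin n ⊕ Fin n

instance : ∀ a, Fintype (Cpt.Arity a)
  | .inl _ => inferInstanceAs (Fintype (Fin 0))
  | .inr (.inl n) => inferInstanceAs (Fintype (Fin n))
  | .inr (.inr ⟨n, _⟩) => inferInstanceAs (Fintype (Fin n ⊕ Fin n))

instance : ∀ a, Encodable (Cpt.Arity a)
  | .inl _ => inferInstanceAs (Encodable (Fin 0))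
  | .inr (.inl n) => inferInstanceAs (Encodable (Fin n))
  | .inr (.inr ⟨n, _⟩) => inferInstanceAs (Encodable (Fin n ⊕ Fin n))

def Cpt.toW : Cpt → WType Cpt.Arity
  | .atom a => ⟨.inl a, Fin.elim0⟩
  | .tup n vs => ⟨.inr (.inl n), fun i => (vs i).toW⟩
  | .fn n d t e => ⟨.inr (.inr ⟨n, t⟩), Sum.elim (fun i => (d i).toW) (fun i => (e i).toW)⟩

theorem Cpt.toW_injective : Function.Injective Cpt.toW := by
  intro a
  induction a with
  | atom a => intro b h; cases b <;> simp_all [Cpt.toW]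
  | tup n vs ih =>
    intro b h
    cases b with
    | tup m ws =>
      simp only [Cpt.toW, WType.mk.injEq, Sum.inr.injEq, Sum.inl.injEq] at h
      obtain ⟨rfl, h⟩ := h
      congr 1
      funext i
      exact ih i (congrFun (eq_of_heq h) i)
    | _ => simp_all [Cpt.toW]
  | fn n d t e ihd ihe =>
    intro b h
    cases b with
    | fn m d' t' e' =>
      simp only [Cpt.toW, WType.mk.injEq, Sum.inr.injEq, Sigma.mk.injEq] at h
      obtain ⟨⟨rfl, ht⟩, h⟩ := h
      obtain rfl := eq_of_heq ht
      have h := eq_of_heq h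
      congr 1
      · funext i
        exact ihd i (congrFun h (.inl i))
      · funext i
        exact ihe i (congrFun h (.inr i))
    | _ => simp_all [Cpt.toW]

instance : Countable Cpt := by
  have := Encodable.ofCountable Atom
  have := Encodable.ofCountable (Σ n, Fin n → Trace)
  exact Cpt.toW_injective.countable

theorem subset_dagger {A : Type} [PartialOrder A] (U : Set (Trace × A)) : U ⊆ (dagger U).1 :=
  fun _ hp _ hV => hV.2 hp

theorem dagger_le {A : Type} [PartialOrder A] {U : Set (Trace × A)} {W : Set (Trace × A)}
    (hW : IsTClosed W) (h : U ⊆ W) : (dagger U).1 ⊆ W :=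
  fun _ hp => hp W ⟨hW, h⟩

theorem IsTClosed.sms {A : Type} [PartialOrder A] {U : Set (Trace × A)} (hU : IsTClosed U)
    {t t' : Trace} {a : A} (h : Relation.ReflTransGen SM t t') (ht : (t, a) ∈ U) :
    (t', a) ∈ U := by
  induction h with
  | refl => exact ht
  | tail _ h ih => exact hU.sm _ _ _ h ih

namespace V

theorem mem_of_isLUB {c : ℕ → V} {a : V} (hc : Monotone c) (ha : IsLUB (Set.range c) a) {e : Cpt}
    (he : e ∈ a) : ∃ i, e ∈ c i := by
  let u : V :=
    { carrier := {e | ∃ i, e ∈ c i}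
      lower' := fun _ _ hba ⟨i, hi⟩ => ⟨i, (c i).lower hba hi⟩
      nonempty' := let ⟨e, he⟩ := (c 0).nonempty; ⟨e, 0, he⟩
      directed' := by
        rintro x ⟨i, hi⟩ y ⟨j, hj⟩
        obtain ⟨z, hz, h₁, h₂⟩ := (c (max i j)).directed x (hc (le_max_left i j) hi) y
          (hc (le_max_right i j) hj)
        exact ⟨z, ⟨_, hz⟩, h₁, h₂⟩ }
  have : a ≤ u := ha.2 (by rintro _ ⟨i, rfl⟩ e he; exact ⟨i, he⟩)
  exact this he

/-- Explicit description of application. -/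
theorem mem_app {v x : V} {t : Trace} {e : Cpt} :
    (t, Order.Ideal.principal e) ∈ (app v x).1 ↔
    ∃ (n : ℕ) (d : Fin n → Cpt) (t' : Fin n → Trace) (e' : Fin n → Cpt) (i : Fin n),
      Cpt.fn n d t' e' ∈ v ∧ d i ∈ x ∧ Relation.ReflTransGen SM (t' i) t ∧ e ≤ e' i := by
  constructor
  · intro h
    have : (app v x).1 ⊆ {p | ∀ e ∈ p.2, ∃ (n : ℕ) (d : Fin n → Cpt) (t' : Fin n → Trace) (e' : Fin n → Cpt) (i : Fin n),
      Cpt.fn n d t' e' ∈ v ∧ d i ∈ x ∧ Relation.ReflTransGen SM (t' i) p.1 ∧ e ≤ e' i} := by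
      refine dagger_le ⟨?_, ?_, ?_⟩ ?_
      · intro t t' a hs h e he
        obtain ⟨n, d, t₁, e', i, h₁, h₂, h₃, h₄⟩ := h e he
        exact ⟨n, d, t₁, e', i, h₁, h₂, h₃.tail hs, h₄⟩
      · intro t a b hb h e he
        exact h e (hb he)
      · intro t c a hc ha h e he
        obtain ⟨i, hi⟩ := mem_of_isLUB hc ha he
        exact h i e hi
      · rintro _ ⟨n, d, t, e, i, h₁, h₂, rfl⟩ e'' he''
        exact ⟨n, d, t, e, i, h₁, h₂, .refl, he''⟩
    exact this h e (Order.Ideal.mem_principal_self)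
  · rintro ⟨n, d, t', e', i, h₁, h₂, h₃, h₄⟩
    refine (app v x).2.sms h₃ ((app v x).2.down _ _ _ ?_ (subset_dagger _ ⟨n, d, t', e', i, h₁, h₂, rfl⟩))
    simpa using h₄

/-- Every function value is `fn` of its application. -/
theorem fn_app {v : V} (hv : v.IsFun) : fn v.app = v := by
  have join : ∀ {c : Cpt}, c ∈ v → ∃ n d t e, Cpt.fn n d t e ∈ v ∧ c ≤ Cpt.fn n d t e := by
    intro c hc
    obtain ⟨n, d, t, e, h⟩ := hv
    obtain ⟨z, hz, h₁, h₂⟩ := v.directed _ hc _ h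
    cases h₂ with
    | fn _ n' _ _ _ d' t' e' => exact ⟨_, _, _, _, hz, h₁⟩
  refine le_antisymm ?_ ?_
  · rintro c ⟨_, ⟨n, d, t, e, h, rfl⟩, hc⟩
    refine v.lower hc ?_
    have key : ∀ S : Finset (Fin n), ∃ m d' t' e', Cpt.fn m d' t' e' ∈ v ∧ ∀ i ∈ S, ∃ j,
        d' j ≤ d i ∧ Relation.ReflTransGen SM (t' j) (t i) ∧ e i ≤ e' j := by
      intro S
      induction S using Finset.induction_on with
      | empty => obtain ⟨n, d, t, e, h⟩ := hv; exact ⟨n, d, t, e, h, by simp⟩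
      | insert i S _ ih =>
        obtain ⟨m, d', t', e', hm, hS⟩ := ih
        obtain ⟨n₂, d₂, t₂, e₂, j, h₁, h₂, h₃, h₄⟩ := mem_app.1 (h i)
        obtain ⟨z, hz, z₁, z₂⟩ := v.directed _ hm _ h₁
        cases z₁ with
        | fn _ k _ _ _ D T' E φ hd ht he =>
          cases z₂ with
          | fn _ _ _ _ _ _ _ _ ψ hd' ht' he' =>
          refine ⟨_, _, _, _, hz, ?_⟩
          intro i' hi'
          rcases Finset.mem_insert.1 hi' with rfl | hi'
          · exact ⟨ψ j, le_trans (hd' j) (by simpa using h₂), (ht' j).trans h₃, le_trans h₄ (he' j)⟩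
          · obtain ⟨l, a, b, c⟩ := hS i' hi'
            exact ⟨φ l, le_trans (hd l) a, (ht l).trans b, le_trans c (he l)⟩
    obtain ⟨m, d', t', e', hm, hS⟩ := key Finset.univ
    choose φ h₁ h₂ h₃ using fun i => hS i (Finset.mem_univ i)
    exact v.lower (Cpt.Le.fn _ _ _ _ _ _ _ _ φ h₁ h₂ h₃) hm
  · intro c hc
    obtain ⟨n, d, t, e, h, hce⟩ := join hc
    exact ⟨_, ⟨n, d, t, e, fun i => mem_app.2 ⟨n, d, t, e, i, h, by simp, .refl, le_rfl⟩, rfl⟩, hce⟩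

/-- Every ideal is the supremum of a chain of compact elements. -/
theorem exists_chain (x : V) : ∃ c : ℕ → Cpt,
    Monotone c ∧ (∀ i, c i ∈ x) ∧ ∀ a ∈ x, ∃ i, a ≤ c i := by
  classical
  have : Encodable {a // a ∈ x} := Encodable.ofCountable _
  have : Inhabited {a // a ∈ x} := ⟨⟨_, x.nonempty.some_mem⟩⟩
  have hd : Directed (· ≤ ·) (fun a : {a // a ∈ x} => a.1) := by
    rintro ⟨a, ha⟩ ⟨b, hb⟩
    obtain ⟨z, hz, h⟩ := x.directed a ha b hb
    exact ⟨⟨z, hz⟩, h⟩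
  refine ⟨fun n => (hd.sequence _ n).1, hd.sequence_mono, fun i => (hd.sequence _ i).2, fun a ha => ?_⟩
  exact ⟨_, hd.le_sequence ⟨a, ha⟩⟩

/-- For a continuous function `f`, the application of `fn f` is `f`. -/
theorem app_fn (f : V → TM V) (hm : Monotone f)
    (hc : ∀ (c : ℕ → V) (a : V), Monotone c → IsLUB (Set.range c) a → IsLUB (Set.range (f ∘ c)) (f a)) (x : V) :
    (fn f).app x = f x := by
  have lub : ∀ (x : V) (c : ℕ → Cpt), Monotone c → (∀ i, c i ∈ x) → (∀ a ∈ x, ∃ i, a ≤ c i) →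
      Monotone (fun i => (Order.Ideal.principal (c i) : V)) ∧ IsLUB (Set.range fun i => (Order.Ideal.principal (c i) : V)) x := by
    intro x c h₁ h₂ h₃
    refine ⟨fun i j hij => by simpa using h₁ hij, ?_, ?_⟩
    · rintro _ ⟨i, rfl⟩; simpa using h₂ i
    · intro y hy a ha
      obtain ⟨i, hi⟩ := h₃ a ha
      exact y.lower hi (by simpa using hy ⟨i, rfl⟩)
  refine le_antisymm ?_ ?_
  · refine dagger_le (f x).2 ?_
    rintro _ ⟨n, d, t, e, i, ⟨_, ⟨n', d', t', e', h, rfl⟩, hle⟩, hx, rfl⟩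
    cases hle with
    | fn _ _ _ _ _ _ _ _ φ hd ht he =>
      have h1 := hm (show (Order.Ideal.principal (d' (φ i)) : V) ≤ x by simpa using x.lower (hd i) hx) (h (φ i))
      refine (f x).2.sms (ht i) ((f x).2.down _ _ _ ?_ h1)
      exact Order.Ideal.principal_le_iff.2 (he i)
  · obtain ⟨c, h₁, h₂, h₃⟩ := exists_chain x
    obtain ⟨l₁, l₂⟩ := lub x c h₁ h₂ h₃
    refine (hc _ _ l₁ l₂).2 ?_
    rintro _ ⟨i, rfl⟩ ⟨t, y⟩ hty
    obtain ⟨c', h₁', h₂', h₃'⟩ := exists_chain y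
    obtain ⟨l₁', l₂'⟩ := lub y c' h₁' h₂' h₃'
    refine ((fn f).app x).2.sup t _ y l₁' l₂' fun j => ?_
    refine mem_app.2 ⟨1, fun _ => c i, fun _ => t, fun _ => c' j, 0, ?_, h₂ i, .refl, le_rfl⟩
    refine ⟨_, ⟨1, _, _, _, fun _ => ?_, rfl⟩, le_rfl⟩
    exact (f _).2.down _ _ _ (by simpa using h₂' j) hty

/-- Every value is an atom, a tuple or a function value. -/
theorem cases (v : V) : (∃ a, v = ofAtom a) ∨ (∃ n ds, v = tup n ds) ∨ v.IsFun := by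
  obtain ⟨c, hc⟩ := v.nonempty
  cases c with
  | atom a =>
    left
    refine ⟨a, le_antisymm ?_ (by simpa [ofAtom] using hc)⟩
    intro b hb
    obtain ⟨z, hz, h₁, h₂⟩ := v.directed _ hc _ hb
    cases h₁; exact h₂
  | fn n d t e => exact Or.inr (Or.inr ⟨n, d, t, e, hc⟩)
  | tup n vs =>
    right; left
    have key : ∀ b ∈ v, ∃ a, Cpt.tup n a ∈ v ∧ b ≤ Cpt.tup n a := by
      intro b hb
      obtain ⟨z, hz, h₁, h₂⟩ := v.directed _ hc _ hb
      cases h₁ with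
      | tup _ _ a h => exact ⟨a, hz, h₂⟩
    let ds : Fin n → V := fun i =>
      { carrier := {e | ∃ a, Cpt.tup n a ∈ v ∧ e ≤ a i}
        lower' := fun _ _ hba ⟨a, ha, h⟩ => ⟨a, ha, le_trans hba h⟩
        nonempty' := ⟨_, vs, hc, le_rfl⟩
        directed' := by
          rintro x ⟨a, ha, hx⟩ y ⟨b, hb, hy⟩
          obtain ⟨z, hz, h₁, h₂⟩ := v.directed _ ha _ hb
          cases h₁ with
          | tup _ _ c h => cases h₂ with
            | tup _ _ _ h' => exact ⟨c i, ⟨c, hz, le_rfl⟩, le_trans hx (h i), le_trans hy (h' i)⟩ }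
    refine ⟨n, ds, le_antisymm ?_ ?_⟩
    · intro b hb
      obtain ⟨a, ha, hba⟩ := key b hb
      exact ⟨_, ⟨a, fun i => ⟨a, ha, le_rfl⟩, rfl⟩, hba⟩
    · rintro b ⟨_, ⟨a, ha, rfl⟩, hb⟩
      choose a' ha' haa using ha
      have : ∀ S : Finset (Fin n), ∃ r, Cpt.tup n r ∈ v ∧ ∀ i ∈ S, a i ≤ r i := by
        intro S
        induction S using Finset.induction_on with
        | empty => exact ⟨vs, hc, by simp⟩
        | insert i S _ ih =>
          obtain ⟨r, hr, hS⟩ := ih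
          obtain ⟨z, hz, h₁, h₂⟩ := v.directed _ hr _ (ha' i)
          cases h₁ with
          | tup _ _ c h => cases h₂ with
            | tup _ _ _ h' =>
              refine ⟨c, hz, fun j hj => ?_⟩
              rcases Finset.mem_insert.1 hj with rfl | hj
              · exact le_trans (haa _) (h' _)
              · exact le_trans (hS j hj) (h j)
      obtain ⟨r, hr, h⟩ := this Finset.univ
      exact v.lower (le_trans hb (Cpt.Le.tup n a r fun i => h i (Finset.mem_univ i))) hr

end V

/-- R-values as compact elements. -/
def RVal.toCpt : RVal → Cpt
  | .atom a => .atom a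
  | .tup n vs => .tup n fun i => (vs i).toCpt

/-- R-values as semantic values. -/
def V.ofR (r : RVal) : V := Order.Ideal.principal r.toCpt

/-- `U | W = {⟨t₃,(a,b)⟩ ∣ inter(t₁,t₂,t₃), ⟨t₁,a⟩ ∈ U, ⟨t₂,b⟩ ∈ W}†`. -/
def parT (U W : TM V) : TM V :=
  dagger {p | ∃ t₁ t₂ a b, Interleave t₁.list t₂.list p.1.list ∧ (t₁, a) ∈ U.1 ∧ (t₂, b) ∈ W.1 ∧
    p.2 = V.pair a b}

/-! ### Syntax -/

/-- Built-in functions. -/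
inductive Prim where
  | add | sub | mul | le | eq | isInt | isBool | isLoc | isPair | isFun

/-- The partial functions `F_c`, as graphs: `c.Graph v w` means `F_c(v) = w`. -/
inductive Prim.Graph : Prim → V → V → Prop where
  | add (m n : ℤ) : Graph .add (V.pair (V.int m) (V.int n)) (V.int (m + n))
  | sub (m n : ℤ) : Graph .sub (V.pair (V.int m) (V.int n)) (V.int (m - n))
  | mul (m n : ℤ) : Graph .mul (V.pair (V.int m) (V.int n)) (V.int (m * n))
  | le (m n : ℤ) : Graph .le (V.pair (V.int m) (V.int n)) (V.bool (decide (m ≤ n)))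
  | eq (a : Atom) : Graph .eq (V.pair (V.ofAtom a) (V.ofAtom a)) (V.bool true)
  | ne (a b : Atom) (h : a ≠ b) : Graph .eq (V.pair (V.ofAtom a) (V.ofAtom b)) (V.bool false)
  | isInt (v : V) (h : ∃ n, v = V.int n) : Graph .isInt v (V.bool true)
  | notInt (v : V) (h : ¬ ∃ n, v = V.int n) : Graph .isInt v (V.bool false)
  | isBool (v : V) (h : ∃ b, v = V.bool b) : Graph .isBool v (V.bool true)
  | notBool (v : V) (h : ¬ ∃ b, v = V.bool b) : Graph .isBool v (V.bool false)
  | isLoc (v : V) (h : ∃ x, v = V.loc x) : Graph .isLoc v (V.bool true)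
  | notLoc (v : V) (h : ¬ ∃ x, v = V.loc x) : Graph .isLoc v (V.bool false)
  | isPair (v : V) (h : ∃ a b, v = V.pair a b) : Graph .isPair v (V.bool true)
  | notPair (v : V) (h : ¬ ∃ a b, v = V.pair a b) : Graph .isPair v (V.bool false)
  | isFun (v : V) (h : v.IsFun) : Graph .isFun v (V.bool true)
  | notFun (v : V) (h : ¬ v.IsFun) : Graph .isFun v (V.bool false)

mutual
/-- Value expressions; variables are natural numbers. -/
inductive Val where
  | var (x : ℕ)
  | pair (v w : Val)
  | rval (r : RVal)
  | prim (c : Prim)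
  | fst (v : Val)
  | snd (v : Val)
  | fix (f x : ℕ) (e : Tm)
/-- Computations. -/
inductive Tm where
  | val (v : Val)
  | letin (x : ℕ) (e₁ e₂ : Tm)
  | app (v w : Val)
  | ite (v : Val) (e₁ e₂ : Tm)
  | read (v : Val)
  | write (v w : Val)
  | ref (v : Val)
  | par (e₁ e₂ : Tm)
  | atomic (e : Tm)
end

/-! ### Denotational semantics -/

abbrev Env := ℕ → V

/-- `g‡ = sup_i gⁱ(⊥)` for an operator `g` on functions from values to computations. -/
def lfpT (g : (V → TM V) → (V → TM V)) : V → TM V :=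
  fun d => dagger {p | ∃ i : ℕ, p ∈ ((g^[i] fun _ => dagger ∅) d).1}

open Classical in
mutual
/-- The semantics of value expressions. -/
noncomputable def semV (al : Allocator) : Val → Env → V
  | .var x, ρ => ρ x
  | .pair v w, ρ => V.pair (semV al v ρ) (semV al w ρ)
  | .rval r, _ => V.ofR r
  | .prim c, _ => V.fn fun v => dagger {p | ∃ w, c.Graph v w ∧ p ∈ (rtn w).1}
  | .fst v, ρ => if h : ∃ d : V × V, semV al v ρ = V.pair d.1 d.2 then h.choose.1 else V.int 0
  | .snd v, ρ => if h : ∃ d : V × V, semV al v ρ = V.pair d.1 d.2 then h.choose.2 else V.int 0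
  | .fix f x e, ρ =>
      V.fn (lfpT fun u d =>
        semC al e (Function.update (Function.update ρ f (V.fn u)) x d))
/-- The semantics of computations. -/
noncomputable def semC (al : Allocator) : Tm → Env → TM V
  | .val v, ρ => rtn (semV al v ρ)
  | .letin x e₁ e₂, ρ => bnd (fun d => semC al e₂ (Function.update ρ x d)) (semC al e₁ ρ)
  | .app v w, ρ => V.app (semV al v ρ) (semV al w ρ)
  | .ite v e₁ e₂, ρ =>
      if semV al v ρ = V.bool true then semC al e₁ ρ
      else if semV al v ρ = V.bool false then semC al e₂ ρ
      else dagger ∅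
  | .read v, ρ =>
      if h : ∃ x, semV al v ρ = V.loc x then
        fromState fun k => (k.get h.choose).map fun r => (k, V.ofR r)
      else dagger ∅
  | .write v w, ρ =>
      if h : ∃ p : Loc × RVal, semV al v ρ = V.loc p.1 ∧ semV al w ρ = V.ofR p.2 then
        fromState fun k => some (k.set h.choose.1 h.choose.2, V.unit)
      else dagger ∅
  | .ref v, ρ =>
      if h : ∃ r, semV al v ρ = V.ofR r then
        fromState fun k =>
          some (k.set (al.new k h.choose) h.choose, V.loc (al.new k h.choose))
      else dagger ∅
  | .par e₁ e₂, ρ => parT (semC al e₁ ρ) (semC al e₂ ρ)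
  | .atomic e, ρ => atomically (semC al e ρ)
end

/-- The environment in which closed expressions are evaluated. -/
def env₀ : Env := fun _ => V.int 0

/-! ### Concurrent abstract locations, worlds, effects -/

/-- Concurrent abstract locations: the semantic equivalence `sem`, the strict equivalence `strict` and the
step relation `step`. -/
structure AbsLoc where
  sem : Heap → Heap → Prop
  strict : Heap → Heap → Prop
  step : Heap → Heap → Prop
  sem_symm : ∀ h k, sem h k → sem k h
  sem_trans : ∀ h k q, sem h k → sem k q → sem h q
  strict_symm : ∀ h k, strict h k → strict k h
  strict_trans : ∀ h k q, strict h k → strict k q → strict h q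
  strict_sem : ∀ h k, strict h k → sem h k
  step_refl : ∀ h, sem h h → step h h
  step_trans : ∀ h k q, step h k → step k q → step h q
  strict_refl : ∀ h, sem h h → strict h h
  step_sem : ∀ h k, step h k → sem h h ∧ sem k k

abbrev World := Set AbsLoc

/-- `h ⊨ w`, the largest relation with the two closure properties. -/
def Sat (w : World) (h : Heap) : Prop :=
  ∃ P : Heap → Prop, P h ∧
    ∀ k, P k → (∀ l ∈ w, l.sem k k) ∧
      ∀ l ∈ w, ∀ k₁, l.step k k₁ → (∀ l' ∈ w, l' ≠ l → l'.strict k k₁) ∧ P k₁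

/-- Elementary effects: reading, writing, chaotic access. -/
inductive ElemEff where
  | rd (l : AbsLoc)
  | wr (l : AbsLoc)
  | co (l : AbsLoc)

abbrev Effect := Set ElemEff

namespace Effect

def rds (ε : Effect) : Set AbsLoc := {l | ElemEff.rd l ∈ ε}
def wrs (ε : Effect) : Set AbsLoc := {l | ElemEff.wr l ∈ ε}
def cos (ε : Effect) : Set AbsLoc := {l | ElemEff.co l ∈ ε}

/-- Well-formedness of an effect in the world `w`. -/
def WF (w : World) (ε : Effect) : Prop :=
  ε.rds ∪ ε.wrs ∪ ε.cos ⊆ w ∧ ε.rds ∩ ε.cos = ∅ ∧ ε.cos ⊆ ε.wrs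

/-- The relation `→_ε` on heaps. -/
def Step (w : World) (ε : Effect) : Heap → Heap → Prop :=
  Relation.TransGen fun h k =>
    (∃ l ∈ ε.wrs, l.step h k) ∨ (∃ l ∈ w, l.step h k ∧ l.strict h k)

end Effect

/-- Effect specifications. -/
def IsEffSpec (w : World) (ε₁ ε₂ ε₃ : Effect) : Prop :=
  ε₁.WF w ∧ ε₂.WF w ∧ ε₃.WF w ∧ ε₂ ⊆ ε₃

/-- Tiling `[ε](h, h', k, k')`. -/
def Tile (w : World) (ε : Effect) (h h' k k' : Heap) : Prop :=
  (Sat w h → ε.Step w h k) ∧ (Sat w h' → ε.Step w h' k') ∧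
    ((∀ l ∈ ε.rds, l.sem h h') → ∀ l ∈ ε.wrs \ ε.cos,
      (l.strict h k ∧ l.strict h' k') ∨ l.sem k k')

/-! ### The logical relation -/

/-- The proponent wins the rest of the game: `(h,k) :: …` is the rest of the pilot trace, `h'` is the heap that
the opponent has played to match `h`, `acc` is the response so far, and `fin kₙ kₙ' r` is the condition
checked at the end, where `r` is the whole response. -/
def Wins (w : World) (ε₁ ε₂ : Effect) (fin : Heap → Heap → List (Heap × Heap) → Prop) :
    List (Heap × Heap) → Heap → List (Heap × Heap) → Prop
  | [], _, _ => False
  | [(h, k)], h', acc => ∃ k', Tile w ε₁ h h' k k' ∧ fin k k' (acc ++ [(h', k')])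
  | (h, k) :: (h₂, k₂) :: r, h', acc =>
      ∃ k', Tile w ε₁ h h' k k' ∧
        ∀ h₂', Tile w ε₂ k k' h₂ h₂' →
          Wins w ε₁ ε₂ fin ((h₂, k₂) :: r) h₂' (acc ++ [(h', k')])

/-- The relation `T₀(E, ε₁, ε₂, ε₃)`. -/
def T₀ (w : World) (E : V → V → Prop) (ε₁ ε₂ ε₃ : Effect) : Set (TM V × TM V) :=
  {U | ∀ t a, (t, a) ∈ U.1.1 → ∀ h₁, (t.list.head t.ne).1 = h₁ → Sat w h₁ →
    ∀ h₁', Sat w h₁' → (∀ l ∈ ε₃.rds, l.sem h₁ h₁') →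
      Wins w ε₁ ε₂
        (fun k k' r => Tile w ε₃ h₁ h₁' k k' ∧
          ∃ a' t', E a a' ∧ t'.list = r ∧ (t', a') ∈ U.2.1)
        t.list h₁' []}

/-- `Adm(P)`, the least superset of `P` closed under suprema of ascending chains. -/
inductive Adm {A : Type} [PartialOrder A] (P : Set A) : A → Prop where
  | of (a : A) (h : a ∈ P) : Adm P a
  | sup (c : ℕ → A) (a : A) (hc : Monotone c) (ha : IsLUB (Set.range c) a)
      (h : ∀ i, Adm P (c i)) : Adm P a

/-- The relation `T(E, ε₁, ε₂, ε₃) = Adm(T₀(E, ε₁, ε₂, ε₃))`. -/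
def TRel (w : World) (E : V → V → Prop) (ε₁ ε₂ ε₃ : Effect) (U U' : TM V) : Prop :=
  Adm (T₀ w E ε₁ ε₂ ε₃) (U, U')

/-- Refined types; `arrow τ ε₁ ε₂ ε₃ σ` is the type of functions from `τ` to `σ` with effect specification
`(ε₁, ε₂, ε₃)`. -/
inductive Ty where
  | unit
  | int
  | bool
  | prod (τ σ : Ty)
  | arrow (τ : Ty) (ε₁ ε₂ ε₃ : Effect) (σ : Ty)

/-- The value specification of a type in the world `w`. -/
def Ty.sem (w : World) : Ty → V → V → Prop
  | .unit, v, v' => v = V.unit ∧ v' = V.unit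
  | .int, v, v' => ∃ n, v = V.int n ∧ v' = V.int n
  | .bool, v, v' => ∃ b, v = V.bool b ∧ v' = V.bool b
  | .prod τ σ, v, v' => ∃ a b a' b', v = V.pair a b ∧ v' = V.pair a' b' ∧
      τ.sem w a a' ∧ σ.sem w b b'
  | .arrow τ ε₁ ε₂ ε₃ σ, v, v' => v.IsFun ∧ v'.IsFun ∧
      ∀ x x', τ.sem w x x' → TRel w (σ.sem w) ε₁ ε₂ ε₃ (v.app x) (v'.app x')

/-! ### The Michael-Scott queue

Layout: the root `X` holds the location of the sentinel, a node holds the pair `(elem, next)`, and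
`null` is an integer `nl`. -/

namespace MSQ

/-- The `next` component of the node at `x`. -/
def Next (h : Heap) (x : Loc) (v : RVal) : Prop := ∃ e, h.get x = some (RVal.pair e v)

/-- The `elem` component of the node at `x`. -/
def Elem (h : Heap) (x : Loc) (v : RVal) : Prop := ∃ n, h.get x = some (RVal.pair v n)

/-- The nodes following `x` up to the end of the list are the first components of `l`, and their elements are the
second components. -/
def Chain (nl : ℤ) (h : Heap) : Loc → List (Loc × ℤ) → Prop
  | x, [] => Next h x (RVal.int nl)
  | x, (y, v) :: l => Next h x (RVal.loc y) ∧ Elem h y (RVal.int v) ∧ Chain nl h y l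

/-- `List(X, h, (X₀,…,Xₙ), (v₁,…,vₙ))` with `x₀ = X₀` and `l = [(X₁,v₁),…,(Xₙ,vₙ)]`. -/
def IsQueue (nl : ℤ) (X : Loc) (h : Heap) (x₀ : Loc) (l : List (Loc × ℤ)) : Prop :=
  h.get X = some (RVal.loc x₀) ∧ Chain nl h x₀ l

/-- `x'` can be reached from `x` by following `next` pointers. -/
def Reach (h : Heap) : Loc → Loc → Prop :=
  Relation.ReflTransGen fun x y => Next h x (RVal.loc y)

/-- The footprint: the root, and the nodes reachable or co-reachable from the sentinel to which it points. -/
def fp (X : Loc) (h : Heap) : Set Loc :=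
  {x | x = X ∨ ∃ x₀, h.get X = some (RVal.loc x₀) ∧ (Reach h x₀ x ∨ Reach h x x₀)}

/-- `h` and `h'` hold queues with the same entries. -/
def Sem (nl : ℤ) (X : Loc) (h h' : Heap) : Prop :=
  ∃ x₀ l x₀' l', IsQueue nl X h x₀ l ∧ IsQueue nl X h' x₀' l' ∧
    l.map Prod.snd = l'.map Prod.snd

/-- `h` and `h'` moreover agree on the footprint of the queue. -/
def Strict (nl : ℤ) (X : Loc) (h h' : Heap) : Prop :=
  Sem nl X h h' ∧ ∀ x ∈ fp X h ∪ fp X h', h.get x = h'.get x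

/-- `h₁` arises from `h` by attaching a new node with entry `v` at the end of the queue. -/
def Snoc (nl : ℤ) (X : Loc) (h h₁ : Heap) (v : ℤ) : Prop :=
  ∃ x₀ l e y, IsQueue nl X h x₀ l ∧ y ∉ h.dom ∧
    h.get ((x₀ :: l.map Prod.fst).getLast (by simp)) = some (RVal.pair e (RVal.int nl)) ∧
    h₁ = (h.set y (RVal.pair (RVal.int v) (RVal.int nl))).set
      ((x₀ :: l.map Prod.fst).getLast (by simp)) (RVal.pair e (RVal.loc y))

/-- One dequeue (the root moves to the next node, and nothing else changes) or one enqueue. -/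
def Step₁ (nl : ℤ) (X : Loc) (h h₁ : Heap) : Prop :=
  (∃ x₀ x₁, h.get X = some (RVal.loc x₀) ∧ Next h x₀ (RVal.loc x₁) ∧
    h₁ = h.set X (RVal.loc x₁)) ∨
  ∃ v, Snoc nl X h h₁ v

def Step (nl : ℤ) (X : Loc) (h h₁ : Heap) : Prop :=
  Sem nl X h h ∧ Sem nl X h₁ h₁ ∧ Relation.ReflTransGen (Step₁ nl X) h h₁

theorem pair_inj {a b c d : RVal} (h : RVal.pair a b = RVal.pair c d) : a = c ∧ b = d := by
  simp only [RVal.pair, RVal.tup.injEq, heq_eq_eq, true_and] at h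
  exact ⟨congrFun h 0, congrFun h 1⟩

theorem Next.inj {h : Heap} {x : Loc} {v w : RVal} (hv : Next h x v) (hw : Next h x w) :
    v = w := by
  obtain ⟨e, he⟩ := hv
  obtain ⟨e', he'⟩ := hw
  rw [he] at he'
  exact (pair_inj (Option.some.inj he')).2

theorem Elem.inj {h : Heap} {x : Loc} {v w : RVal} (hv : Elem h x v) (hw : Elem h x w) :
    v = w := by
  obtain ⟨e, he⟩ := hv
  obtain ⟨e', he'⟩ := hw
  rw [he] at he'
  exact (pair_inj (Option.some.inj he')).1

theorem Chain.inj {nl : ℤ} {h : Heap} : ∀ {x : Loc} {l l' : List (Loc × ℤ)},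
    Chain nl h x l → Chain nl h x l' → l = l'
  | _, [], [], _, _ => rfl
  | _, [], (_, _) :: _, h₁, h₂ => by
    have := Next.inj h₁ h₂.1
    simp [RVal.int, RVal.loc] at this
  | _, (_, _) :: _, [], h₁, h₂ => by
    have := Next.inj h₂ h₁.1
    simp [RVal.int, RVal.loc] at this
  | _, (y, v) :: l, (y', v') :: l', h₁, h₂ => by
    have e₁ := Next.inj h₁.1 h₂.1
    simp only [RVal.loc, RVal.atom.injEq, Atom.loc.injEq] at e₁
    subst e₁
    have e₂ := Elem.inj h₁.2.1 h₂.2.1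
    simp only [RVal.int, RVal.atom.injEq, Atom.int.injEq] at e₂
    subst e₂
    rw [Chain.inj h₁.2.2 h₂.2.2]

theorem Sem.symm {nl : ℤ} {X : Loc} {h k : Heap} (H : Sem nl X h k) : Sem nl X k h := by
  obtain ⟨x, l, x', l', a, b, c⟩ := H
  exact ⟨x', l', x, l, b, a, c.symm⟩

theorem Sem.trans {nl : ℤ} {X : Loc} {h k q : Heap} (H : Sem nl X h k) (H' : Sem nl X k q) :
    Sem nl X h q := by
  obtain ⟨x, l, x', l', a, b, c⟩ := H
  obtain ⟨y, m, y', m', a', b', c'⟩ := H'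
  have e := b.1.symm.trans a'.1
  simp only [RVal.loc, Option.some.injEq, RVal.atom.injEq, Atom.loc.injEq] at e
  subst e
  have e := Chain.inj b.2 a'.2
  subst e
  exact ⟨x, l, y', m', a, b', c.trans c'⟩

theorem fp_subset {X : Loc} {h k : Heap} (H : ∀ x ∈ fp X h, h.get x = k.get x) :
    fp X h ⊆ fp X k := by
  rintro x (rfl | ⟨x₀, h₀, hx | hx⟩)
  · exact Or.inl rfl
  · refine Or.inr ⟨x₀, (H X (Or.inl rfl)) ▸ h₀, Or.inl ?_⟩
    induction hx with
    | refl => exact .refl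
    | tail hab hbc ih =>
      refine ih.tail ?_
      obtain ⟨e, he⟩ := hbc
      exact ⟨e, (H _ (Or.inr ⟨x₀, h₀, Or.inl hab⟩)) ▸ he⟩
  · refine Or.inr ⟨x₀, (H X (Or.inl rfl)) ▸ h₀, Or.inr ?_⟩
    induction hx using Relation.ReflTransGen.head_induction_on with
    | refl => exact .refl
    | head hab hbc ih =>
      refine Relation.ReflTransGen.head ?_ ih
      have hm := H _ (Or.inr ⟨x₀, h₀, Or.inr (Relation.ReflTransGen.head hab hbc)⟩)
      obtain ⟨e, he⟩ := hab
      exact ⟨e, hm ▸ he⟩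

/-- The concurrent abstract location `msq(X)`. -/
def loc (nl : ℤ) (X : Loc) : AbsLoc where
  sem := Sem nl X
  strict := Strict nl X
  step := Step nl X
  sem_symm _ _ H := H.symm
  sem_trans _ _ _ H H' := H.trans H'
  strict_symm _ _ H := ⟨H.1.symm, fun x hx => (H.2 x hx.symm).symm⟩
  strict_trans h k q H H' := by
    refine ⟨H.1.trans H'.1, ?_⟩
    have A : ∀ x ∈ fp X h, h.get x = q.get x := fun x hx =>
      (H.2 x (Or.inl hx)).trans
        (H'.2 x (Or.inl (fp_subset (fun y hy => H.2 y (Or.inl hy)) hx)))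
    have B : ∀ x ∈ fp X q, h.get x = q.get x := fun x hx =>
      (H.2 x (Or.inr (fp_subset (fun y hy => (H'.2 y (Or.inr hy)).symm) hx))).trans
        (H'.2 x (Or.inr hx))
    rintro x (hx | hx)
    exacts [A x hx, B x hx]
  strict_sem _ _ H := H.1
  step_refl _ H := ⟨H, H, .refl⟩
  step_trans _ _ _ H H' := ⟨H.1, H'.2.1, H.2.2.trans H'.2.2⟩
  strict_refl _ H := ⟨H, fun _ _ => rfl⟩
  step_sem _ _ H := ⟨H.1, H.2.1⟩

/-- The effect `MSQ = {rd msq(X), wr msq(X)}`. -/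
def eff (nl : ℤ) (X : Loc) : Effect := {ElemEff.rd (loc nl X), ElemEff.wr (loc nl X)}

end MSQ

/-! ### The programs -/

namespace Prog

def unitV : Val := .rval RVal.unit
def boolT (b : Bool) : Tm := .val (.rval (RVal.bool b))

/-- `λ x. e`; the name `99` of the function itself is not used in `e`. -/
def lam (x : ℕ) (e : Tm) : Val := .fix 99 x e

/-- `v = w` on simple values. -/
def eqT (v w : Val) : Tm := .app (.prim .eq) (.pair v w)

/-- `cas(x, v, w) = atomic(if !x = v then x := w; true else false)`; the variables `90`, `91` and `92`
do not occur in `x`, `v`, `w`. -/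
def cas (x v w : Val) : Tm :=
  .atomic
    (.letin 90 (.read x)
    (.letin 91 (eqT (.var 90) v)
    (.ite (.var 91)
      (.letin 92 (.write x w) (boolT true))
      (boolT false))))

/-- The body of `dequeue`'s recursive function `try` (variable `1`, with dummy argument `2`). -/
def deqBody (nl : ℤ) (X : Loc) : Tm :=
  -- let n₀ = !X in if (!n₀).next = null then null
  .letin 3 (.read (.rval (RVal.loc X)))
  (.letin 4 (.read (.var 3))
  (.letin 5 (eqT (.snd (.var 4)) (.rval (RVal.int nl)))
  (.ite (.var 5) (.val (.rval (RVal.int nl)))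
    -- else let n₁ = (!n₀).next in if cas(X, n₀, n₁) then (!n₁).elem else try ()
    (.letin 6 (.read (.var 3))
    (.letin 7 (.val (.snd (.var 6)))
    (.letin 8 (cas (.rval (RVal.loc X)) (.var 3) (.var 7))
    (.ite (.var 8)
      (.letin 9 (.read (.var 7)) (.val (.fst (.var 9))))
      (.app (.var 1) unitV))))))))

/-- `dequeue`. -/
def dequeue (nl : ℤ) (X : Loc) : Val :=
  lam 0 (.letin 1 (.val (.fix 1 2 (deqBody nl X))) (.app (.var 1) unitV))

/-- The body of `enqueue`'s recursive function `try` (variable `1`, with argument `p`, the variable `2`); the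
variable `0` is the argument of `enqueue`. -/
def enqBody (nl : ℤ) : Tm :=
  -- if (!p).next = null then
  .letin 3 (.read (.var 2))
  (.letin 4 (eqT (.snd (.var 3)) (.rval (RVal.int nl)))
  (.ite (.var 4)
    -- if atomic(if (!p).next = null then (!p).next := ref (x, null); true else false)
    (.letin 5
      (.atomic
        (.letin 6 (.read (.var 2))
        (.letin 7 (eqT (.snd (.var 6)) (.rval (RVal.int nl)))
        (.ite (.var 7)
          (.letin 8 (.ref (.pair (.var 0) (.rval (RVal.int nl))))
          (.letin 9 (.write (.var 2) (.pair (.fst (.var 6)) (.var 8)))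
          (boolT true)))
          (boolT false)))))
    (.ite (.var 5)
      -- then () else try ((!p).next)
      (.val unitV)
      (.letin 10 (.read (.var 2)) (.app (.var 1) (.snd (.var 10))))))
    -- else try ((!p).next)
    (.letin 10 (.read (.var 2)) (.app (.var 1) (.snd (.var 10))))))

/-- `enqueue`. -/
def enqueue (nl : ℤ) (X : Loc) : Val :=
  lam 0 (.letin 1 (.val (.fix 1 2 (enqBody nl)))
    (.letin 11 (.read (.rval (RVal.loc X))) (.app (.var 1) (.var 11))))

/-- The atomic version `λ x. atomic(v x)` of a closed function value `v`. -/
def atomicV (v : Val) : Val := lam 0 (.atomic (.app v (.var 0)))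

/-- Finite parallel compositions `op₁ ∥ ⋯ ∥ opₙ` (`n ≥ 1`, bracketed in any way) of queue operations. -/
inductive Ops where
  | deq
  | enq (v : ℤ)
  | par (o o' : Ops)

/-- The parallel composition of the operations; if `b` is true, of their atomic versions. -/
def Ops.tm (nl : ℤ) (X : Loc) (b : Bool) : Ops → Tm
  | .deq => if b then .atomic (.app (dequeue nl X) unitV) else .app (dequeue nl X) unitV
  | .enq v =>
      if b then .atomic (.app (enqueue nl X) (.rval (RVal.int v)))
      else .app (enqueue nl X) (.rval (RVal.int v))
  | .par o o' => .par (o.tm nl X b) (o'.tm nl X b)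

/-- The type of the result. -/
def Ops.ty : Ops → Ty
  | .deq => .int
  | .enq _ => .unit
  | .par o o' => .prod o.ty o'.ty

end Prog

/-! ### R-values as semantic values -/

-- Every completed run of a queue operation has exactly one step that matters, its linearization
-- point: for a dequeue, the successful `cas` or the read of a null `next` field; for an enqueue,
-- the successful atomic block. The proponent answers this step by performing the whole operation at
-- once on the other heap, and answers every other step by doing nothing. This works against any
-- implementation on the response side that can perform the operation without interruption, and both
-- the plain and the atomic version can: the former by mumbling its steps together, the latter by
-- definition. So each operation needs two facts, collected in `Implements`: a statement about all
-- pilot traces, whichever the environment (`Triple.dequeue`, `Triple.enqueue`), and the existence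
-- of one uninterrupted run for the response (`Run.dequeue`, `Run.enqueue`). Combining the first
-- fact for one version with the second for another gives all required approximations.
--
-- The pilot's side is a rely-guarantee argument. Since the three effects coincide, tiles between
-- matching heaps are just pairs of effect steps that end in matching heaps (`Tile.mv`), and a move
-- of one thread is an admissible environment move for the other. The responses still available are
-- kept as a language `Q` that is differentiated at every move; an operation is `Pending` while `Q`
-- contains all its one-step executions, and `Done` once `Q` contains the empty response. Winning is
-- preserved by stuttering and mumbling (`Game.stutter`, `Game.mumble`), so it extends to the
-- closure of a set of traces (`Triple.dagger`), and by interleaving (`Game.par`), which yields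
-- parallel compositions by induction.
--
-- What makes the programs correct is that the environment cannot undo what they have seen (`Adv`):
-- nodes connected to the sentinel remain so, a node behind the sentinel stays behind it, and
-- entries and non-null `next` fields of nodes never change. A null `next` field in a node
-- identifies it as the last one (`Node.cases`), and in a node behind the sentinel it shows that the
-- queue is empty (`Behind.cases`).
--
-- All arguments and results are R-values, which are isolated points of the order on values;
-- therefore neither continuity nor the closure conditions on results cause any work.

theorem RVal.eq_of_le_toCpt {c : Cpt} {r : RVal} (h : c ≤ r.toCpt) : c = r.toCpt := by
  induction r generalizing c with
  | atom a => cases h; rfl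
  | tup n vs ih =>
    cases h with
    | tup _ a _ h => exact congrArg _ (funext fun i => ih i (h i))

theorem RVal.eq_of_toCpt_le {c : Cpt} {r : RVal} (h : r.toCpt ≤ c) : c = r.toCpt := by
  induction r generalizing c with
  | atom a => cases h; rfl
  | tup n vs ih =>
    cases h with
    | tup _ _ a h => exact congrArg _ (funext fun i => ih i (h i))

theorem RVal.toCpt_injective : Function.Injective RVal.toCpt := by
  intro r s h
  induction r generalizing s with
  | atom a => cases s with
    | atom b => simpa [RVal.toCpt] using h
    | tup => simp [RVal.toCpt] at h
  | tup n vs ih => cases s with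
    | atom b => simp [RVal.toCpt] at h
    | tup m ws =>
      simp only [RVal.toCpt, Cpt.tup.injEq] at h
      obtain ⟨rfl, h⟩ := h
      exact congrArg _ (funext fun i => ih i (congrFun (eq_of_heq h) i))

namespace V

theorem mem_ofR {c : Cpt} {r : RVal} : c ∈ ofR r ↔ c = r.toCpt :=
  ⟨fun h => RVal.eq_of_le_toCpt (by simpa [ofR] using h), fun h => by simp [ofR, h]⟩

/-- Together with `eq_ofR_of_ge` this makes R-values isolated: [Down] and [Sup] cannot change a
result that is an R-value, so only stuttering and mumbling matter in closure arguments. -/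
theorem eq_ofR_of_le {v : V} {r : RVal} (h : v ≤ ofR r) : v = ofR r := by
  refine le_antisymm h ?_
  obtain ⟨c, hc⟩ := v.nonempty
  intro d hd
  rw [mem_ofR.1 hd, ← mem_ofR.1 (h hc)]
  exact hc

theorem eq_ofR_of_mem {v : V} {r : RVal} (h : r.toCpt ∈ v) : v = ofR r := by
  refine eq_ofR_of_le fun b hb => ?_
  obtain ⟨z, -, h₁, h₂⟩ := v.directed _ h _ hb
  rw [RVal.eq_of_toCpt_le h₁] at h₂
  exact mem_ofR.2 (RVal.eq_of_le_toCpt h₂)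

theorem eq_ofR_of_ge {v : V} {r : RVal} (h : ofR r ≤ v) : v = ofR r :=
  eq_ofR_of_mem (h (mem_ofR.2 rfl))

theorem ofR_injective : Function.Injective ofR := fun _ _ h =>
  RVal.toCpt_injective (mem_ofR.1 (h ▸ mem_ofR.2 rfl))

theorem int_eq (n : ℤ) : V.int n = ofR (.int n) := rfl
theorem bool_eq (b : Bool) : V.bool b = ofR (.bool b) := rfl
theorem ofAtom_eq (a : Atom) : ofAtom a = ofR (.atom a) := rfl

theorem tup_ofR (n : ℕ) (rs : Fin n → RVal) : tup n (fun i => ofR (rs i)) = ofR (.tup n rs) :=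
  eq_ofR_of_mem ⟨_, ⟨_, fun _ => mem_ofR.2 rfl, rfl⟩, le_rfl⟩

theorem unit_eq : V.unit = ofR .unit := by
  rw [V.unit, RVal.unit, ← tup_ofR]
  exact congrArg _ (funext fun i => i.elim0)

theorem pair_ofR (r s : RVal) : V.pair (ofR r) (ofR s) = ofR (.pair r s) := by
  rw [V.pair, RVal.pair, ← tup_ofR]
  refine congrArg _ (funext fun i => ?_)
  fin_cases i <;> rfl

theorem tup_eq_ofR {n : ℕ} {ds : Fin n → V} {rs : Fin n → RVal}
    (h : tup n ds = ofR (.tup n rs)) (i : Fin n) : ds i = ofR (rs i) := by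
  have : (RVal.tup n rs).toCpt ∈ tup n ds := h ▸ mem_ofR.2 rfl
  obtain ⟨_, ⟨a, ha, rfl⟩, hle⟩ := this
  have := RVal.eq_of_toCpt_le hle
  simp only [RVal.toCpt, Cpt.tup.injEq, heq_eq_eq, true_and] at this
  exact eq_ofR_of_mem (congrFun this i ▸ ha i)

theorem pair_eq_ofR {a b : V} {r s : RVal} (h : V.pair a b = ofR (.pair r s)) :
    a = ofR r ∧ b = ofR s :=
  ⟨tup_eq_ofR h 0, tup_eq_ofR h 1⟩

theorem isFun_fn (f : V → TM V) : (V.fn f).IsFun :=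
  ⟨0, Fin.elim0, Fin.elim0, Fin.elim0, _, ⟨0, Fin.elim0, Fin.elim0, Fin.elim0, fun i => i.elim0, rfl⟩, le_rfl⟩

theorem app_mono {v v' : V} (h : v ≤ v') (x : V) : (app v x).1 ⊆ (app v' x).1 := by
  refine dagger_le (app v' x).2 ?_
  rintro _ ⟨n, d, t, e, i, h₁, h₂, rfl⟩
  exact subset_dagger _ ⟨n, d, t, e, i, h h₁, h₂, rfl⟩

/-- Application of a function value to an R-value; no continuity is needed. -/
theorem app_fn_ofR (f : V → TM V) (r : RVal) : app (V.fn f) (ofR r) = f (ofR r) := by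
  refine le_antisymm (dagger_le (f _).2 ?_) ?_
  · rintro _ ⟨n, d, t, e, i, ⟨_, ⟨n', d', t', e', h, rfl⟩, hle⟩, hx, rfl⟩
    cases hle with
    | fn _ _ _ _ _ _ _ _ φ hd ht he =>
      have h1 := h (φ i)
      -- Nothing lies strictly below an R-value, so the step function that dominates this one has
      -- the argument `r` itself; monotonicity of `f` is not needed.
      rw [RVal.eq_of_le_toCpt (le_of_le_of_eq (hd i) (mem_ofR.1 hx))] at h1
      exact (f _).2.sms (ht i) ((f _).2.down _ _ _ (Order.Ideal.principal_le_iff.2 (he i)) h1)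
  · rintro ⟨t, y⟩ hty
    -- Results of `f` need not be compact, but step functions only produce compact ones; the result
    -- is recovered by [Sup] from a chain of compact elements.
    obtain ⟨c, h₁, h₂, h₃⟩ := exists_chain y
    refine (app (V.fn f) (ofR r)).2.sup t (fun i => Order.Ideal.principal (c i)) y
      (fun i j hij => by simpa using h₁ hij)
      ⟨by rintro _ ⟨i, rfl⟩; simpa using h₂ i, fun z hz a ha => ?_⟩ fun j => ?_
    · obtain ⟨i, hi⟩ := h₃ a ha
      exact z.lower hi (by simpa using hz ⟨i, rfl⟩)
    · refine subset_dagger _ ⟨1, fun _ => r.toCpt, fun _ => t, fun _ => c j, 0, ⟨_, ⟨1, _, _, _, fun _ => ?_, rfl⟩, le_rfl⟩, mem_ofR.2 rfl, rfl⟩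
      exact (f _).2.down _ _ _ (by simpa using h₂ j) hty

end V

/-! ### Languages of responses -/

/-- Domains never shrink along the list. -/
def MonoDom (r : List (Heap × Heap)) : Prop :=
  (r.flatMap fun p => [p.1, p.2]).Pairwise fun h k => h.dom ⊆ k.dom

theorem MonoDom.sublist {r r' : List (Heap × Heap)} (h : MonoDom r') (hs : List.Sublist r r') :
    MonoDom r :=
  List.Pairwise.sublist (hs.flatMap _) h

/-- Mumbling forgets the middle heap `q`; its domain must be known to lie in between before the
longer list can be seen as a trace. -/
theorem MonoDom.unmumble {u v : List (Heap × Heap)} {h q k : Heap} (hq : h.dom ⊆ q.dom)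
    (qk : q.dom ⊆ k.dom) (H : MonoDom (u ++ (h, k) :: v)) :
    MonoDom (u ++ (h, q) :: (q, k) :: v) := by
  simp only [MonoDom, List.flatMap_append, List.flatMap_cons, List.pairwise_append,
    List.pairwise_cons, List.cons_append, List.nil_append, List.mem_cons] at H ⊢
  obtain ⟨h₁, ⟨h₂, h₃, h₄⟩, h₅⟩ := H
  refine ⟨h₁, ⟨?_, ?_, ?_, h₃, h₄⟩, ?_⟩
  · rintro a (rfl | rfl | rfl | ha)
    exacts [hq, hq, hq.trans qk, h₂ _ (.inr ha)]
  · rintro a (rfl | rfl | ha)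
    exacts [subset_rfl, qk, qk.trans (h₃ _ ha)]
  · rintro a (rfl | ha)
    exacts [qk, qk.trans (h₃ _ ha)]
  · rintro a ha b (rfl | rfl | rfl | rfl | hb)
    exacts [h₅ a ha _ (.inl rfl), (h₅ a ha _ (.inl rfl)).trans hq, (h₅ a ha _ (.inl rfl)).trans hq,
      h₅ a ha _ (.inr (.inl rfl)), h₅ a ha _ (.inr (.inr hb))]

/-- Languages of responses with results, closed under stuttering and mumbling. -/
structure Lang where
  mem : List (Heap × Heap) → V → Prop
  stutter : ∀ u v h a, mem (u ++ v) a → mem (u ++ (h, h) :: v) a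
  mumble : ∀ u v h q k a, h.dom ⊆ q.dom → q.dom ⊆ k.dom →
    mem (u ++ (h, q) :: (q, k) :: v) a → mem (u ++ (h, k) :: v) a

namespace Lang

instance : LE Lang := ⟨fun Q Q' => ∀ r a, Q.mem r a → Q'.mem r a⟩

/-- The responses that may follow after the move `p`. -/
def der (Q : Lang) (p : Heap × Heap) : Lang where
  mem r a := Q.mem (p :: r) a
  stutter u v h a := Q.stutter (p :: u) v h a
  mumble u v h q k a := Q.mumble (p :: u) v h q k a

theorem der_mono {Q Q' : Lang} (h : Q ≤ Q') (p : Heap × Heap) : Q.der p ≤ Q'.der p :=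
  fun r a H => h (p :: r) a H

theorem le_der_stutter (Q : Lang) (h : Heap) : Q ≤ Q.der (h, h) :=
  fun r a H => Q.stutter [] r h a H

theorem der_mumble (Q : Lang) {h q k : Heap} (hq : h.dom ⊆ q.dom) (qk : q.dom ⊆ k.dom) :
    (Q.der (h, q)).der (q, k) ≤ Q.der (h, k) :=
  fun r a H => Q.mumble [] r h q k a hq qk H

/-- The responses offered by a computation. -/
def of (U : TM V) : Lang where
  -- Monotonicity of domains is a premise here and not a conjunct: the language is then closed under
  -- stuttering with an arbitrary heap, and the premise is discharged once, for the complete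
  -- response, in `wins_of_game`.
  mem r a := ∃ ne : r ≠ [], ∀ hm : MonoDom r, ((⟨r, ne, hm⟩ : Trace), a) ∈ U.1
  stutter := by
    rintro u v h a ⟨ne, H⟩
    refine ⟨by simp, fun hm => ?_⟩
    refine U.2.sm _ _ _ (SM.stutter ⟨u ++ v, ne, ?_⟩ _ u v h rfl rfl) (H ?_) <;>
    · refine hm.sublist ?_
      exact List.Sublist.append_left (List.sublist_cons_self _ _) _
  mumble := by
    rintro u v h q k a hq qk ⟨ne, H⟩
    refine ⟨by simp, fun hm => ?_⟩
    exact U.2.sm _ _ _ (SM.mumble ⟨_, ne, hm.unmumble hq qk⟩ _ u v h q k rfl rfl)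
      (H (hm.unmumble hq qk))

end Lang

theorem Interleave.sublists {α : Type} {t₁ t₂ t₃ : List α} (h : Interleave t₁ t₂ t₃) :
    t₁.Sublist t₃ ∧ t₂.Sublist t₃ := by
  induction h with
  | nil => exact ⟨.slnil, .slnil⟩
  | left a _ ih => exact ⟨ih.1.cons_cons a, ih.2.cons a⟩
  | right a _ ih => exact ⟨ih.1.cons a, ih.2.cons_cons a⟩

/-- Both components are sublists of the interleaving, so they inherit monotone domains from it. -/
theorem Lang.of_parT {U U' : TM V} {r₁ r₂ r : List (Heap × Heap)} {a b : V}
    (h₁ : (Lang.of U).mem r₁ a) (h₂ : (Lang.of U').mem r₂ b) (h : Interleave r₁ r₂ r) :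
    (Lang.of (parT U U')).mem r (V.pair a b) := by
  obtain ⟨n₁, h₁⟩ := h₁
  obtain ⟨n₂, h₂⟩ := h₂
  obtain ⟨s₁, s₂⟩ := h.sublists
  refine ⟨fun hr => n₁ (List.sublist_nil.1 (hr ▸ s₁)), fun hm => ?_⟩
  exact subset_dagger _ ⟨_, _, a, b, h, h₁ (hm.sublist s₁), h₂ (hm.sublist s₂), rfl⟩

/-! ### Games -/

section Game

variable {X : Loc} {nl : ℤ} {w : World}

/-- A matching pair of heaps. -/
def Good (nl : ℤ) (X : Loc) (w : World) (h h' : Heap) : Prop :=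
  Sat w h ∧ Sat w h' ∧ MSQ.Sem nl X h h'

/-- A move that keeps a pair of heaps matching. -/
def Mv (nl : ℤ) (X : Loc) (w : World) (c c' h h' : Heap) : Prop :=
  Good nl X w c c' ∧ (MSQ.eff nl X).Step w c h ∧ (MSQ.eff nl X).Step w c' h' ∧ MSQ.Sem nl X h h'

/-- Silent steps never shrink the domain. -/
def SilentMono (w : World) : Prop :=
  ∀ l ∈ w, ∀ h k : Heap, l.step h k → l.strict h k → h.dom ⊆ k.dom

theorem Sat.step {l : AbsLoc} {h k : Heap} (hs : Sat w h) (hl : l ∈ w) (hk : l.step h k) :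
    Sat w k := by
  obtain ⟨P, hP, H⟩ := hs
  exact ⟨P, ((H h hP).2 l hl k hk).2, H⟩

theorem Sat.sem {l : AbsLoc} {h : Heap} (hs : Sat w h) (hl : l ∈ w) : l.sem h h := by
  obtain ⟨P, hP, H⟩ := hs
  exact (H h hP).1 l hl

theorem Sat.strict {l l' : AbsLoc} {h k : Heap} (hs : Sat w h) (hl : l ∈ w) (hk : l.step h k)
    (hl' : l' ∈ w) (hne : l' ≠ l) : l'.strict h k := by
  obtain ⟨P, hP, H⟩ := hs
  exact ((H h hP).2 l hl k hk).1 l' hl' hne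

-- Steps of the effect in a heap that satisfies the world

namespace MSQ

theorem mem_wrs {l : AbsLoc} : l ∈ (eff nl X).wrs ↔ l = loc nl X := by
  simp [Effect.wrs, eff]

theorem mem_rds {l : AbsLoc} : l ∈ (eff nl X).rds ↔ l = loc nl X := by
  simp [Effect.rds, eff]

theorem cos_eff : (eff nl X).cos = ∅ := by
  ext l
  simp [Effect.cos, eff]

theorem wf_eff (hX : loc nl X ∈ w) : (eff nl X).WF w := by
  refine ⟨?_, by simp [cos_eff], by simp [cos_eff]⟩
  rintro l ((h | h) | h)
  · exact mem_rds.1 h ▸ hX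
  · exact mem_wrs.1 h ▸ hX
  · simp [cos_eff] at h

/-- Induction along steps from a heap that satisfies the world: every step is an operation on the queue or
leaves the queue strictly unchanged. -/
theorem Step.induction (hX : loc nl X ∈ w) {R : Heap → Heap → Prop}
    (hq : ∀ h k, Step nl X h k → R h k)
    (hs : ∀ l ∈ w, ∀ h k, l.step h k → l.strict h k → Strict nl X h k → R h k)
    (ht : ∀ h k q, R h k → R k q → R h q) {h k : Heap} (H : (eff nl X).Step w h k) (h₀ : Sat w h) :
    Sat w k ∧ R h k := by
  have one : ∀ h k, Sat w h → ((∃ l ∈ (eff nl X).wrs, l.step h k) ∨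
      (∃ l ∈ w, l.step h k ∧ l.strict h k)) → Sat w k ∧ R h k := by
    rintro h k h₀ (⟨l, hl, H⟩ | ⟨l, hl, H, H'⟩)
    · rw [mem_wrs] at hl
      subst hl
      exact ⟨h₀.step hX H, hq _ _ H⟩
    · refine ⟨h₀.step hl H, hs l hl _ _ H H' ?_⟩
      -- A silent step of the queue is strict for the queue by definition; a step of any other
      -- location is so because the heap satisfies the world.
      by_cases hne : loc nl X = l
      · subst hne; exact H'
      · exact h₀.strict hl H hX hne
  induction H with
  | single H => exact one _ _ h₀ H
  | tail _ H ih =>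
    obtain ⟨s, r⟩ := ih
    obtain ⟨s', r'⟩ := one _ _ s H
    exact ⟨s', ht _ _ _ r r'⟩

end MSQ

theorem Heap.dom_set (h : Heap) (x : Loc) (v : RVal) : h.dom ⊆ (h.set x v).dom := by
  intro y hy
  by_cases hxy : y = x
  · subst hxy; simp [Heap.dom, Heap.set]
  · simpa [Heap.dom, Heap.set, Function.update_of_ne hxy] using hy

theorem MSQ.Step₁.dom_subset {h k : Heap} (H : MSQ.Step₁ nl X h k) : h.dom ⊆ k.dom := by
  rcases H with ⟨_, _, _, _, rfl⟩ | ⟨_, _, _, _, _, _, _, _, rfl⟩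
  · exact Heap.dom_set _ _ _
  · exact (Heap.dom_set _ _ _).trans (Heap.dom_set _ _ _)

/-- Operations on the queue only update or allocate, so the assumption on silent steps covers
everything else. It is needed because the proponent's responses must be traces, whose domains never
shrink. -/
theorem MSQ.step_dom (hX : MSQ.loc nl X ∈ w) (hd : SilentMono w) {h k : Heap}
    (H : (MSQ.eff nl X).Step w h k) (h₀ : Sat w h) : h.dom ⊆ k.dom := by
  refine (MSQ.Step.induction hX (R := fun h k => h.dom ⊆ k.dom) ?_ ?_
    (fun _ _ _ => Set.Subset.trans) H h₀).2
  · rintro h k ⟨-, -, H⟩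
    induction H with
    | refl => exact subset_rfl
    | tail _ H ih => exact ih.trans H.dom_subset
  · exact fun l hl h k H H' _ => hd l hl h k H H'

theorem MSQ.step_sat (hX : MSQ.loc nl X ∈ w) {h k : Heap}
    (H : (MSQ.eff nl X).Step w h k) (h₀ : Sat w h) : Sat w k :=
  (MSQ.Step.induction hX (R := fun _ _ => True) (fun _ _ _ => trivial)
    (fun _ _ _ _ _ _ _ => trivial) (fun _ _ _ _ _ => trivial) H h₀).1

theorem Mv.good (hX : MSQ.loc nl X ∈ w) {c c' h h' : Heap} (H : Mv nl X w c c' h h') :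
    Good nl X w h h' :=
  ⟨MSQ.step_sat hX H.2.1 H.1.1, MSQ.step_sat hX H.2.2.1 H.1.2.1, H.2.2.2⟩

theorem Good.refl (hX : MSQ.loc nl X ∈ w) {c c' : Heap} (H : Good nl X w c c') :
    Mv nl X w c c' c c' :=
  ⟨H, .single (.inl ⟨_, MSQ.mem_wrs.2 rfl, (MSQ.loc nl X).step_refl _ (H.1.sem hX)⟩),
    .single (.inl ⟨_, MSQ.mem_wrs.2 rfl, (MSQ.loc nl X).step_refl _ (H.2.1.sem hX)⟩), H.2.2⟩

theorem Mv.trans {c c' h h' k k' : Heap} (H : Mv nl X w c c' h h')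
    (H' : Mv nl X w h h' k k') : Mv nl X w c c' k k' :=
  ⟨H.1, H.2.1.trans H'.2.1, H.2.2.1.trans H'.2.2.1, H'.2.2.2⟩

theorem Mv.tile {c c' h h' : Heap} (H : Mv nl X w c c' h h') :
    Tile w (MSQ.eff nl X) c c' h h' :=
  ⟨fun _ => H.2.1, fun _ => H.2.2.1, fun _ _ hl => .inr (MSQ.mem_wrs.1 hl.1 ▸ H.2.2.2)⟩

/-- The premise on `rd` holds for a good pair and there is no `co`. Both alternatives of the tile
lead to matching heaps: if neither side has changed the queue strictly, the old match persists. -/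
theorem Tile.mv {c c' h h' : Heap} (hg : Good nl X w c c')
    (H : Tile w (MSQ.eff nl X) c c' h h') : Mv nl X w c c' h h' := by
  refine ⟨hg, H.1 hg.1, H.2.1 hg.2.1, ?_⟩
  rcases H.2.2 (fun l hl => MSQ.mem_rds.1 hl ▸ hg.2.2) (MSQ.loc nl X)
    ⟨MSQ.mem_wrs.2 rfl, by simp [MSQ.cos_eff]⟩ with h | h
  · exact (h.1.1.symm.trans hg.2.2).trans h.2.1
  · exact h

/-- The game in which the environment moves first; `c` and `c'` are the current heaps, `Q` is the set of responses
that are still possible, and `fin` is the winning condition. -/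
def Game (nl : ℤ) (X : Loc) (w : World) (fin : Lang → Heap → Prop) :
    List (Heap × Heap) → Lang → Heap → Heap → Prop
  | [], Q, c, _ => fin Q c
  | (h, k) :: r, Q, c, c' => ∀ h', Mv nl X w c c' h h' →
      ∃ k', Mv nl X w h h' k k' ∧ Game nl X w fin r (Q.der (h', k')) k k'

/-- Assertions that are monotone in the possible responses and stable under the environment. -/
structure Stable (nl : ℤ) (X : Loc) (w : World) (B : Lang → Heap → Prop) : Prop where
  mono : ∀ Q Q' c, Q ≤ Q' → B Q c → B Q' c
  step : ∀ Q c h, Sat w c → (MSQ.eff nl X).Step w c h → B Q c → B Q h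

-- Closure properties of the game

namespace Game

theorem imp {fin fin' : Lang → Heap → Prop} (hX : MSQ.loc nl X ∈ w)
    (hf : ∀ Q c c', Good nl X w c c' → fin Q c → fin' Q c) :
    ∀ {t : List (Heap × Heap)} {Q : Lang} {c c' : Heap}, Good nl X w c c' →
      Game nl X w fin t Q c c' → Game nl X w fin' t Q c c'
  | [], _, _, _, hg, H => hf _ _ _ hg H
  | _ :: _, _, _, _, _, H => fun h' hm =>
    let ⟨k', hk, H'⟩ := H h' hm
    ⟨k', hk, imp hX hf (hk.good hX) H'⟩

theorem mono {fin : Lang → Heap → Prop} (hf : ∀ Q Q' c, Q ≤ Q' → fin Q c → fin Q' c) :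
    ∀ {t : List (Heap × Heap)} {Q Q' : Lang} {c c' : Heap}, Q ≤ Q' →
      Game nl X w fin t Q c c' → Game nl X w fin t Q' c c'
  | [], _, _, _, _, h, H => hf _ _ _ h H
  | _ :: _, _, _, _, _, h, H => fun h' hm =>
    let ⟨k', hk, H'⟩ := H h' hm
    ⟨k', hk, mono hf (Lang.der_mono h _) H'⟩

/-- The environment opens each round, so an earlier move of the environment is absorbed into the
next one by transitivity; when no round is left, stability of the winning condition takes over. -/
theorem env {fin : Lang → Heap → Prop} (hf : Stable nl X w fin) {t : List (Heap × Heap)} {Q : Lang}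
    {c c' h h' : Heap} (hm : Mv nl X w c c' h h') (H : Game nl X w fin t Q c c') :
    Game nl X w fin t Q h h' := by
  cases t with
  | nil => exact hf.step _ _ _ hm.1.1 hm.2.1 H
  | cons p t => exact fun k' hk => H k' (hm.trans hk)

/-- The added round is answered by an idle move, which costs nothing because the language is closed
under stuttering. -/
theorem stutter (hX : MSQ.loc nl X ∈ w) {fin : Lang → Heap → Prop} (hf : Stable nl X w fin)
    {v : List (Heap × Heap)} {h : Heap} :
    ∀ {u : List (Heap × Heap)} {Q : Lang} {c c' : Heap}, Game nl X w fin (u ++ v) Q c c' →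
      Game nl X w fin (u ++ (h, h) :: v) Q c c'
  | [], Q, _, _, H => fun h' hm =>
    ⟨h', (hm.good hX).refl hX, mono hf.mono (Q.le_der_stutter h') (env hf hm H)⟩
  | _ :: _, _, _, _, H => fun h' hm =>
    let ⟨k', hk, H'⟩ := H h' hm
    ⟨k', hk, stutter hX hf H'⟩

/-- The strategy for the two rounds is run with an idle environment in between. Its two answers are
composed into one, and the language is closed under the corresponding mumbling. -/
theorem mumble (hX : MSQ.loc nl X ∈ w) (hd : SilentMono w) {fin : Lang → Heap → Prop}
    (hf : Stable nl X w fin) {v : List (Heap × Heap)} {h q k : Heap} :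
    ∀ {u : List (Heap × Heap)} {Q : Lang} {c c' : Heap},
      Game nl X w fin (u ++ (h, q) :: (q, k) :: v) Q c c' →
      Game nl X w fin (u ++ (h, k) :: v) Q c c'
  | [], Q, _, _, H => fun h' hm =>
    let ⟨q', hq, H'⟩ := H h' hm
    let ⟨k', hk, H''⟩ := H' q' ((hq.good hX).refl hX)
    ⟨k', hq.trans hk, mono hf.mono (Q.der_mumble (MSQ.step_dom hX hd hq.2.2.1 hq.1.2.1)
      (MSQ.step_dom hX hd hk.2.2.1 hk.1.2.1)) H''⟩
  | _ :: _, _, _, _, H => fun h' hm =>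
    let ⟨k', hk, H'⟩ := H h' hm
    ⟨k', hk, mumble hX hd hf H'⟩

theorem append (hX : MSQ.loc nl X ∈ w) {fin fin' : Lang → Heap → Prop} {v : List (Heap × Heap)}
    (hv : ∀ Q c c', Good nl X w c c' → fin Q c → Game nl X w fin' v Q c c') :
    ∀ {u : List (Heap × Heap)} {Q : Lang} {c c' : Heap}, Good nl X w c c' →
      Game nl X w fin u Q c c' → Game nl X w fin' (u ++ v) Q c c'
  | [], _, _, _, hg, H => hv _ _ _ hg H
  | _ :: _, _, _, _, _, H => fun h' hm =>
    let ⟨k', hk, H'⟩ := H h' hm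
    ⟨k', hk, append hX hv (hk.good hX) H'⟩

/-- Each thread regards the moves of the other one, and the proponent's answers to them, as
environment moves. `J` relates the remaining responses of the threads to those of the composition
and must survive a move of either thread. -/
theorem par {fin₁ fin₂ fin : Lang → Heap → Prop}
    (h₁ : Stable nl X w fin₁) (h₂ : Stable nl X w fin₂) (J : Lang → Lang → Lang → Prop)
    (hJ₁ : ∀ Q₁ Q₂ Q p, J Q₁ Q₂ Q → J (Q₁.der p) Q₂ (Q.der p))
    (hJ₂ : ∀ Q₁ Q₂ Q p, J Q₁ Q₂ Q → J Q₁ (Q₂.der p) (Q.der p))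
    (hf : ∀ Q₁ Q₂ Q c, J Q₁ Q₂ Q → fin₁ Q₁ c → fin₂ Q₂ c → fin Q c)
    {t₁ t₂ t : List (Heap × Heap)} (hi : Interleave t₁ t₂ t) :
    ∀ {Q₁ Q₂ Q : Lang} {c c' : Heap}, J Q₁ Q₂ Q → Game nl X w fin₁ t₁ Q₁ c c' →
      Game nl X w fin₂ t₂ Q₂ c c' → Game nl X w fin t Q c c' := by
  induction hi with
  | nil => exact fun hj H₁ H₂ => hf _ _ _ _ hj H₁ H₂
  | left p _ ih =>
    intro Q₁ Q₂ Q c c' hj H₁ H₂ h' hm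
    obtain ⟨k', hk, H'⟩ := H₁ h' hm
    exact ⟨k', hk, ih (hJ₁ _ _ _ _ hj) H' (env h₂ (hm.trans hk) H₂)⟩
  | right p _ ih =>
    intro Q₁ Q₂ Q c c' hj H₁ H₂ h' hm
    obtain ⟨k', hk, H'⟩ := H₂ h' hm
    exact ⟨k', hk, ih (hJ₂ _ _ _ _ hj) (env h₁ (hm.trans hk) H₁) H'⟩

end Game

end Game

/-! ### Semantic equations -/

theorem stutter_append {U : TM V} {v t : Trace} {b : V} (hv : (v, b) ∈ U.1) :
    ∀ u : List (Heap × Heap), (∀ p ∈ u, p.1 = p.2) → t.list = u ++ v.list → (t, b) ∈ U.1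
  | [], _, ht => by
    have : t = v := by cases t; cases v; simpa using ht
    exact this ▸ hv
  | (h, k) :: u, hu, ht => by
    obtain rfl : h = k := hu (h, k) (by simp)
    have hm : MonoDom (u ++ v.list) := MonoDom.sublist t.mono (ht ▸ List.sublist_cons_self _ _)
    refine U.2.sm ⟨u ++ v.list, by simp [v.ne], hm⟩ t b (SM.stutter _ _ [] _ h rfl ht) ?_
    exact stutter_append hv u (fun p hp => hu p (by simp [hp])) rfl

theorem mem_rtn {t : Trace} {a b : V} (h : (t, b) ∈ (rtn a).1) :
    (∀ p ∈ t.list, p.1 = p.2) ∧ b ≤ a := by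
  have : (rtn a).1 ⊆ {p | (∀ q ∈ p.1.list, q.1 = q.2) ∧ p.2 ≤ a} := by
    refine dagger_le ⟨?_, ?_, ?_⟩ ?_
    · rintro t t' b hs ⟨h₁, h₂⟩
      refine ⟨fun p hp => ?_, h₂⟩
      cases hs with
      | stutter u v h ht ht' =>
        simp only [ht', List.mem_append, List.mem_cons] at hp
        rcases hp with hp | rfl | hp
        · exact h₁ p (by simp [ht, hp])
        · rfl
        · exact h₁ p (by simp [ht, hp])
      | mumble u v h q k ht ht' =>
        simp only [ht', List.mem_append, List.mem_cons] at hp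
        rcases hp with hp | rfl | hp
        · exact h₁ p (by simp [ht, hp])
        · exact (h₁ (h, q) (by simp [ht])).trans (h₁ (q, k) (by simp [ht]))
        · exact h₁ p (by simp [ht, hp])
    · exact fun t b b' hb h => ⟨h.1, hb.trans h.2⟩
    · refine fun t c b _ hb h => ⟨(h 0).1, hb.2 ?_⟩
      rintro _ ⟨i, rfl⟩
      exact (h i).2
    · rintro ⟨t, b⟩ ⟨h, ht, rfl⟩
      change t.list = _ at ht
      exact ⟨by simp [ht], le_rfl⟩
  exact this h

/-- Traces of `rtn a` only stutter, and their results are at most `a`; hence monotonicity of `f` at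
`a` suffices. Conversely, a trace of `f a` arises by mumbling from the same trace with a stutter
step in front. -/
theorem bnd_rtn (f : V → TM V) (a : V) (hf : ∀ b ≤ a, (f b).1 ⊆ (f a).1) :
    bnd f (rtn a) = f a := by
  refine le_antisymm (dagger_le (f a).2 ?_) ?_
  · rintro ⟨t, b⟩ ⟨u, v, a', hu, hv, ht⟩
    obtain ⟨hs, ha⟩ := mem_rtn hu
    exact stutter_append (hf _ ha hv) _ hs ht
  · rintro ⟨⟨l, ne, hm⟩, b⟩ hv
    obtain ⟨⟨h, k⟩, r, rfl⟩ := List.exists_cons_of_ne_nil ne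
    have hm' : MonoDom ([] ++ (h, h) :: (h, k) :: r) :=
      MonoDom.unmumble subset_rfl (by
        simp only [List.flatMap_cons, List.pairwise_append, List.pairwise_cons] at hm
        exact hm.1.1 _ (by simp)) hm
    refine (bnd f (rtn a)).2.sm ⟨_, by simp, hm'⟩ _ _ (SM.mumble _ _ [] r h h k rfl rfl) ?_
    refine subset_dagger _ ⟨⟨[(h, h)], by simp, by simp⟩, _, a, ?_, hv, by simp⟩
    exact subset_dagger _ ⟨h, rfl, rfl⟩

theorem bnd_rtn_ofR (f : V → TM V) (r : RVal) : bnd f (rtn (V.ofR r)) = f (V.ofR r) :=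
  bnd_rtn f _ fun _ hb => by rw [V.eq_ofR_of_le hb]

theorem bnd_mono {f f' : V → TM V} (g : TM V) (h : ∀ a, (f a).1 ⊆ (f' a).1) :
    (bnd f g).1 ⊆ (bnd f' g).1 := by
  refine dagger_le (bnd f' g).2 ?_
  rintro ⟨t, b⟩ ⟨u, v, a, hu, hv, ht⟩
  exact subset_dagger _ ⟨u, v, a, hu, h a hv, ht⟩

theorem dagger_self {A : Type} [PartialOrder A] (U : TM A) : dagger U.1 = U :=
  le_antisymm (dagger_le U.2 subset_rfl) (subset_dagger _)

theorem atomically_le {A : Type} [PartialOrder A] (U : TM A) : (atomically U).1 ⊆ U.1 :=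
  dagger_le U.2 fun _ h => h.1

section Equations

variable {al : Allocator} {ρ : Env} {v v' : Val} {e e' : Tm} {x y : ℕ}

theorem semV_pair {r s : RVal} (h : semV al v ρ = V.ofR r) (h' : semV al v' ρ = V.ofR s) :
    semV al (.pair v v') ρ = V.ofR (.pair r s) := by
  simp only [semV]
  rw [h, h', V.pair_ofR]

theorem semV_fst {r s : RVal} (h : semV al v ρ = V.ofR (.pair r s)) :
    semV al (.fst v) ρ = V.ofR r := by
  have H : ∃ d : V × V, semV al v ρ = V.pair d.1 d.2 :=
    ⟨(V.ofR r, V.ofR s), by rw [h, V.pair_ofR]⟩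
  rw [semV, dif_pos H]
  exact (V.pair_eq_ofR (H.choose_spec.symm.trans h)).1

theorem semV_snd {r s : RVal} (h : semV al v ρ = V.ofR (.pair r s)) :
    semV al (.snd v) ρ = V.ofR s := by
  have H : ∃ d : V × V, semV al v ρ = V.pair d.1 d.2 :=
    ⟨(V.ofR r, V.ofR s), by rw [h, V.pair_ofR]⟩
  rw [semV, dif_pos H]
  exact (V.pair_eq_ofR (H.choose_spec.symm.trans h)).2

theorem RVal.loc_injective : Function.Injective RVal.loc := by
  intro x y h
  simpa [RVal.loc] using h

theorem semC_read {z : Loc} (h : semV al v ρ = V.ofR (.loc z)) :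
    semC al (.read v) ρ = fromState fun k => (k.get z).map fun r => (k, V.ofR r) := by
  have H : ∃ x, semV al v ρ = V.loc x := ⟨z, h⟩
  have e : H.choose = z := RVal.loc_injective (V.ofR_injective (H.choose_spec.symm.trans h))
  rw [semC, dif_pos H, e]

theorem semC_write {z : Loc} {r : RVal} (h : semV al v ρ = V.ofR (.loc z))
    (h' : semV al v' ρ = V.ofR r) :
    semC al (.write v v') ρ = fromState fun k => some (k.set z r, V.ofR .unit) := by
  have H : ∃ p : Loc × RVal, semV al v ρ = V.loc p.1 ∧ semV al v' ρ = V.ofR p.2 :=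
    ⟨(z, r), h, h'⟩
  have e : H.choose.1 = z :=
    RVal.loc_injective (V.ofR_injective (H.choose_spec.1.symm.trans h))
  have e' : H.choose.2 = r := V.ofR_injective (H.choose_spec.2.symm.trans h')
  rw [semC, dif_pos H, e, e', V.unit_eq]

theorem semC_ref {r : RVal} (h : semV al v ρ = V.ofR r) :
    semC al (.ref v) ρ = fromState fun k => some (k.set (al.new k r) r, V.ofR (.loc (al.new k r))) := by
  have H : ∃ r, semV al v ρ = V.ofR r := ⟨r, h⟩
  have e : H.choose = r := V.ofR_injective (H.choose_spec.symm.trans h)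
  rw [semC, dif_pos H, e]
  rfl

theorem semC_ite_true (h : semV al v ρ = V.ofR (.bool true)) :
    semC al (.ite v e e') ρ = semC al e ρ := by
  rw [semC, if_pos (h.trans (V.bool_eq _).symm)]

theorem semC_ite_false (h : semV al v ρ = V.ofR (.bool false)) :
    semC al (.ite v e e') ρ = semC al e' ρ := by
  rw [semC, if_neg, if_pos (h.trans (V.bool_eq _).symm)]
  rw [h, V.bool_eq, V.ofR_injective.eq_iff]
  simp [RVal.bool]

theorem semC_letin_val {r : RVal} (h : semV al v ρ = V.ofR r) :
    semC al (.letin x (.val v) e) ρ = semC al e (Function.update ρ x (V.ofR r)) := by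
  rw [semC, semC, h, bnd_rtn_ofR]

theorem graph_eq {a b : Atom} {d : V} :
    Prim.Graph .eq (V.ofR (.pair (.atom a) (.atom b))) d ↔
      (a = b ∧ d = V.ofR (.bool true)) ∨ (a ≠ b ∧ d = V.ofR (.bool false)) := by
  have inj : ∀ a b a' b' : Atom, V.pair (V.ofAtom a) (V.ofAtom b) =
      V.ofR (.pair (.atom a') (.atom b')) → a = a' ∧ b = b' := by
    intro a b a' b' h
    obtain ⟨h₁, h₂⟩ := V.pair_eq_ofR h
    have h₁ := V.ofR_injective ((V.ofAtom_eq _).symm.trans h₁)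
    have h₂ := V.ofR_injective ((V.ofAtom_eq _).symm.trans h₂)
    exact ⟨by simpa using h₁, by simpa using h₂⟩
  constructor
  · intro h
    generalize hv : V.ofR (.pair (.atom a) (.atom b)) = v at h
    cases h with
    | eq a' =>
      obtain ⟨rfl, rfl⟩ := inj _ _ _ _ hv.symm
      exact .inl ⟨rfl, rfl⟩
    | ne a' b' hne =>
      obtain ⟨rfl, rfl⟩ := inj _ _ _ _ hv.symm
      exact .inr ⟨hne, rfl⟩
  · rw [← V.pair_ofR, ← V.ofAtom_eq, ← V.ofAtom_eq]
    rintro (⟨rfl, rfl⟩ | ⟨h, rfl⟩)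
    · exact .eq a
    · exact .ne a b h

open Classical in
theorem semC_eqT {a b : Atom} (h : semV al v ρ = V.ofR (.atom a))
    (h' : semV al v' ρ = V.ofR (.atom b)) :
    semC al (Prog.eqT v v') ρ = rtn (V.ofR (.bool (decide (a = b)))) := by
  rw [Prog.eqT, semC, semV_pair h h', semV, V.app_fn_ofR]
  by_cases hab : a = b
  · simp only [graph_eq, hab, true_and, ne_eq, not_true, false_and, or_false, exists_eq_left,
      decide_true]
    exact dagger_self (rtn _)
  · simp only [graph_eq, hab, false_and, ne_eq, not_false_eq_true, true_and, false_or,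
      exists_eq_left, decide_false]
    exact dagger_self (rtn _)

theorem semC_ifEq_pos {a b : Atom} (h : semV al v ρ = V.ofR (.atom a))
    (h' : semV al v' ρ = V.ofR (.atom b)) (hab : a = b) :
    semC al (.letin x (Prog.eqT v v') (.ite (.var x) e e')) ρ =
      semC al e (Function.update ρ x (V.ofR (.bool true))) := by
  rw [semC, semC_eqT h h', bnd_rtn_ofR, semC_ite_true]
  · simp [hab]
  · simp [semV, hab]

theorem semC_ifEq_neg {a b : Atom} (h : semV al v ρ = V.ofR (.atom a))
    (h' : semV al v' ρ = V.ofR (.atom b)) (hab : a ≠ b) :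
    semC al (.letin x (Prog.eqT v v') (.ite (.var x) e e')) ρ =
      semC al e' (Function.update ρ x (V.ofR (.bool false))) := by
  rw [semC, semC_eqT h h', bnd_rtn_ofR, semC_ite_false]
  · simp [hab]
  · simp [semV, hab]

end Equations

/-! ### One-step runs -/

/-- `U` may run from `h` to `k` without interruption, with the result `a`. -/
def Run (U : TM V) (h k : Heap) (a : V) : Prop := ∃ t : Trace, t.list = [(h, k)] ∧ (t, a) ∈ U.1

namespace Run

variable {al : Allocator} {ρ : Env} {v v' : Val} {e e' : Tm} {x y : ℕ} {h k q : Heap} {a b : V}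

theorem dom_subset {U : TM V} (H : Run U h k a) : h.dom ⊆ k.dom := by
  obtain ⟨t, ht, -⟩ := H
  have := t.mono
  simpa [ht] using this

theorem lang {U : TM V} (H : Run U h k a) : (Lang.of U).mem [(h, k)] a := by
  obtain ⟨⟨_, ne, hm⟩, rfl, ht⟩ := H
  exact ⟨ne, fun _ => ht⟩

theorem rtn : Run (rtn a) h h a :=
  ⟨⟨[(h, h)], by simp, by simp⟩, rfl, subset_dagger _ ⟨h, rfl, rfl⟩⟩

theorem bnd {f : V → TM V} {g : TM V} (H : Run g h q a) (H' : Run (f a) q k b) :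
    Run (bnd f g) h k b := by
  have d₁ := H.dom_subset
  have d₂ := H'.dom_subset
  obtain ⟨u, hu, mu⟩ := H
  obtain ⟨v, hv, mv⟩ := H'
  have hm : MonoDom [(h, k)] := by simpa [MonoDom] using d₁.trans d₂
  refine ⟨⟨[(h, k)], by simp, hm⟩, rfl, ?_⟩
  refine (_root_.bnd f g).2.sm ⟨_, by simp, MonoDom.unmumble (u := []) d₁ d₂ hm⟩ _ _
    (SM.mumble _ _ [] [] h q k rfl rfl) ?_
  exact subset_dagger _ ⟨u, v, a, mu, mv, by simp [hu, hv]⟩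

theorem fromState {c : Heap → Option (Heap × V)} (hc : c h = some (k, a)) (hk : h.dom ⊆ k.dom) :
    Run (fromState c) h k a :=
  ⟨⟨[(h, k)], by simp, by simpa using hk⟩, rfl, subset_dagger _ ⟨h, k, hc, rfl⟩⟩

theorem atomically {U : TM V} (H : Run U h k a) : Run (atomically U) h k a := by
  obtain ⟨t, ht, hU⟩ := H
  exact ⟨t, ht, subset_dagger _ ⟨hU, h, k, ht⟩⟩

theorem letin_read {z : Loc} {r : RVal} (hv : semV al v ρ = V.ofR (.loc z))
    (hr : h.get z = some r) (H : Run (semC al e (Function.update ρ x (V.ofR r))) h k b) :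
    Run (semC al (.letin x (.read v) e) ρ) h k b := by
  rw [semC, semC_read hv]
  exact bnd (fromState (by simp [hr]) subset_rfl) H

theorem letin_write {z : Loc} {r : RVal} (hv : semV al v ρ = V.ofR (.loc z))
    (hv' : semV al v' ρ = V.ofR r)
    (H : Run (semC al e (Function.update ρ x (V.ofR .unit))) (h.set z r) k b) :
    Run (semC al (.letin x (.write v v') e) ρ) h k b := by
  rw [semC, semC_write hv hv']
  exact bnd (fromState rfl (Heap.dom_set _ _ _)) H

theorem letin_ref {r : RVal} (hv : semV al v ρ = V.ofR r)
    (H : Run (semC al e (Function.update ρ x (V.ofR (.loc (al.new h r))))) (h.set (al.new h r) r) k b) :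
    Run (semC al (.letin x (.ref v) e) ρ) h k b := by
  rw [semC, semC_ref hv]
  exact bnd (fromState rfl (Heap.dom_set _ _ _)) H

theorem lfpT {g : (V → TM V) → V → TM V} {d : V} (i : ℕ)
    (H : Run ((g^[i] fun _ => dagger ∅) d) h k a) : Run (lfpT g d) h k a := by
  obtain ⟨t, ht, hU⟩ := H
  exact ⟨t, ht, subset_dagger _ ⟨i, hU⟩⟩

/-- A function that does not call itself is reached by the first approximation of the fixed point;
quantifying over `F` expresses that its own name is irrelevant. -/
theorem app_lam {r : RVal}
    (H : ∀ F, Run (semC al e (Function.update (Function.update ρ 99 F) x (V.ofR r))) h k a) :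
    Run (V.app (semV al (Prog.lam x e) ρ) (V.ofR r)) h k a := by
  rw [Prog.lam, semV, V.app_fn_ofR]
  exact lfpT 1 (H _)

end Run

/-! ### Sequential correctness -/

/-- The list is an uninterrupted run from the first heap to the second one. -/
def Uninterrupted : List (Heap × Heap) → Heap → Heap → Prop
  | [], h, k => h = k
  | (a, b) :: r, h, k => a = h ∧ Uninterrupted r b k

theorem Uninterrupted.append {v : List (Heap × Heap)} {k : Heap} :
    ∀ {u : List (Heap × Heap)} {h : Heap}, Uninterrupted (u ++ v) h k ↔
      ∃ q, Uninterrupted u h q ∧ Uninterrupted v q k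
  | [], h => by simp [Uninterrupted]
  | (a, b) :: u, h => by simp [Uninterrupted, Uninterrupted.append, and_assoc]

/-- Every uninterrupted run of `U` from `h` ends as `R` says. -/
def Isolated (U : TM V) (h : Heap) (R : Heap → RVal → Prop) : Prop :=
  ∀ t a, (t, a) ∈ U.1 → ∀ k, Uninterrupted t.list h k → ∃ r, a = V.ofR r ∧ R k r

namespace Isolated

variable {al : Allocator} {ρ : Env} {v v' : Val} {e e' : Tm} {x y : ℕ} {h : Heap}
  {R R' : Heap → RVal → Prop}

/-- Stuttering and mumbling do not alter the end points of an uninterrupted run, and R-values are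
isolated, so the property passes to the closure. -/
theorem dagger {S : Set (Trace × V)}
    (H : ∀ t a, (t, a) ∈ S → ∀ k, Uninterrupted t.list h k → ∃ r, a = V.ofR r ∧ R k r) :
    Isolated (dagger S) h R := by
  have : (_root_.dagger S).1 ⊆
      {p | ∀ k, Uninterrupted p.1.list h k → ∃ r, p.2 = V.ofR r ∧ R k r} := by
    refine dagger_le ⟨?_, ?_, ?_⟩ fun p hp => H p.1 p.2 hp
    · intro t t' a hs H k hk
      refine H k ?_
      cases hs with
      | stutter u v q ht ht' =>
        rw [ht', Uninterrupted.append] at hk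
        rw [ht, Uninterrupted.append]
        obtain ⟨_, h₁, rfl, h₂⟩ := hk
        exact ⟨_, h₁, h₂⟩
      | mumble u v q₁ q q₂ ht ht' =>
        rw [ht', Uninterrupted.append] at hk
        rw [ht, Uninterrupted.append]
        obtain ⟨_, h₁, rfl, h₂⟩ := hk
        exact ⟨_, h₁, rfl, rfl, h₂⟩
    · intro t a b hb H k hk
      obtain ⟨r, rfl, hr⟩ := H k hk
      exact ⟨r, V.eq_ofR_of_le hb, hr⟩
    · intro t c a _ ha H k hk
      obtain ⟨r, h₀, hr⟩ := H 0 k hk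
      exact ⟨r, V.eq_ofR_of_ge (h₀ ▸ ha.1 ⟨0, rfl⟩), hr⟩
  exact fun t a hta => this hta

theorem bnd {f : V → TM V} {g : TM V} (H : Isolated g h R)
    (H' : ∀ k r, R k r → Isolated (f (V.ofR r)) k R') : Isolated (bnd f g) h R' := by
  refine dagger ?_
  rintro t b ⟨u, v, a, hu, hv, ht⟩ k hk
  rw [ht, Uninterrupted.append] at hk
  obtain ⟨q, h₁, h₂⟩ := hk
  obtain ⟨r, rfl, hr⟩ := H _ _ hu _ h₁
  exact H' _ _ hr _ _ hv _ h₂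

theorem fromState {c : Heap → Option (Heap × V)}
    (H : ∀ k a, c h = some (k, a) → ∃ r, a = V.ofR r ∧ R k r) : Isolated (fromState c) h R := by
  refine dagger ?_
  rintro t a ⟨h', k', hc, ht⟩ k hk
  rw [show t.list = _ from ht] at hk
  obtain ⟨rfl, rfl⟩ := hk
  exact H _ _ hc

theorem val {r : RVal} (hv : semV al v ρ = V.ofR r) (hr : R h r) : Isolated (semC al (.val v) ρ) h R := by
  rw [semC, hv]
  refine dagger ?_
  rintro t a ⟨h', ht, rfl⟩ k hk
  rw [show t.list = _ from ht] at hk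
  obtain ⟨rfl, rfl⟩ := hk
  exact ⟨r, rfl, hr⟩

theorem letin_read {z : Loc} (hv : semV al v ρ = V.ofR (.loc z))
    (H : ∀ r, h.get z = some r → Isolated (semC al e (Function.update ρ x (V.ofR r))) h R) :
    Isolated (semC al (.letin x (.read v) e) ρ) h R := by
  rw [semC, semC_read hv]
  refine bnd (R := fun k r => k = h ∧ h.get z = some r) (fromState ?_) ?_
  · rintro k a hc
    simp only [Option.map_eq_some_iff, Prod.mk.injEq] at hc
    obtain ⟨r, hr, rfl, rfl⟩ := hc
    exact ⟨r, rfl, rfl, hr⟩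
  · rintro k r ⟨rfl, hr⟩
    exact H r hr

theorem letin_write {z : Loc} {r : RVal} (hv : semV al v ρ = V.ofR (.loc z))
    (hv' : semV al v' ρ = V.ofR r)
    (H : Isolated (semC al e (Function.update ρ x (V.ofR .unit))) (h.set z r) R) :
    Isolated (semC al (.letin x (.write v v') e) ρ) h R := by
  rw [semC, semC_write hv hv']
  refine bnd (R := fun k s => k = h.set z r ∧ s = .unit) (fromState ?_) ?_
  · rintro k a ⟨⟩
    exact ⟨_, rfl, rfl, rfl⟩
  · rintro k r ⟨rfl, rfl⟩
    exact H

theorem letin_ref {r : RVal} (hv : semV al v ρ = V.ofR r)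
    (H : Isolated (semC al e (Function.update ρ x (V.ofR (.loc (al.new h r))))) (h.set (al.new h r) r) R) :
    Isolated (semC al (.letin x (.ref v) e) ρ) h R := by
  rw [semC, semC_ref hv]
  refine bnd (R := fun k s => k = h.set (al.new h r) r ∧ s = .loc (al.new h r)) (fromState ?_) ?_
  · rintro k a ⟨⟩
    exact ⟨_, rfl, rfl, rfl⟩
  · rintro k r ⟨rfl, rfl⟩
    exact H

end Isolated

/-! ### Triples -/

section Triple

variable {nl : ℤ} {X : Loc} {w : World}

/-- The result is an R-value that satisfies `B`. -/
def Ends (B : RVal → Lang → Heap → Prop) (a : V) (Q : Lang) (c : Heap) : Prop :=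
  ∃ r, a = V.ofR r ∧ B r Q c

theorem Stable.ends {B : RVal → Lang → Heap → Prop} (hB : ∀ r, Stable nl X w (B r)) (a : V) :
    Stable nl X w (Ends B a) where
  mono := fun _ _ _ h ⟨r, hr, H⟩ => ⟨r, hr, (hB r).mono _ _ _ h H⟩
  step := fun _ _ _ h₀ h ⟨r, hr, H⟩ => ⟨r, hr, (hB r).step _ _ _ h₀ h H⟩

/-- Every trace of `U` wins the game from the precondition `A` to the postcondition `B`. -/
def Triple (nl : ℤ) (X : Loc) (w : World) (A : Lang → Heap → Prop) (U : TM V)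
    (B : RVal → Lang → Heap → Prop) : Prop :=
  ∀ t a, (t, a) ∈ U.1 → ∀ Q c c', Good nl X w c c' → A Q c → Game nl X w (Ends B a) t.list Q c c'

namespace Triple

variable {A A' : Lang → Heap → Prop} {B C : RVal → Lang → Heap → Prop}

theorem mono {U U' : TM V} (h : U.1 ⊆ U'.1) (H : Triple nl X w A U' B) : Triple nl X w A U B :=
  fun t a ha => H t a (h ha)

theorem pre {ι : Sort*} {A' : ι → Lang → Heap → Prop} {U : TM V}
    (hA : ∀ Q c c', Good nl X w c c' → A Q c → ∃ i, A' i Q c)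
    (H : ∀ i, Triple nl X w (A' i) U B) : Triple nl X w A U B := fun t a ht Q c c' hg hQ =>
  let ⟨i, hi⟩ := hA Q c c' hg hQ
  H i t a ht Q c c' hg hi

theorem post (hX : MSQ.loc nl X ∈ w) {U : TM V}
    (hB : ∀ r Q c c', Good nl X w c c' → B r Q c → C r Q c)
    (H : Triple nl X w A U B) : Triple nl X w A U C := fun t a ht Q c c' hg hQ =>
  (H t a ht Q c c' hg hQ).imp hX (fun _ _ _ hg ⟨r, hr, h⟩ => ⟨r, hr, hB _ _ _ _ hg h⟩) hg

/-- The winning pairs of a trace and a result form a closed set, so only the generators have to be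
examined. The conditions on results are trivial since a winning result is an R-value. -/
theorem dagger (hX : MSQ.loc nl X ∈ w) (hd : SilentMono w) (hB : ∀ r, Stable nl X w (B r))
    {S : Set (Trace × V)}
    (H : ∀ t a, (t, a) ∈ S → ∀ Q c c', Good nl X w c c' → A Q c →
      Game nl X w (Ends B a) t.list Q c c') :
    Triple nl X w A (dagger S) B := by
  have : (_root_.dagger S).1 ⊆ {p | ∀ Q c c', Good nl X w c c' → A Q c →
      Game nl X w (Ends B p.2) p.1.list Q c c'} := by
    refine dagger_le ⟨?_, ?_, ?_⟩ fun p hp => H p.1 p.2 hp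
    · intro t t' a hs H Q c c' hg hQ
      have := H Q c c' hg hQ
      cases hs with
      | stutter u v h ht ht' =>
        change Game _ _ _ _ t'.list _ _ _
        change Game _ _ _ _ t.list _ _ _ at this
        rw [ht] at this
        rw [ht']
        exact this.stutter hX (.ends hB a)
      | mumble u v h q k ht ht' =>
        change Game _ _ _ _ t'.list _ _ _
        change Game _ _ _ _ t.list _ _ _ at this
        rw [ht] at this
        rw [ht']
        exact this.mumble hX hd (.ends hB a)
    · intro t a b hb H Q c c' hg hQ
      refine (H Q c c' hg hQ).imp hX ?_ hg
      rintro Q c c' - ⟨r, rfl, hr⟩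
      exact ⟨r, V.eq_ofR_of_le hb, hr⟩
    · intro t d a _ ha H Q c c' hg hQ
      refine (H 0 Q c c' hg hQ).imp hX ?_ hg
      rintro Q c c' - ⟨r, h₀, hr⟩
      exact ⟨r, V.eq_ofR_of_ge (h₀ ▸ ha.1 ⟨0, rfl⟩), hr⟩
  exact fun t a hta => this hta

theorem bnd (hX : MSQ.loc nl X ∈ w) (hd : SilentMono w) {f : V → TM V} {g : TM V}
    (hC : ∀ r, Stable nl X w (C r)) (H : Triple nl X w A g B)
    (H' : ∀ r, Triple nl X w (B r) (f (V.ofR r)) C) : Triple nl X w A (bnd f g) C := by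
  refine dagger hX hd hC ?_
  rintro t b ⟨u, v, a, hu, hv, ht⟩ Q c c' hg hQ
  rw [show t.list = _ from ht]
  refine (H u a hu Q c c' hg hQ).append hX ?_ hg
  rintro Q c c' hg ⟨r, rfl, hr⟩
  exact H' r v b hv Q c c' hg hr

/-- The rule for computations that consist of a single step. -/
theorem single (hX : MSQ.loc nl X ∈ w) (hd : SilentMono w) {S : Set (Trace × V)}
    (hA : Stable nl X w A) (hB : ∀ r, Stable nl X w (B r))
    (hS : ∀ t a, (t, a) ∈ S → ∃ h k, t.list = [(h, k)] ∧
      ∀ Q h', Good nl X w h h' → A Q h → ∃ r, a = V.ofR r ∧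
        ∃ k', Mv nl X w h h' k k' ∧ B r (Q.der (h', k')) k) :
    Triple nl X w A (_root_.dagger S) B := by
  refine dagger hX hd hB ?_
  intro t a hta Q c c' hg hQ
  obtain ⟨h, k, ht, H⟩ := hS t a hta
  rw [ht]
  intro h' hm
  obtain ⟨r, rfl, k', hk, hr⟩ := H Q h' (hm.good hX) (hA.step _ _ _ hg.1 hm.2.1 hQ)
  exact ⟨k', hk, r, rfl, hr⟩

variable {al : Allocator} {ρ : Env} {v v' : Val} {e e' : Tm} {x y : ℕ}

theorem val (hX : MSQ.loc nl X ∈ w) (hd : SilentMono w) {r : RVal}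
    (hB : ∀ r, Stable nl X w (B r)) (hv : semV al v ρ = V.ofR r) :
    Triple nl X w (B r) (semC al (.val v) ρ) B := by
  rw [semC, hv]
  refine single hX hd (hB r) hB ?_
  rintro t a ⟨h, ht, rfl⟩
  exact ⟨h, h, ht, fun Q h' hg hr =>
    ⟨r, rfl, h', hg.refl hX, (hB r).mono _ _ _ (Q.le_der_stutter h') hr⟩⟩

theorem read (hX : MSQ.loc nl X ∈ w) (hd : SilentMono w) {z : Loc}
    (hv : semV al v ρ = V.ofR (.loc z)) (hA : Stable nl X w A) (hB : ∀ r, Stable nl X w (B r))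
    (H : ∀ Q h h', Good nl X w h h' → A Q h → ∀ r, h.get z = some r → B r (Q.der (h', h')) h) :
    Triple nl X w A (semC al (.read v) ρ) B := by
  rw [semC_read hv]
  refine single hX hd hA hB ?_
  rintro t a ⟨h, k, hc, ht⟩
  simp only [Option.map_eq_some_iff, Prod.mk.injEq] at hc
  obtain ⟨r, hr, rfl, rfl⟩ := hc
  exact ⟨h, h, ht, fun Q h' hg hQ => ⟨r, rfl, h', hg.refl hX, H Q h h' hg hQ r hr⟩⟩

theorem letin_read (hX : MSQ.loc nl X ∈ w) (hd : SilentMono w) {z : Loc}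
    (hv : semV al v ρ = V.ofR (.loc z)) (hA : Stable nl X w A) (hB : ∀ r, Stable nl X w (B r))
    (hC : ∀ r, Stable nl X w (C r))
    (H : ∀ Q h h', Good nl X w h h' → A Q h → ∀ r, h.get z = some r → B r (Q.der (h', h')) h)
    (H' : ∀ r, Triple nl X w (B r) (semC al e (Function.update ρ x (V.ofR r))) C) :
    Triple nl X w A (semC al (.letin x (.read v) e) ρ) C := by
  rw [semC]
  exact bnd hX hd hC (read hX hd hv hA hB H) H'

theorem letin_atomic (hX : MSQ.loc nl X ∈ w) (hd : SilentMono w)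
    (hA : Stable nl X w A) (hB : ∀ r, Stable nl X w (B r)) (hC : ∀ r, Stable nl X w (C r))
    (H : ∀ Q h h', Good nl X w h h' → A Q h → Isolated (semC al e ρ) h fun k r =>
      ∃ k', Mv nl X w h h' k k' ∧ B r (Q.der (h', k')) k)
    (H' : ∀ r, Triple nl X w (B r) (semC al e' (Function.update ρ x (V.ofR r))) C) :
    Triple nl X w A (semC al (.letin x (.atomic e) e') ρ) C := by
  rw [semC]
  refine bnd hX hd hC ?_ H'
  rw [semC]
  refine single hX hd hA hB ?_
  rintro t a ⟨hU, h, k, ht⟩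
  refine ⟨h, k, ht, fun Q h' hg hQ => ?_⟩
  exact H Q h h' hg hQ t a hU k (by rw [show t.list = _ from ht]; exact ⟨rfl, rfl⟩)

/-- Fixed-point induction. A triple speaks about each trace separately, so it holds of the empty
computation and passes from the approximations to their closed union; termination plays no role. -/
theorem lfpT (hX : MSQ.loc nl X ∈ w) (hd : SilentMono w) {g : (V → TM V) → V → TM V}
    {A : RVal → Lang → Heap → Prop} (hB : ∀ r, Stable nl X w (B r))
    (H : ∀ u : V → TM V, (∀ r, Triple nl X w (A r) (u (V.ofR r)) B) →
      ∀ r, Triple nl X w (A r) (g u (V.ofR r)) B) (r : RVal) :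
    Triple nl X w (A r) (lfpT g (V.ofR r)) B := by
  have key : ∀ i r, Triple nl X w (A r) ((g^[i] fun _ => _root_.dagger ∅) (V.ofR r)) B := by
    intro i
    induction i with
    | zero => exact fun r => dagger hX hd hB fun _ _ h => h.elim
    | succ i ih =>
      rw [Function.iterate_succ_apply']
      exact H _ ih
  refine dagger hX hd hB ?_
  rintro t a ⟨i, hi⟩
  exact key i r t a hi

theorem app_lam (hX : MSQ.loc nl X ∈ w) (hd : SilentMono w) {r : RVal}
    (hB : ∀ r, Stable nl X w (B r))
    (H : ∀ F, Triple nl X w A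
      (semC al e (Function.update (Function.update ρ 99 F) x (V.ofR r))) B) :
    Triple nl X w A (V.app (semV al (Prog.lam x e) ρ) (V.ofR r)) B := by
  rw [Prog.lam, semV, V.app_fn_ofR]
  -- The rule for fixed points wants a precondition for every argument; the conjunct pins the
  -- argument to `r`.
  refine pre (A' := fun (_ : Unit) Q c => A Q c ∧ r = r) (fun _ _ _ _ h => ⟨(), h, rfl⟩) fun _ => ?_
  refine lfpT hX hd (A := fun s Q c => A Q c ∧ s = r) hB (fun u _ s => ?_) r
  refine pre (A' := fun (_ : s = r) => A) (fun _ _ _ _ h => ⟨h.2, h.1⟩) ?_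
  rintro rfl
  exact H _

theorem par (hX : MSQ.loc nl X ∈ w) (hd : SilentMono w) {U₁ U₁' U₂ U₂' : TM V}
    {B₁ B₂ : RVal → Prop}
    (H₁ : Triple nl X w (fun Q _ => Lang.of U₁' ≤ Q) U₁ fun r Q _ => Q.mem [] (V.ofR r) ∧ B₁ r)
    (H₂ : Triple nl X w (fun Q _ => Lang.of U₂' ≤ Q) U₂ fun r Q _ => Q.mem [] (V.ofR r) ∧ B₂ r) :
    Triple nl X w (fun Q _ => Lang.of (parT U₁' U₂') ≤ Q) (parT U₁ U₂)
      fun r Q _ => Q.mem [] (V.ofR r) ∧ ∃ r₁ r₂, r = .pair r₁ r₂ ∧ B₁ r₁ ∧ B₂ r₂ := by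
  have st : ∀ P : RVal → Prop, ∀ r, Stable nl X w fun Q _ => Q.mem [] (V.ofR r) ∧ P r :=
    fun P r => ⟨fun _ _ _ h H => ⟨h _ _ H.1, H.2⟩, fun _ _ _ _ _ H => H⟩
  refine dagger hX hd (st _) ?_
  rintro t p ⟨t₁, t₂, a, b, hi, h₁, h₂, hp⟩ Q c c' hg hQ
  obtain rfl : p = V.pair a b := hp
  refine Game.par (Stable.ends (st B₁) a) (Stable.ends (st B₂) b)
    -- Invariant: every interleaving of remaining responses of the threads is a remaining response
    -- of the composition. A derivative on either side extends the interleaving on that side.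
    (fun Q₁ Q₂ Q => ∀ r₁ r₂ r, Q₁.mem r₁ a → Q₂.mem r₂ b → Interleave r₁ r₂ r →
      Q.mem r (V.pair a b))
    (fun Q₁ Q₂ Q p H r₁ r₂ r m₁ m₂ hr => H _ _ _ m₁ m₂ (hr.left p))
    (fun Q₁ Q₂ Q p H r₁ r₂ r m₁ m₂ hr => H _ _ _ m₁ m₂ (hr.right p)) ?_ hi ?_
    (H₁ _ _ h₁ _ _ _ hg fun _ _ h => h) (H₂ _ _ h₂ _ _ _ hg fun _ _ h => h)
  · rintro Q₁ Q₂ Q c H ⟨r₁, rfl, m₁, b₁⟩ ⟨r₂, rfl, m₂, b₂⟩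
    exact ⟨_, V.pair_ofR _ _, V.pair_ofR r₁ r₂ ▸ H _ _ _ m₁ m₂ .nil, r₁, r₂, rfl, b₁, b₂⟩
  · exact fun r₁ r₂ r m₁ m₂ hr => hQ _ _ (Lang.of_parT m₁ m₂ hr)

end Triple

-- From triples to the relation `T₀`

theorem MonoDom.concat {l : List (Heap × Heap)} {h k : Heap} (hl : MonoDom l)
    (hb : ∀ p ∈ l, p.1.dom ⊆ h.dom ∧ p.2.dom ⊆ h.dom) (hk : h.dom ⊆ k.dom) :
    MonoDom (l ++ [(h, k)]) := by
  simp only [MonoDom, List.flatMap_append, List.pairwise_append]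
  refine ⟨hl, by simpa using hk, ?_⟩
  intro a ha b hb'
  have hah : a.dom ⊆ h.dom := by
    obtain ⟨p, hp, hap⟩ := List.mem_flatMap.1 ha
    simp only [List.mem_cons, List.not_mem_nil, or_false] at hap
    rcases hap with rfl | rfl
    exacts [(hb p hp).1, (hb p hp).2]
  simp only [List.flatMap_cons, List.flatMap_nil, List.append_nil, List.mem_cons,
    List.not_mem_nil, or_false] at hb'
  rcases hb' with rfl | rfl
  exacts [hah, hah.trans hk]

/-- Here the proponent moves first, so the environment's opening move is taken to be idle. The
language contains the continuations of `acc`, and the composite move from the initial heaps provides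
the final tile. -/
theorem wins_of_game (hX : MSQ.loc nl X ∈ w) (hd : SilentMono w) {U' : TM V} {E : V → V → Prop}
    {a : V} {h₁ h₁' : Heap} : ∀ (r : List (Heap × Heap)) (h k h' : Heap)
    (acc : List (Heap × Heap)) (Q : Lang),
    (∀ s b, Q.mem s b → (Lang.of U').mem (acc ++ s) b) → MonoDom acc →
    (∀ p ∈ acc, p.1.dom ⊆ h'.dom ∧ p.2.dom ⊆ h'.dom) → Mv nl X w h₁ h₁' h h' →
    Game nl X w (Ends (fun r Q _ => Q.mem [] (V.ofR r) ∧ E (V.ofR r) (V.ofR r)) a)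
      ((h, k) :: r) Q h h' →
    Wins w (MSQ.eff nl X) (MSQ.eff nl X)
      (fun k k' r => Tile w (MSQ.eff nl X) h₁ h₁' k k' ∧
        ∃ a' t', E a a' ∧ t'.list = r ∧ (t', a') ∈ U'.1) ((h, k) :: r) h' acc
  | [], h, k, h', acc, Q, hQ, hm, hb, mv, H => by
    obtain ⟨k', hk, r, rfl, hr, hE⟩ := H h' ((mv.good hX).refl hX)
    obtain ⟨ne, ht⟩ := hQ _ _ hr
    exact ⟨k', hk.tile, (mv.trans hk).tile, _, _, hE, rfl, ht (hm.concat hb (MSQ.step_dom hX hd hk.2.2.1 hk.1.2.1))⟩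
  | (h₂, k₂) :: r, h, k, h', acc, Q, hQ, hm, hb, mv, H => by
    obtain ⟨k', hk, H⟩ := H h' ((mv.good hX).refl hX)
    refine ⟨k', hk.tile, fun h₂' ht => ?_⟩
    have mv' := ht.mv (hk.good hX)
    have d₁ := MSQ.step_dom hX hd hk.2.2.1 hk.1.2.1
    have d₂ := MSQ.step_dom hX hd mv'.2.2.1 mv'.1.2.1
    -- The opponent's tile has become a move `mv'`; prefixing it to the next environment move
    -- restarts the game from the heaps that the opponent has reached.
    refine wins_of_game hX hd r h₂ k₂ h₂' _ (Q.der (h', k')) (fun s b hs => ?_) (hm.concat hb d₁) ?_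
      ((mv.trans hk).trans mv') (fun q hq => H q (mv'.trans hq))
    · simpa using hQ _ _ hs
    · intro p hp
      rcases List.mem_append.1 hp with hp | hp
      · exact ⟨(hb p hp).1.trans (d₁.trans d₂), (hb p hp).2.trans (d₁.trans d₂)⟩
      · obtain rfl := List.mem_singleton.1 hp
        exact ⟨d₁.trans d₂, d₂⟩

/-- The pair already lies in `T₀`; the closure under suprema of chains is not used. -/
theorem Triple.tRel (hX : MSQ.loc nl X ∈ w) (hd : SilentMono w) {U U' : TM V} {E : V → V → Prop}
    (H : Triple nl X w (fun Q _ => Lang.of U' ≤ Q) U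
      fun r Q _ => Q.mem [] (V.ofR r) ∧ E (V.ofR r) (V.ofR r)) :
    TRel w E (MSQ.eff nl X) (MSQ.eff nl X) (MSQ.eff nl X) U U' := by
  refine .of _ ?_
  intro t a hta h₁ hh s₁ h₁' s₁' hs
  have hg : Good nl X w h₁ h₁' := ⟨s₁, s₁', hs _ (MSQ.mem_rds.2 rfl)⟩
  have := H t a hta (Lang.of U') h₁ h₁' hg fun _ _ h => h
  obtain ⟨⟨h, k⟩, r, e⟩ := List.exists_cons_of_ne_nil t.ne
  obtain rfl : h = h₁ := by simpa [e] using hh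
  rw [e] at this ⊢
  exact wins_of_game hX hd r h k h₁' [] (Lang.of U') (fun s b h => h) (by simp [MonoDom])
    (by simp) (hg.refl hX) this

end Triple

/-! ### Evolution of the queue -/

namespace MSQ

variable {nl : ℤ} {X : Loc} {w : World} {h k q : Heap} {x y p : Loc}

/-- `p` reaches the sentinel. -/
def Behind (X : Loc) (h : Heap) (p : Loc) : Prop :=
  ∃ x₀, h.get X = some (RVal.loc x₀) ∧ Reach h p x₀

/-- `p` reaches the sentinel or is reached from it. -/
def Node (X : Loc) (h : Heap) (p : Loc) : Prop :=
  ∃ x₀, h.get X = some (RVal.loc x₀) ∧ (Reach h x₀ p ∨ Reach h p x₀)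

theorem Behind.node (H : Behind X h p) : Node X h p :=
  let ⟨x₀, h₀, H⟩ := H
  ⟨x₀, h₀, .inr H⟩

/-- What the environment preserves. -/
structure Adv (X : Loc) (h k : Heap) : Prop where
  behind : ∀ p, Behind X h p → Behind X k p
  node : ∀ p, Node X h p → Node X k p
  next : ∀ p y, Node X h p → Next h p (RVal.loc y) → Next k p (RVal.loc y)
  elem : ∀ p v, Node X h p → Elem h p v → Elem k p v

theorem Adv.trans (H : Adv X h k) (H' : Adv X k q) : Adv X h q where
  behind p hp := H'.behind p (H.behind p hp)
  node p hp := H'.node p (H.node p hp)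
  next p y hp hy := H'.next p y (H.node p hp) (H.next p y hp hy)
  elem p y hp hy := H'.elem p y (H.node p hp) (H.elem p y hp hy)

theorem Adv.refl : Adv X h h := ⟨fun _ h => h, fun _ h => h, fun _ _ _ h => h, fun _ _ _ h => h⟩

theorem pair_ne_loc {a b : RVal} : RVal.pair a b ≠ RVal.loc x := by simp [RVal.pair, RVal.loc]

theorem loc_ne_int {n : ℤ} : RVal.loc x ≠ RVal.int n := by simp [RVal.loc, RVal.int]

theorem _root_.Heap.get_set_self (v : RVal) : (h.set x v).get x = some v := by simp [Heap.set]

theorem _root_.Heap.get_set_of_ne (v : RVal) (hne : y ≠ x) : (h.set x v).get y = h.get y := by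
  simp [Heap.set, hne]

/-- The root contains a location before and after the update, hence it is not a node and no node
changes. -/
theorem get_set_root_pair {a b : RVal} {x₀ : Loc} (h₀ : h.get X = some (RVal.loc x₀)) :
    (h.set X (RVal.loc x)).get p = some (RVal.pair a b) ↔ h.get p = some (RVal.pair a b) := by
  by_cases hp : p = X
  · subst hp
    simp [Heap.get_set_self, h₀, pair_ne_loc.symm]
  · rw [Heap.get_set_of_ne _ hp]

theorem next_set_root {x₀ : Loc} (h₀ : h.get X = some (RVal.loc x₀)) :
    Next (h.set X (RVal.loc x)) = Next h := by
  ext p v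
  simp [Next, get_set_root_pair h₀]

theorem elem_set_root {x₀ : Loc} (h₀ : h.get X = some (RVal.loc x₀)) :
    Elem (h.set X (RVal.loc x)) = Elem h := by
  ext p v
  simp [Elem, get_set_root_pair h₀]

theorem reach_set_root {x₀ : Loc} (h₀ : h.get X = some (RVal.loc x₀)) :
    Reach (h.set X (RVal.loc x)) = Reach h := by
  simp only [Reach, next_set_root h₀]

theorem chain_set_root {x₀ : Loc} (h₀ : h.get X = some (RVal.loc x₀)) :
    ∀ {y : Loc} {l : List (Loc × ℤ)}, Chain nl h y l → Chain nl (h.set X (RVal.loc x)) y l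
  | _, [], H => by rwa [Chain, next_set_root h₀]
  | _, (_, _) :: _, H =>
    ⟨by rw [next_set_root h₀]; exact H.1, by rw [elem_set_root h₀]; exact H.2.1,
      chain_set_root h₀ H.2.2⟩

theorem IsQueue.dequeue {x₀ x₁ : Loc} {v : ℤ} {l : List (Loc × ℤ)}
    (H : IsQueue nl X h x₀ ((x₁, v) :: l)) : IsQueue nl X (h.set X (RVal.loc x₁)) x₁ l :=
  ⟨Heap.get_set_self _, chain_set_root H.1 H.2.2.2⟩

theorem adv_set_root {x₀ x₁ : Loc} (h₀ : h.get X = some (RVal.loc x₀))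
    (h₁ : Next h x₀ (RVal.loc x₁)) : Adv X h (h.set X (RVal.loc x₁)) where
  behind := by
    rintro p ⟨_, h₀', hp⟩
    obtain rfl := RVal.loc_injective (Option.some.inj (h₀.symm.trans h₀'))
    exact ⟨x₁, Heap.get_set_self _, by rw [reach_set_root h₀]; exact hp.tail h₁⟩
  node := by
    rintro p ⟨_, h₀', hp⟩
    obtain rfl := RVal.loc_injective (Option.some.inj (h₀.symm.trans h₀'))
    refine ⟨x₁, Heap.get_set_self _, ?_⟩
    rw [reach_set_root h₀]
    rcases hp with hp | hp
    -- The old sentinel falls behind the new one. Whatever else it reaches, it reaches through its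
    -- unique successor, the new sentinel.
    · rcases hp.cases_head with rfl | ⟨z, hz, hp⟩
      · exact .inr (.single h₁)
      · obtain rfl := RVal.loc_injective (Next.inj h₁ hz)
        exact .inl hp
    · exact .inr (hp.tail h₁)
  next p y _ H := by rwa [next_set_root h₀]
  elem p y _ H := by rwa [elem_set_root h₀]

theorem IsQueue.inj {x₀ x₀' : Loc} {l l' : List (Loc × ℤ)} (H : IsQueue nl X h x₀ l)
    (H' : IsQueue nl X h x₀' l') : x₀ = x₀' ∧ l = l' := by
  obtain rfl := RVal.loc_injective (Option.some.inj (H.1.symm.trans H'.1))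
  exact ⟨rfl, Chain.inj H.2 H'.2⟩

theorem Sem.queue {h' : Heap} (H : Sem nl X h h') : ∃ x₀ l, IsQueue nl X h x₀ l :=
  let ⟨x₀, l, _, _, H, _⟩ := H
  ⟨x₀, l, H⟩

/-- The last node of a chain. -/
def last (x : Loc) (l : List (Loc × ℤ)) : Loc := (x :: l.map Prod.fst).getLast (by simp)

theorem last_nil : last x [] = x := rfl

theorem last_cons {v : ℤ} {l : List (Loc × ℤ)} : last x ((y, v) :: l) = last y l := by
  simp [last]

/-- The heap after attaching the node `y` with entry `v` to the node `p`. -/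
def attach (nl : ℤ) (h : Heap) (y p : Loc) (e : RVal) (v : ℤ) : Heap :=
  (h.set y (RVal.pair (RVal.int v) (RVal.int nl))).set p (RVal.pair e (RVal.loc y))

-- Attaching a node at the end

section Attach

variable {e : RVal} {v : ℤ}

theorem ne_of_attach (hy : y ∉ h.dom)
    (hp : h.get p = some (RVal.pair e (RVal.int nl))) : y ≠ p := by
  rintro rfl
  exact hy (by simp [Heap.dom, hp])

theorem get_attach (hy : y ∉ h.dom) {z : Loc} {r : RVal} (hz : h.get z = some r) (hzp : z ≠ p) :
    (attach nl h y p e v).get z = some r := by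
  have hzy : z ≠ y := by
    rintro rfl
    exact hy (by simp [Heap.dom, hz])
  rw [attach, Heap.get_set_of_ne _ hzp, Heap.get_set_of_ne _ hzy, hz]

/-- The only `next` field overwritten is a null one, and the new node is fresh; so all pointers to
locations survive. -/
theorem next_attach (hy : y ∉ h.dom)
    (hp : h.get p = some (RVal.pair e (RVal.int nl))) {z x : Loc} (H : Next h z (RVal.loc x)) :
    Next (attach nl h y p e v) z (RVal.loc x) := by
  obtain ⟨e', H⟩ := H
  refine ⟨e', get_attach hy H ?_⟩
  rintro rfl
  exact loc_ne_int (pair_inj (Option.some.inj (H.symm.trans hp))).2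

theorem elem_attach (hy : y ∉ h.dom)
    (hp : h.get p = some (RVal.pair e (RVal.int nl))) {z : Loc} {a : RVal} (H : Elem h z a) :
    Elem (attach nl h y p e v) z a := by
  obtain ⟨n, H⟩ := H
  by_cases hz : z = p
  · subst hz
    rw [(pair_inj (Option.some.inj (H.symm.trans hp))).1]
    exact ⟨_, Heap.get_set_self _⟩
  · exact ⟨n, get_attach hy H hz⟩

theorem root_attach (hy : y ∉ h.dom)
    (hp : h.get p = some (RVal.pair e (RVal.int nl))) {x₀ : Loc} (h₀ : h.get X = some (RVal.loc x₀)) :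
    (attach nl h y p e v).get X = some (RVal.loc x₀) := by
  refine get_attach hy h₀ ?_
  rintro rfl
  exact pair_ne_loc (Option.some.inj (hp.symm.trans h₀))

theorem reach_attach (hy : y ∉ h.dom)
    (hp : h.get p = some (RVal.pair e (RVal.int nl))) {z x : Loc} (H : Reach h z x) : Reach (attach nl h y p e v) z x :=
  Relation.ReflTransGen.mono (fun _ _ H => next_attach hy hp H) _ _ H

theorem adv_attach (hy : y ∉ h.dom)
    (hp : h.get p = some (RVal.pair e (RVal.int nl))) : Adv X h (attach nl h y p e v) where
  behind := fun _ ⟨x₀, h₀, H⟩ => ⟨x₀, root_attach hy hp h₀, reach_attach hy hp H⟩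
  node := fun _ ⟨x₀, h₀, H⟩ =>
    ⟨x₀, root_attach hy hp h₀, H.imp (reach_attach hy hp) (reach_attach hy hp)⟩
  next := fun _ _ _ H => next_attach hy hp H
  elem := fun _ _ _ H => elem_attach hy hp H

theorem chain_attach (hy : y ∉ h.dom)
    (hp : h.get p = some (RVal.pair e (RVal.int nl))) : ∀ {l : List (Loc × ℤ)} {x : Loc}, last x l = p → Chain nl h x l →
    Chain nl (attach nl h y p e v) x (l ++ [(y, v)])
  | [], x, hl, H => by
    obtain rfl : x = p := hl
    have : (attach nl h y x e v).get y = some (RVal.pair (RVal.int v) (RVal.int nl)) := by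
      rw [attach, Heap.get_set_of_ne _ (ne_of_attach hy hp), Heap.get_set_self]
    exact ⟨⟨_, Heap.get_set_self _⟩, ⟨_, this⟩, ⟨_, this⟩⟩
  | (z, a) :: l, x, hl, H =>
    ⟨next_attach hy hp H.1, elem_attach hy hp H.2.1, chain_attach hy hp (last_cons.symm.trans hl) H.2.2⟩

theorem IsQueue.attach (hy : y ∉ h.dom)
    (hp : h.get p = some (RVal.pair e (RVal.int nl))) {x₀ : Loc} {l : List (Loc × ℤ)} (H : IsQueue nl X h x₀ l)
    (hl : last x₀ l = p) : IsQueue nl X (attach nl h y p e v) x₀ (l ++ [(y, v)]) :=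
  ⟨root_attach hy hp H.1, chain_attach hy hp hl H.2⟩

end Attach

theorem Step₁.queue {x₀ : Loc} {l : List (Loc × ℤ)} (hq : IsQueue nl X h x₀ l)
    (H : Step₁ nl X h k) : (∃ x₀ l, IsQueue nl X k x₀ l) ∧ Adv X h k := by
  rcases H with ⟨_, x₁, h₀, h₁, rfl⟩ | ⟨v, _, _, e, y, hq', hy, hp, rfl⟩
  · obtain rfl := RVal.loc_injective (Option.some.inj (hq.1.symm.trans h₀))
    refine ⟨?_, adv_set_root h₀ h₁⟩
    match l, hq with
    | [], hq => exact absurd (Next.inj h₁ hq.2) loc_ne_int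
    | (z, a) :: l, hq =>
      obtain rfl := RVal.loc_injective (Next.inj h₁ hq.2.1)
      exact ⟨_, _, hq.dequeue⟩
  · exact ⟨⟨_, _, IsQueue.attach hy hp hq' rfl⟩, adv_attach hy hp⟩

theorem Step.adv (H : Step nl X h k) : Adv X h k := by
  obtain ⟨H₁, -, H⟩ := H
  have : (∃ x₀ l, IsQueue nl X k x₀ l) ∧ Adv X h k := by
    induction H with
    | refl => exact ⟨H₁.queue, .refl⟩
    | tail _ H ih =>
      obtain ⟨⟨x₀, l, hq⟩, ha⟩ := ih
      obtain ⟨hq', ha'⟩ := H.queue hq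
      exact ⟨hq', ha.trans ha'⟩
  exact this.2

/-- All paths to and from the sentinel run inside the footprint, where the two heaps agree. The
co-reachable part is essential: a thread may still hold nodes that were dequeued meanwhile. -/
theorem Strict.adv (H : Strict nl X h k) : Adv X h k := by
  have fw : ∀ x₀ p, h.get X = some (RVal.loc x₀) → Reach h x₀ p → Reach k x₀ p := by
    intro x₀ p h₀ hp
    induction hp with
    | refl => exact .refl
    | tail hab hbc ih =>
      obtain ⟨e, he⟩ := hbc
      exact ih.tail ⟨e, H.2 _ (.inl (.inr ⟨x₀, h₀, .inl hab⟩)) ▸ he⟩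
  have bw : ∀ x₀ p, h.get X = some (RVal.loc x₀) → Reach h p x₀ → Reach k p x₀ := by
    intro x₀ p h₀ hp
    induction hp using Relation.ReflTransGen.head_induction_on with
    | refl => exact .refl
    | head hab hbc ih =>
      have hm := H.2 _ (.inl (.inr ⟨x₀, h₀, .inr (hbc.head hab)⟩))
      obtain ⟨e, he⟩ := hab
      exact ih.head ⟨e, hm ▸ he⟩
  have hX : h.get X = k.get X := H.2 X (.inl (.inl rfl))
  have nd : ∀ p, Node X h p → h.get p = k.get p := fun p ⟨x₀, h₀, hp⟩ =>
    H.2 p (.inl (.inr ⟨x₀, h₀, hp⟩))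
  exact
    { behind := fun p ⟨x₀, h₀, hp⟩ => ⟨x₀, hX ▸ h₀, bw _ _ h₀ hp⟩
      node := fun p ⟨x₀, h₀, hp⟩ => ⟨x₀, hX ▸ h₀, hp.imp (fw _ _ h₀) (bw _ _ h₀)⟩
      next := fun p y hp ⟨e, he⟩ => ⟨e, nd p hp ▸ he⟩
      elem := fun p v hp ⟨e, he⟩ => ⟨e, nd p hp ▸ he⟩ }

theorem adv_of_step (hX : loc nl X ∈ w) (h₀ : Sat w h) (H : (eff nl X).Step w h k) : Adv X h k :=
  (Step.induction hX (fun _ _ => Step.adv) (fun _ _ _ _ _ _ => Strict.adv)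
    (fun _ _ _ => Adv.trans) H h₀).2

/-- Since `next` is a partial function, everything reachable from `x` lies on the chain, and the
rest of the chain has the same last node. -/
theorem Chain.of_reach {l : List (Loc × ℤ)} (H : Chain nl h x l) (hp : Reach h x p) :
    ∃ l', Chain nl h p l' ∧ last x l = last p l' := by
  induction hp with
  | refl => exact ⟨l, H, rfl⟩
  | tail _ hbc ih =>
    obtain ⟨l', hc, hl⟩ := ih
    match l', hc with
    | [], hc => exact absurd (Next.inj hbc hc) loc_ne_int
    | (z, a) :: l', hc =>
      obtain rfl := RVal.loc_injective (Next.inj hbc hc.1)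
      exact ⟨l', hc.2.2, hl.trans last_cons⟩

/-- A walk along `next` pointers stays connected to the sentinel and can stop only at the end of the
queue, even if it starts at a node dequeued long ago. This is why an enqueue may start from a stale
sentinel. -/
theorem Node.cases {x₀ : Loc} {l : List (Loc × ℤ)} (hq : IsQueue nl X h x₀ l) (H : Node X h p) :
    ∃ e, (h.get p = some (RVal.pair e (RVal.int nl)) ∧ last x₀ l = p) ∨
      ∃ z, h.get p = some (RVal.pair e (RVal.loc z)) ∧ Node X h z := by
  have fw : Reach h x₀ p → ∃ e, (h.get p = some (RVal.pair e (RVal.int nl)) ∧ last x₀ l = p) ∨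
      ∃ z, h.get p = some (RVal.pair e (RVal.loc z)) ∧ Node X h z := by
    intro hp
    obtain ⟨l', hc, hl⟩ := hq.2.of_reach hp
    match l', hc with
    | [], ⟨e, he⟩ => exact ⟨e, .inl ⟨he, hl⟩⟩
    | (z, a) :: l', ⟨⟨e, he⟩, _⟩ => exact ⟨e, .inr ⟨z, he, x₀, hq.1, .inl (hp.tail ⟨e, he⟩)⟩⟩
  obtain ⟨_, h₀, hp⟩ := H
  obtain rfl := RVal.loc_injective (Option.some.inj (hq.1.symm.trans h₀))
  rcases hp with hp | hp
  · exact fw hp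
  · rcases hp.cases_head with rfl | ⟨z, ⟨e, he⟩, hp⟩
    · exact fw .refl
    · exact ⟨e, .inr ⟨z, he, x₀, hq.1, .inr hp⟩⟩

/-- A node that reaches the sentinel without being it has a successor. So a null `next` field means
that the node is the current sentinel and that the queue is empty right now. -/
theorem Behind.cases {x₀ : Loc} {l : List (Loc × ℤ)} (hq : IsQueue nl X h x₀ l)
    (H : Behind X h p) :
    ∃ e, (h.get p = some (RVal.pair e (RVal.int nl)) ∧ l = []) ∨
      ∃ z, h.get p = some (RVal.pair e (RVal.loc z)) := by
  obtain ⟨_, h₀, hp⟩ := H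
  obtain rfl := RVal.loc_injective (Option.some.inj (hq.1.symm.trans h₀))
  rcases hp.cases_head with rfl | ⟨z, ⟨e, he⟩, hp⟩
  · match l, hq.2 with
    | [], ⟨e, he⟩ => exact ⟨e, .inl ⟨he, rfl⟩⟩
    | (z, a) :: l', ⟨⟨e, he⟩, _⟩ => exact ⟨e, .inr ⟨z, he⟩⟩
  · exact ⟨e, .inr ⟨z, he⟩⟩

theorem IsQueue.root_node {x₀ : Loc} {l : List (Loc × ℤ)} (hq : IsQueue nl X h x₀ l) :
    Behind X h x₀ := ⟨x₀, hq.1, .refl⟩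

theorem Step₁.step {h' k' : Heap} (hs : Sem nl X h h') (hs' : Sem nl X k k') (H : Step₁ nl X h k) :
    (eff nl X).Step w h k :=
  .single (.inl ⟨_, mem_wrs.2 rfl, hs.trans hs.symm, hs'.trans hs'.symm, .single H⟩)

theorem _root_.Good.mv {h' k' : Heap} (hg : Good nl X w h h') (H : Step₁ nl X h k)
    (H' : Step₁ nl X h' k') (hs : Sem nl X k k') : Mv nl X w h h' k k' :=
  ⟨hg, H.step hg.2.2 hs, H'.step hg.2.2.symm hs.symm, hs⟩

/-- The sequential behaviour of a dequeue. -/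
def DeqSpec (nl : ℤ) (X : Loc) (h k : Heap) (r : RVal) : Prop :=
  (∃ x₀, IsQueue nl X h x₀ [] ∧ k = h ∧ r = .int nl) ∨
  ∃ x₀ x₁ v l, IsQueue nl X h x₀ ((x₁, v) :: l) ∧ k = h.set X (RVal.loc x₁) ∧ r = .int v

/-- The sequential behaviour of an enqueue. -/
def EnqSpec (al : Allocator) (nl : ℤ) (X : Loc) (v : ℤ) (h k : Heap) (r : RVal) : Prop :=
  ∃ x₀ l e, IsQueue nl X h x₀ l ∧ h.get (last x₀ l) = some (RVal.pair e (RVal.int nl)) ∧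
    k = attach nl h (al.new h (RVal.pair (RVal.int v) (RVal.int nl))) (last x₀ l) e v ∧ r = .unit

theorem exists_deq_nil {h' : Heap} {x₀ : Loc} (hs : Sem nl X h h') (hq : IsQueue nl X h x₀ []) :
    DeqSpec nl X h' h' (.int nl) := by
  obtain ⟨_, _, x₀', l', hq', hq'', hl⟩ := hs
  obtain ⟨rfl, rfl⟩ := hq.inj hq'
  obtain rfl : l' = [] := by simpa using hl
  exact .inl ⟨_, hq'', rfl, rfl⟩

theorem exists_deq_cons {h' : Heap} {x₀ x₁ : Loc} {v : ℤ} {l : List (Loc × ℤ)}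
    (hg : Good nl X w h h') (hq : IsQueue nl X h x₀ ((x₁, v) :: l)) :
    ∃ k', DeqSpec nl X h' k' (.int v) ∧ Mv nl X w h h' (h.set X (RVal.loc x₁)) k' := by
  obtain ⟨_, _, x₀', l', hq', hq'', hl⟩ := hg.2.2
  obtain ⟨rfl, rfl⟩ := hq.inj hq'
  match l', hl, hq'' with
  | (x₁', v') :: l', hl, hq'' =>
    obtain ⟨rfl, hl'⟩ : v = v' ∧ l.map Prod.snd = l'.map Prod.snd := by simpa using hl
    refine ⟨_, .inr ⟨_, _, _, _, hq'', rfl, rfl⟩, hg.mv ?_ ?_ ?_⟩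
    · exact .inl ⟨_, _, hq.1, hq.2.1, rfl⟩
    · exact .inl ⟨_, _, hq''.1, hq''.2.1, rfl⟩
    · exact ⟨_, _, _, _, hq.dequeue, hq''.dequeue, hl'⟩

theorem Chain.get_last : ∀ {l : List (Loc × ℤ)} {x : Loc}, Chain nl h x l →
    ∃ e, h.get (last x l) = some (RVal.pair e (RVal.int nl))
  | [], _, ⟨e, he⟩ => ⟨e, he⟩
  | (_, _) :: _, _, H => by
    rw [last_cons]
    exact H.2.2.get_last

/-- The pilot and the response may allocate at different locations and attach to different nodes;
matching heaps only need the same entries. -/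
theorem exists_enq (al : Allocator) {h' : Heap} {x₀ : Loc} {v : ℤ} {e : RVal} {l : List (Loc × ℤ)}
    (hg : Good nl X w h h') (hq : IsQueue nl X h x₀ l) (hy : y ∉ h.dom)
    (he : h.get (last x₀ l) = some (RVal.pair e (RVal.int nl))) :
    ∃ k', EnqSpec al nl X v h' k' .unit ∧ Mv nl X w h h' (attach nl h y (last x₀ l) e v) k' := by
  obtain ⟨_, _, x₀', l', hq', hq'', hl⟩ := hg.2.2
  obtain ⟨rfl, rfl⟩ := hq.inj hq'
  obtain ⟨e', he'⟩ := hq''.2.get_last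
  have hy' := al.fresh h' (RVal.pair (RVal.int v) (RVal.int nl))
  refine ⟨_, ⟨_, _, e', hq'', he', rfl, rfl⟩, hg.mv ?_ ?_ ?_⟩
  · exact .inr ⟨v, _, _, _, _, hq, hy, he, rfl⟩
  · exact .inr ⟨v, _, _, _, _, hq'', hy', he', rfl⟩
  · exact ⟨_, _, _, _, hq.attach hy he rfl, hq''.attach hy' he' rfl, by simp [hl]⟩

end MSQ

/-! ### The pilot's side: every run of a queue operation has one linearization point -/

section Pilot

variable {nl : ℤ} {X : Loc} {w : World} {al : Allocator}

namespace Triple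

variable {A : Lang → Heap → Prop} {B : RVal → Lang → Heap → Prop} {U : TM V}

theorem of_exists {ι : Sort*} {A : ι → Lang → Heap → Prop} (H : ∀ i, Triple nl X w (A i) U B) :
    Triple nl X w (fun Q c => ∃ i, A i Q c) U B :=
  pre (fun _ _ _ _ h => h) H

theorem of_and {p : Prop} (H : p → Triple nl X w A U B) :
    Triple nl X w (fun Q c => p ∧ A Q c) U B :=
  pre (A' := fun (_ : p) => A) (fun _ _ _ _ h => ⟨h.1, h.2⟩) H

theorem of_or {A' : Lang → Heap → Prop} (H : Triple nl X w A U B) (H' : Triple nl X w A' U B) :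
    Triple nl X w (fun Q c => A Q c ∨ A' Q c) U B :=
  fun t a ht Q c c' hg hQ => hQ.elim (H t a ht Q c c' hg) (H' t a ht Q c c' hg)

end Triple

/-- The operation `S` is still to be answered. -/
def Pending (S : Heap → Heap → RVal → Prop) (Q : Lang) : Prop :=
  ∀ h k r, S h k r → Q.mem [(h, k)] (V.ofR r)

/-- The operation has been answered with an R-value that satisfies `P`. -/
def Done (P : RVal → Prop) (r : RVal) (Q : Lang) (_ : Heap) : Prop := Q.mem [] (V.ofR r) ∧ P r

theorem Pending.stutter {S : Heap → Heap → RVal → Prop} {Q : Lang} (H : Pending S Q) (h : Heap) :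
    Pending S (Q.der (h, h)) := fun a b r hr => Q.le_der_stutter h _ _ (H a b r hr)

/-- Assertions about heaps that are stable under the environment. -/
def HStable (nl : ℤ) (X : Loc) (w : World) (P : Heap → Prop) : Prop :=
  ∀ c h, Sat w c → (MSQ.eff nl X).Step w c h → P c → P h

theorem HStable.true : HStable nl X w fun _ => True := fun _ _ _ _ h => h

theorem HStable.behind (hX : MSQ.loc nl X ∈ w) (p : Loc) :
    HStable nl X w fun c => MSQ.Behind X c p :=
  fun _ _ h₀ h H => (MSQ.adv_of_step hX h₀ h).behind p H

theorem HStable.node (hX : MSQ.loc nl X ∈ w) (p : Loc) :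
    HStable nl X w fun c => MSQ.Node X c p :=
  fun _ _ h₀ h H => (MSQ.adv_of_step hX h₀ h).node p H

theorem HStable.node_next (hX : MSQ.loc nl X ∈ w) (p z : Loc) :
    HStable nl X w fun c => MSQ.Node X c p ∧ MSQ.Next c p (RVal.loc z) :=
  fun _ _ h₀ h H => ⟨(MSQ.adv_of_step hX h₀ h).node p H.1,
    (MSQ.adv_of_step hX h₀ h).next p z H.1 H.2⟩

theorem HStable.behind_next (hX : MSQ.loc nl X ∈ w) (p z : Loc) :
    HStable nl X w fun c => MSQ.Behind X c p ∧ MSQ.Next c p (RVal.loc z) :=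
  fun _ _ h₀ h H => ⟨(MSQ.adv_of_step hX h₀ h).behind p H.1,
    (MSQ.adv_of_step hX h₀ h).next p z H.1.node H.2⟩

theorem HStable.node_elem (hX : MSQ.loc nl X ∈ w) (p : Loc) (v : RVal) :
    HStable nl X w fun c => MSQ.Node X c p ∧ MSQ.Elem c p v :=
  fun _ _ h₀ h H => ⟨(MSQ.adv_of_step hX h₀ h).node p H.1,
    (MSQ.adv_of_step hX h₀ h).elem p v H.1 H.2⟩

namespace Stable

theorem pending {S : Heap → Heap → RVal → Prop} {P : Heap → Prop} (hP : HStable nl X w P) :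
    Stable nl X w fun Q c => Pending S Q ∧ P c :=
  ⟨fun _ _ _ h H => ⟨fun a b r hr => h _ _ (H.1 a b r hr), H.2⟩,
    fun _ _ _ h₀ h H => ⟨H.1, hP _ _ h₀ h H.2⟩⟩

theorem answered {a : V} {P : Heap → Prop} (hP : HStable nl X w P) :
    Stable nl X w fun Q c => Q.mem [] a ∧ P c :=
  ⟨fun _ _ _ h H => ⟨h _ _ H.1, H.2⟩, fun _ _ _ h₀ h H => ⟨H.1, hP _ _ h₀ h H.2⟩⟩

theorem done {P : RVal → Prop} (r : RVal) : Stable nl X w (Done P r) :=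
  ⟨fun _ _ _ h H => ⟨h _ _ H.1, H.2⟩, fun _ _ _ _ _ H => H⟩

theorem of_exists {ι : Sort*} {A : ι → Lang → Heap → Prop} (H : ∀ i, Stable nl X w (A i)) :
    Stable nl X w fun Q c => ∃ i, A i Q c :=
  ⟨fun _ _ _ h ⟨i, hi⟩ => ⟨i, (H i).mono _ _ _ h hi⟩,
    fun _ _ _ h₀ h ⟨i, hi⟩ => ⟨i, (H i).step _ _ _ h₀ h hi⟩⟩

theorem of_and {p : Prop} {A : Lang → Heap → Prop} (H : Stable nl X w A) :
    Stable nl X w fun Q c => p ∧ A Q c :=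
  ⟨fun _ _ _ h hi => ⟨hi.1, H.mono _ _ _ h hi.2⟩,
    fun _ _ _ h₀ h hi => ⟨hi.1, H.step _ _ _ h₀ h hi.2⟩⟩

theorem of_or {A A' : Lang → Heap → Prop} (H : Stable nl X w A) (H' : Stable nl X w A') :
    Stable nl X w fun Q c => A Q c ∨ A' Q c :=
  ⟨fun _ _ _ h => Or.imp (H.mono _ _ _ h) (H'.mono _ _ _ h),
    fun _ _ _ h₀ h => Or.imp (H.step _ _ _ h₀ h) (H'.step _ _ _ h₀ h)⟩

end Stable

/-- The bound value is a function value and so not isolated, hence the unit law requires a monotone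
continuation; it is monotone because it merely applies the variable. -/
theorem semC_letin_val_app {ρ : Env} {x : ℕ} {v v' : Val} {d : V}
    (hv : ∀ b, semV al v' (Function.update ρ x b) = d) :
    semC al (.letin x (.val v) (.app (.var x) v')) ρ = V.app (semV al v ρ) d := by
  have : ∀ b, semC al (.app (.var x) v') (Function.update ρ x b) = V.app b d := fun b => by
    rw [semC, hv]
    simp [semV]
  rw [semC, semC, bnd_rtn, this]
  intro b hb
  rw [this, this]
  exact V.app_mono hb _

theorem atom_loc_ne_int {x : Loc} {n : ℤ} : Atom.loc x ≠ Atom.int n := by simp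

-- Linearization points of the two operations

open MSQ Prog

/-- The stable facts carried along are that `n₀`, once the sentinel, stays behind the sentinel, and
that a successor `n₁` once seen remains its successor. -/
theorem Triple.deqBody (hX : MSQ.loc nl X ∈ w) (hd : SilentMono w) {ρ : Env}
    (H : Triple nl X w (fun Q _ => Pending (DeqSpec nl X) Q ∧ True) (V.app (ρ 1) (V.ofR .unit))
      (Done fun r => ∃ n, r = .int n)) :
    Triple nl X w (fun Q _ => Pending (DeqSpec nl X) Q ∧ True) (semC al (deqBody nl X) ρ)
      (Done fun r => ∃ n, r = .int n) := by
  rw [Prog.deqBody]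
  refine letin_read hX hd (z := X) (by simp [semV])
    (B := fun r Q c => ∃ n₀, r = .loc n₀ ∧ Pending (DeqSpec nl X) Q ∧ Behind X c n₀)
    (.pending .true) (fun r => .of_exists fun n₀ => .of_and (.pending (.behind hX n₀))) .done ?_
    fun r => of_exists fun n₀ => of_and ?_
  · rintro Q h h' hg ⟨hP, -⟩ r hr
    obtain ⟨x₀, l, hq⟩ := hg.2.2.queue
    exact ⟨x₀, Option.some.inj (hr.symm.trans hq.1), hP.stutter h', hq.root_node⟩
  rintro rfl
  refine letin_read hX hd (z := n₀) (by simp [semV])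
    (B := fun r Q c => (∃ e, r = .pair e (.int nl) ∧ Q.mem [] (V.ofR (.int nl)) ∧ True) ∨
      ∃ e n₁, r = .pair e (.loc n₁) ∧ Pending (DeqSpec nl X) Q ∧
        (Behind X c n₀ ∧ Next c n₀ (.loc n₁)))
    (.pending (.behind hX n₀)) (fun r => .of_or (.of_exists fun e => .of_and (.answered .true))
      (.of_exists fun e => .of_exists fun n₁ => .of_and (.pending (.behind_next hX n₀ n₁)))) .done ?_
    fun r => of_or (of_exists fun e => of_and ?_)
      (of_exists fun e => of_exists fun n₁ => of_and ?_)
  · rintro Q h h' hg ⟨hP, hb⟩ r hr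
    obtain ⟨x₀, l, hq⟩ := hg.2.2.queue
    -- Linearization point of a dequeue from an empty queue: although `n₀` was read earlier, a null
    -- `next` field shows emptiness at this very moment. In the other case the response stutters.
    obtain ⟨e, ⟨he, rfl⟩ | ⟨n₁, he⟩⟩ := hb.cases hq
    · exact .inl ⟨e, Option.some.inj (hr.symm.trans he),
        hP _ _ _ (exists_deq_nil hg.2.2 hq), trivial⟩
    · exact .inr ⟨e, n₁, Option.some.inj (hr.symm.trans he), hP.stutter h', hb, e, he⟩
  · rintro rfl
    rw [semC_ifEq_pos (a := .int nl) (b := .int nl) (semV_snd (r := e) (by simp [semV]; rfl))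
      (by simp [semV]; rfl) rfl]
    refine pre (A' := fun (_ : Unit) => Done (fun r => ∃ n, r = .int n) (.int nl))
      (fun Q c c' _ h => ⟨(), h.1, nl, rfl⟩) fun _ => ?_
    exact val hX hd .done (by simp [semV])
  rintro rfl
  rw [semC_ifEq_neg (a := .loc n₁) (b := .int nl) (semV_snd (r := e) (by simp [semV]; rfl))
    (by simp [semV]; rfl) atom_loc_ne_int]
  refine letin_read hX hd (z := n₀) (by simp [semV])
    (B := fun r Q c => ∃ e, r = .pair e (.loc n₁) ∧ Pending (DeqSpec nl X) Q ∧
      (Behind X c n₀ ∧ Next c n₀ (.loc n₁)))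
    (.pending (.behind_next hX n₀ n₁))
    (fun r => .of_exists fun e => .of_and (.pending (.behind_next hX n₀ n₁))) .done ?_
    fun r => of_exists fun e => of_and ?_
  · rintro Q h h' hg ⟨hP, hb, e, he⟩ r hr
    exact ⟨e, Option.some.inj (hr.symm.trans he), hP.stutter h', hb, e, he⟩
  rintro rfl
  rw [semC_letin_val (semV_snd (r := e) (s := .loc n₁) (by simp [semV])), cas]
  refine letin_atomic hX hd
    (B := fun r Q c => (r = .bool true ∧ ∃ v, Q.mem [] (V.ofR (.int v)) ∧
      (Node X c n₁ ∧ Elem c n₁ (.int v))) ∨ (r = .bool false ∧ Pending (DeqSpec nl X) Q ∧ True))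
    (.pending (.behind_next hX n₀ n₁))
    (fun r => .of_or (.of_and (.of_exists fun v => .answered (.node_elem hX n₁ _)))
      (.of_and (.pending .true))) .done ?_
    fun r => of_or (of_and ?_) (of_and ?_)
  · rintro Q h h' hg ⟨hP, hb, hn⟩
    obtain ⟨x₀, l, hq⟩ := hg.2.2.queue
    refine .letin_read (z := X) (by simp [semV]) fun r hr => ?_
    obtain rfl := Option.some.inj (hr.symm.trans hq.1)
    by_cases hx : x₀ = n₀
    · subst hx
      rw [semC_ifEq_pos (a := .loc x₀) (b := .loc x₀) (by simp [semV]; rfl) (by simp [semV]; rfl) rfl]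
      refine .letin_write (z := X) (r := .loc n₁) (by simp [semV]) (by simp [semV]) ?_
      refine .val (r := .bool true) (by simp [semV]) ?_
      -- Linearization point of a successful dequeue: `n₀` is the sentinel and still points to `n₁`,
      -- so the queue is not empty and `n₁` holds its first entry `v`.
      match l, hq with
      | [], hq => exact absurd (Next.inj hn hq.2) loc_ne_int
      | (z, v) :: l, hq =>
        obtain rfl := RVal.loc_injective (Next.inj hn hq.2.1)
        obtain ⟨k', hk, mv⟩ := exists_deq_cons hg hq
        refine ⟨k', mv, .inl ⟨rfl, v, hP _ _ _ hk, hq.dequeue.root_node.node, ?_⟩⟩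
        rw [elem_set_root hq.1]
        exact hq.2.2.1
    · rw [semC_ifEq_neg (a := .loc x₀) (b := .loc n₀) (by simp [semV]; rfl) (by simp [semV]; rfl)
        (by simpa using hx)]
      refine .val (r := .bool false) (by simp [semV]) ?_
      exact ⟨h', hg.refl hX, .inr ⟨rfl, hP.stutter h', trivial⟩⟩
  · rintro rfl
    rw [semC_ite_true (by simp [semV])]
    -- The operation is already answered with `v`. Later dequeues may pass `n₁`, but it stays a node
    -- and keeps its entry, so this read returns `v`.
    refine of_exists fun v => letin_read hX hd (z := n₁) (by simp [semV])
      (B := fun r Q c => ∃ n, r = .pair (.int v) n ∧ Q.mem [] (V.ofR (.int v)) ∧ True)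
      (.answered (.node_elem hX n₁ _))
      (fun r => .of_exists fun e => .of_and (.answered .true)) .done ?_
      fun r => of_exists fun n => of_and ?_
    · rintro Q h h' hg ⟨hQ, -, n, hn⟩ r hr
      exact ⟨n, Option.some.inj (hr.symm.trans hn), Q.le_der_stutter h' _ _ hQ, trivial⟩
    rintro rfl
    refine pre (A' := fun (_ : Unit) => Done (fun r => ∃ n, r = .int n) (.int v))
      (fun Q c c' _ h => ⟨(), h.1, v, rfl⟩) fun _ => ?_
    exact val hX hd .done (semV_fst (s := n) (by simp [semV]))
  · rintro rfl
    rw [semC_ite_false (by simp [semV]), semC]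
    simpa [semV, unitV] using H

theorem Triple.dequeue (hX : MSQ.loc nl X ∈ w) (hd : SilentMono w) (ρ : Env) :
    Triple nl X w (fun Q _ => Pending (DeqSpec nl X) Q ∧ True)
      (V.app (semV al (Prog.dequeue nl X) ρ) (V.ofR .unit)) (Done fun r => ∃ n, r = .int n) := by
  refine app_lam hX hd .done fun F => ?_
  rw [semC_letin_val_app (d := V.ofR .unit) (fun b => by simp [semV, unitV]), semV, V.app_fn_ofR]
  refine pre (A' := fun (_ : Unit) Q _ => RVal.unit = .unit ∧ Pending (DeqSpec nl X) Q ∧ True)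
    (fun _ _ _ _ h => ⟨(), rfl, h⟩) fun _ => ?_
  refine lfpT hX hd (A := fun r Q _ => r = .unit ∧ Pending (DeqSpec nl X) Q ∧ True) .done
    (fun u hu r => ?_) .unit
  refine of_and ?_
  rintro rfl
  refine deqBody hX hd ?_
  simp only [ne_eq, OfNat.one_ne_ofNat, not_false_eq_true, Function.update_of_ne,
    Function.update_self, V.app_fn_ofR]
  refine pre (A' := fun (_ : Unit) Q _ => RVal.unit = .unit ∧ Pending (DeqSpec nl X) Q ∧ True)
    (fun _ _ _ _ h => ⟨(), rfl, h⟩) fun _ => hu _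

/-- The loop invariant is only that `p` is connected to the sentinel; it need not belong to the
current queue. -/
theorem Triple.enqBody (hX : MSQ.loc nl X ∈ w) (hd : SilentMono w) {ρ : Env} {v : ℤ} {p : Loc}
    (hv : ρ 0 = V.ofR (.int v)) (hp : ρ 2 = V.ofR (.loc p))
    (H : ∀ z, Triple nl X w (fun Q c => Pending (EnqSpec al nl X v) Q ∧ Node X c z)
      (V.app (ρ 1) (V.ofR (.loc z))) (Done fun r => r = .unit)) :
    Triple nl X w (fun Q c => Pending (EnqSpec al nl X v) Q ∧ Node X c p)
      (semC al (enqBody nl) ρ) (Done fun r => r = .unit) := by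
  -- Both retry branches read `p` again. A successor seen earlier is permanent, so this read finds a
  -- successor too, and that is again a node.
  have next : ∀ (z : Loc) (ρ' : Env), ρ' 1 = ρ 1 → ρ' 2 = ρ 2 →
      Triple nl X w (fun Q c => Pending (EnqSpec al nl X v) Q ∧ (Node X c p ∧ Next c p (.loc z)))
        (semC al (.letin 10 (.read (.var 2)) (.app (.var 1) (.snd (.var 10)))) ρ')
        (Done fun r => r = .unit) := by
    intro z ρ' h₁ h₂
    refine letin_read hX hd (z := p) (by simp [semV, h₂, hp])
      (B := fun r Q c => ∃ e z, r = .pair e (.loc z) ∧ Pending (EnqSpec al nl X v) Q ∧ Node X c z)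
      (.pending (.node_next hX p z))
      (fun r => .of_exists fun e => .of_exists fun z => .of_and (.pending (.node hX z))) .done ?_
      fun r => of_exists fun e => of_exists fun z => of_and ?_
    · rintro Q h h' hg ⟨hP, hn, e, he⟩ r hr
      obtain ⟨x₀, l, hq⟩ := hg.2.2.queue
      obtain ⟨e', ⟨he', -⟩ | ⟨z', he', hz'⟩⟩ := hn.cases hq
      · exact absurd (pair_inj (Option.some.inj (he.symm.trans he'))).2 loc_ne_int
      · exact ⟨e', z', Option.some.inj (hr.symm.trans he'), hP.stutter h', hz'⟩
    rintro rfl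
    rw [semC, semV_snd (r := e) (s := .loc z) (by simp [semV])]
    simpa [semV, h₁] using H z
  rw [Prog.enqBody]
  refine letin_read hX hd (z := p) (by simp [semV, hp])
    (B := fun r Q c => (∃ e, r = .pair e (.int nl) ∧ Pending (EnqSpec al nl X v) Q ∧ Node X c p) ∨
      ∃ e z, r = .pair e (.loc z) ∧ Pending (EnqSpec al nl X v) Q ∧
        (Node X c p ∧ Next c p (.loc z)))
    (.pending (.node hX p)) (fun r => .of_or (.of_exists fun e => .of_and (.pending (.node hX p)))
      (.of_exists fun e => .of_exists fun z => .of_and (.pending (.node_next hX p z)))) .done ?_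
    fun r => of_or (of_exists fun e => of_and ?_)
      (of_exists fun e => of_exists fun z => of_and ?_)
  · rintro Q h h' hg ⟨hP, hn⟩ r hr
    obtain ⟨x₀, l, hq⟩ := hg.2.2.queue
    obtain ⟨e, ⟨he, -⟩ | ⟨z, he, -⟩⟩ := hn.cases hq
    -- That `next` was null is not stable under the environment and is forgotten; the atomic block
    -- tests it again.
    · exact .inl ⟨e, Option.some.inj (hr.symm.trans he), hP.stutter h', hn⟩
    · exact .inr ⟨e, z, Option.some.inj (hr.symm.trans he), hP.stutter h', hn, e, he⟩
  · rintro rfl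
    rw [semC_ifEq_pos (a := .int nl) (b := .int nl) (semV_snd (r := e) (by simp [semV]; rfl))
      (by simp [semV]; rfl) rfl]
    refine letin_atomic hX hd
      (B := fun r Q c => (r = .bool true ∧ Q.mem [] (V.ofR .unit) ∧ True) ∨
        (r = .bool false ∧ ∃ z, Pending (EnqSpec al nl X v) Q ∧
          (Node X c p ∧ Next c p (.loc z))))
      (.pending (.node hX p))
      (fun r => .of_or (.of_and (.answered .true))
        (.of_and (.of_exists fun z => .pending (.node_next hX p z)))) .done ?_
      fun r => of_or (of_and ?_) (of_and ?_)
    · rintro Q h h' hg ⟨hP, hn⟩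
      obtain ⟨x₀, l, hq⟩ := hg.2.2.queue
      refine .letin_read (z := p) (by simp [semV, hp]) fun r hr => ?_
      -- Linearization point of the enqueue: a null `next` field identifies `p` as the last node, so
      -- the update attaches to the end of the queue. Otherwise the block changes nothing and a
      -- permanent successor is known.
      obtain ⟨e, ⟨he, rfl⟩ | ⟨z, he, hz⟩⟩ := hn.cases hq
      · obtain rfl := Option.some.inj (hr.symm.trans he)
        rw [semC_ifEq_pos (a := .int nl) (b := .int nl) (semV_snd (r := e) (by simp [semV]; rfl))
          (by simp [semV]; rfl) rfl]
        refine .letin_ref (r := .pair (.int v) (.int nl))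
          (semV_pair (by simp [semV, hv]) (by simp [semV])) ?_
        refine .letin_write (z := last x₀ l) (by simp [semV, hp])
          (semV_pair (semV_fst (r := e) (s := .int nl) (by simp [semV])) (by simp [semV]; rfl)) ?_
        refine .val (r := .bool true) (by simp [semV]) ?_
        obtain ⟨k', hk, mv⟩ := exists_enq (v := v) al hg hq (al.fresh h _) he
        exact ⟨k', mv, .inl ⟨rfl, hP _ _ _ hk, trivial⟩⟩
      · obtain rfl := Option.some.inj (hr.symm.trans he)
        rw [semC_ifEq_neg (a := .loc z) (b := .int nl) (semV_snd (r := e) (by simp [semV]; rfl))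
          (by simp [semV]; rfl) atom_loc_ne_int]
        refine .val (r := .bool false) (by simp [semV]) ?_
        exact ⟨h', hg.refl hX, .inr ⟨rfl, z, hP.stutter h', hn, e, he⟩⟩
    · rintro rfl
      rw [semC_ite_true (by simp [semV])]
      refine pre (A' := fun (_ : Unit) => Done (fun r => r = .unit) .unit)
        (fun Q c c' _ h => ⟨(), h.1, rfl⟩) fun _ => ?_
      exact val hX hd .done (by simp [semV, unitV])
    · rintro rfl
      rw [semC_ite_false (by simp [semV])]
      exact of_exists fun z => next z _ (by simp) (by simp)
  · rintro rfl
    rw [semC_ifEq_neg (a := .loc z) (b := .int nl) (semV_snd (r := e) (by simp [semV]; rfl))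
      (by simp [semV]; rfl) atom_loc_ne_int]
    exact next z _ (by simp) (by simp)

/-- As in `semC_letin_val_app`, the bound function value is not isolated; the continuation depends
on it monotonically through an application inside `bnd`. -/
theorem semC_enqueue_body {ρ : Env} {e : Tm} :
    (semC al (.letin 1 (.val (.fix 1 2 e)) (.letin 11 (.read (.rval (RVal.loc X)))
      (.app (.var 1) (.var 11)))) ρ) =
    bnd (fun d => V.app (semV al (.fix 1 2 e) ρ) d) (semC al (.read (.rval (RVal.loc X))) ρ) := by
  have : ∀ b, semC al (.letin 11 (.read (.rval (RVal.loc X))) (.app (.var 1) (.var 11)))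
      (Function.update ρ 1 b) = bnd (fun d => V.app b d) (semC al (.read (.rval (RVal.loc X))) ρ) := by
    intro b
    have h : ∀ ρ' : Env, semC al (.read (.rval (RVal.loc X))) ρ' =
        semC al (.read (.rval (RVal.loc X))) ρ := fun ρ' => by
      rw [semC_read (z := X) (by simp [semV]), semC_read (z := X) (by simp [semV])]
    rw [semC, h]
    congr 1
  rw [semC, semC, bnd_rtn, this]
  intro b hb
  rw [this, this]
  exact bnd_mono _ fun a => V.app_mono hb a

theorem Triple.enqueue (hX : MSQ.loc nl X ∈ w) (hd : SilentMono w) (ρ : Env) (v : ℤ) :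
    Triple nl X w (fun Q _ => Pending (EnqSpec al nl X v) Q ∧ True)
      (V.app (semV al (Prog.enqueue nl X) ρ) (V.ofR (.int v))) (Done fun r => r = .unit) := by
  refine app_lam hX hd .done fun F => ?_
  rw [semC_enqueue_body]
  refine bnd hX hd .done (read hX hd (z := X) (by simp [semV])
    (B := fun r Q c => ∃ p, r = .loc p ∧ Pending (EnqSpec al nl X v) Q ∧ Node X c p)
    (.pending .true) (fun r => .of_exists fun p => .of_and (.pending (.node hX p))) ?_) ?_
  · rintro Q h h' hg ⟨hP, -⟩ r hr
    obtain ⟨x₀, l, hq⟩ := hg.2.2.queue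
    exact ⟨x₀, Option.some.inj (hr.symm.trans hq.1), hP.stutter h', hq.root_node.node⟩
  · intro r
    rw [semV, V.app_fn_ofR]
    refine lfpT hX hd (A := fun r Q c =>
      ∃ p, r = .loc p ∧ Pending (EnqSpec al nl X v) Q ∧ Node X c p) .done (fun u hu r => ?_) r
    refine of_exists fun p => of_and ?_
    rintro rfl
    refine enqBody hX hd (by simp) (by simp) fun z => ?_
    simp only [ne_eq, OfNat.one_ne_ofNat, not_false_eq_true, Function.update_of_ne,
      Function.update_self, V.app_fn_ofR]
    exact pre (A' := fun (_ : Unit) Q c => ∃ p, RVal.loc z = .loc p ∧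
      Pending (EnqSpec al nl X v) Q ∧ Node X c p) (fun _ _ _ _ h => ⟨(), z, rfl, h⟩) fun _ => hu _

end Pilot

/-! ### The response: the operations may run without interruption -/

section Response

variable {nl : ℤ} {X : Loc} {al : Allocator} {h k : Heap} {r : RVal}

open MSQ Prog

theorem Run.val {ρ : Env} {v : Val} {a : V} (hv : semV al v ρ = a) :
    Run (semC al (.val v) ρ) h h a := by
  rw [semC, hv]
  exact .rtn

theorem Run.cas_success {ρ : Env} {n₀ n₁ : Loc} (h₀ : h.get X = some (RVal.loc n₀))
    (hn₀ : ρ 3 = V.ofR (.loc n₀)) (hn₁ : ρ 7 = V.ofR (.loc n₁)) :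
    Run (semC al (cas (.rval (RVal.loc X)) (.var 3) (.var 7)) ρ) h (h.set X (.loc n₁))
      (V.ofR (.bool true)) := by
  rw [cas, semC]
  refine .atomically (.letin_read (z := X) (by simp [semV]) h₀ ?_)
  rw [semC_ifEq_pos (a := .loc n₀) (b := .loc n₀) (by simp [semV]; rfl)
    (by simp [semV, hn₀]; rfl) rfl]
  exact .letin_write (z := X) (r := .loc n₁) (by simp [semV]) (by simp [semV, hn₁])
    (.val (by simp [semV]))

theorem Run.deqBody {ρ : Env} (H : DeqSpec nl X h k r) :
    Run (semC al (deqBody nl X) ρ) h k (V.ofR r) := by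
  rw [Prog.deqBody]
  rcases H with ⟨x₀, ⟨h₀, e, he⟩, rfl, rfl⟩ | ⟨x₀, x₁, v, l, hq, rfl, rfl⟩
  · refine .letin_read (z := X) (by simp [semV]) h₀ (.letin_read (z := x₀) (by simp [semV]) he ?_)
    rw [semC_ifEq_pos (a := .int nl) (b := .int nl) (semV_snd (r := e) (by simp [semV]; rfl))
      (by simp [semV]; rfl) rfl]
    exact .val (by simp [semV])
  · obtain ⟨e, he⟩ := hq.2.1
    obtain ⟨n, hn⟩ := hq.2.2.1
    refine .letin_read (z := X) (by simp [semV]) hq.1 (.letin_read (z := x₀) (by simp [semV]) he ?_)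
    rw [semC_ifEq_neg (a := .loc x₁) (b := .int nl) (semV_snd (r := e) (by simp [semV]; rfl))
      (by simp [semV]; rfl) atom_loc_ne_int]
    refine .letin_read (z := x₀) (by simp [semV]) he ?_
    rw [semC_letin_val (semV_snd (r := e) (s := .loc x₁) (by simp [semV])), semC]
    refine .bnd (.cas_success (n₁ := x₁) hq.1 (by simp) (by simp)) ?_
    rw [semC_ite_true (by simp [semV])]
    exact .letin_read (z := x₁) (by simp [semV]) ((get_set_root_pair hq.1).2 hn)
      (.val (semV_fst (s := n) (by simp [semV])))

theorem Run.dequeue (ρ : Env) (H : DeqSpec nl X h k r) :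
    Run (V.app (semV al (Prog.dequeue nl X) ρ) (V.ofR .unit)) h k (V.ofR r) := by
  refine .app_lam fun F => ?_
  rw [semC_letin_val_app (d := V.ofR .unit) (fun b => by simp [semV, unitV]), semV, V.app_fn_ofR]
  -- Without interference the `cas` succeeds, so there is no retry and one unfolding suffices.
  exact .lfpT 1 (.deqBody H)

theorem Run.attach {ρ : Env} {v : ℤ} {p : Loc} {e : RVal} (hv : ρ 0 = V.ofR (.int v))
    (hp : ρ 2 = V.ofR (.loc p)) (he : h.get p = some (RVal.pair e (RVal.int nl))) :
    Run (semC al (enqBody nl) ρ) h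
      (attach nl h (al.new h (RVal.pair (RVal.int v) (RVal.int nl))) p e v) (V.ofR .unit) := by
  rw [Prog.enqBody]
  refine .letin_read (z := p) (by simp [semV, hp]) he ?_
  rw [semC_ifEq_pos (a := .int nl) (b := .int nl) (semV_snd (r := e) (by simp [semV]; rfl))
    (by simp [semV]; rfl) rfl, semC]
  refine .bnd (a := V.ofR (.bool true)) ?_ (q := MSQ.attach nl h (al.new h (.pair (.int v) (.int nl))) p e v) ?_
  · rw [semC]
    refine .atomically (.letin_read (z := p) (by simp [semV, hp]) he ?_)
    rw [semC_ifEq_pos (a := .int nl) (b := .int nl) (semV_snd (r := e) (by simp [semV]; rfl))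
      (by simp [semV]; rfl) rfl]
    refine .letin_ref (r := .pair (.int v) (.int nl))
      (semV_pair (by simp [semV, hv]) (by simp [semV])) ?_
    exact .letin_write (z := p) (by simp [semV, hp])
      (semV_pair (semV_fst (r := e) (s := .int nl) (by simp [semV])) (by simp [semV]))
      (.val (by simp [semV]))
  · rw [semC_ite_true (by simp [semV])]
    exact .val (by simp [semV, unitV])

theorem Run.enqBody_next {ρ : Env} {p z : Loc} {e : RVal} {a : V}
    (hp : ρ 2 = V.ofR (.loc p)) (he : h.get p = some (RVal.pair e (RVal.loc z)))
    (H : Run (V.app (ρ 1) (V.ofR (.loc z))) h k a) :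
    Run (semC al (enqBody nl) ρ) h k a := by
  rw [Prog.enqBody]
  refine .letin_read (z := p) (by simp [semV, hp]) he ?_
  rw [semC_ifEq_neg (a := .loc z) (b := .int nl) (semV_snd (r := e) (by simp [semV]; rfl))
    (by simp [semV]; rfl) atom_loc_ne_int]
  refine .letin_read (z := p) (by simp [semV, hp]) he ?_
  rw [semC, semV_snd (r := e) (s := .loc z) (by simp [semV])]
  simpa [semV] using H

/-- An uninterrupted enqueue walks the whole chain from the sentinel to the last node, one recursive
call per node; hence the induction on the chain. -/
theorem Run.enqueue (ρ : Env) {v : ℤ} (H : EnqSpec al nl X v h k r) :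
    Run (V.app (semV al (Prog.enqueue nl X) ρ) (V.ofR (.int v))) h k (V.ofR r) := by
  obtain ⟨x₀, l, e, hq, he, rfl, rfl⟩ := H
  refine .app_lam fun F => ?_
  rw [semC_enqueue_body, semC_read (z := X) (by simp [semV])]
  refine .bnd (a := V.ofR (.loc x₀)) (.fromState (by simp [hq.1]) subset_rfl) ?_
  rw [semV, V.app_fn_ofR]
  generalize hg : (fun (u : V → TM V) d => semC al (enqBody nl) (Function.update (Function.update
    (Function.update (Function.update ρ 99 F) 0 (V.ofR (.int v))) 1 (V.fn u)) 2 d)) = g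
  obtain ⟨-, hc⟩ := hq
  -- The required approximation depends on the length of the walk: one unfolding attaches the node,
  -- and each further node on the way costs another.
  suffices ∃ i : ℕ, Run ((g^[i] fun _ => dagger ∅) (V.ofR (.loc x₀))) h _ (V.ofR .unit) by
    obtain ⟨i, hi⟩ := this
    exact .lfpT i hi
  induction l generalizing x₀ with
  | nil =>
    refine ⟨1, ?_⟩
    subst hg
    exact .attach (by simp) (by simp [last_nil]) he
  | cons a l ih =>
    obtain ⟨z, a⟩ := a
    rw [last_cons] at he ⊢
    obtain ⟨i, hi⟩ := ih z he hc.2.2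
    obtain ⟨e', he'⟩ := hc.1
    refine ⟨i + 1, ?_⟩
    rw [Function.iterate_succ_apply']
    rw [← congrFun (congrFun hg _) _]
    refine .enqBody_next (by simp) he' ?_
    simp only [ne_eq, OfNat.one_ne_ofNat, not_false_eq_true, Function.update_of_ne,
      Function.update_self, V.app_fn_ofR]
    exact hi

/-- This joins the two sides: from whatever heap the opponent has produced, the response can perform
the operation in a single move. -/
theorem Pending.of_run {S : Heap → Heap → RVal → Prop} {U : TM V} {Q : Lang}
    (H : ∀ h k r, S h k r → Run U h k (V.ofR r)) (hQ : Lang.of U ≤ Q) : Pending S Q :=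
  fun h k r hr => hQ _ _ (H h k r hr).lang

end Response

/-! ### Linearizability -/

section Main

variable {nl : ℤ} {X : Loc} {w : World} {al : Allocator}

open MSQ Prog

/-- `U` is an implementation of the operation `S` with results in `P`: each of its traces has one linearization
point, and it may run without interruption. -/
structure Implements (nl : ℤ) (X : Loc) (w : World) (U : TM V) (S : Heap → Heap → RVal → Prop)
    (P : RVal → Prop) : Prop where
  triple : Triple nl X w (fun Q _ => Pending S Q ∧ True) U (Done P)
  run : ∀ h k r, S h k r → Run U h k (V.ofR r)

namespace Implements

variable {U U' : TM V} {S : Heap → Heap → RVal → Prop} {P : RVal → Prop}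

/-- As a pilot, the atomic version has fewer traces; as a response, it keeps exactly the one-step
runs that are used. -/
theorem atomically (H : Implements nl X w U S P) : Implements nl X w (atomically U) S P :=
  ⟨H.triple.mono (atomically_le U), fun h k r hr => (H.run h k r hr).atomically⟩

/-- Only the pilot half of `H` and the response half of `H'` enter, so any two implementations of
the same operation approximate each other. -/
theorem triple_of (H : Implements nl X w U S P) (H' : Implements nl X w U' S P) :
    Triple nl X w (fun Q _ => Lang.of U' ≤ Q) U fun r Q _ => Q.mem [] (V.ofR r) ∧ P r :=
  .pre (A' := fun (_ : Unit) Q _ => Pending S Q ∧ True)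
    (fun _ _ _ _ h => ⟨(), .of_run H'.run h, trivial⟩) fun _ => H.triple

/-- The inner function is evaluated in the environment extended by the binder, hence the hypothesis
for all `ρ`. -/
theorem atomicV (hX : loc nl X ∈ w) (hd : SilentMono w) {v : Val} {r : RVal}
    (H : ∀ ρ, Implements nl X w (V.app (semV al v ρ) (V.ofR r)) S P) (ρ : Env) :
    Implements nl X w (V.app (semV al (atomicV v) ρ) (V.ofR r)) S P := by
  have e : ∀ F, semC al (.atomic (.app v (.var 0)))
      (Function.update (Function.update ρ 99 F) 0 (V.ofR r)) =
      _root_.atomically (V.app (semV al v (Function.update (Function.update ρ 99 F) 0 (V.ofR r)))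
        (V.ofR r)) := fun F => by
    rw [semC, semC]
    simp [semV]
  refine ⟨.app_lam hX hd .done fun F => ?_, fun h k s hs => .app_lam fun F => ?_⟩
  · rw [e]
    exact (H _).atomically.triple
  · rw [e]
    exact (H _).atomically.run h k s hs

end Implements

theorem implements_dequeue (hX : loc nl X ∈ w) (hd : SilentMono w) (ρ : Env) :
    Implements nl X w (V.app (semV al (dequeue nl X) ρ) (V.ofR .unit)) (DeqSpec nl X)
      fun r => ∃ n, r = .int n :=
  ⟨.dequeue hX hd ρ, fun _ _ _ => .dequeue ρ⟩

theorem implements_enqueue (hX : loc nl X ∈ w) (hd : SilentMono w) (v : ℤ) (ρ : Env) :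
    Implements nl X w (V.app (semV al (enqueue nl X) ρ) (V.ofR (.int v))) (EnqSpec al nl X v)
      fun r => r = .unit :=
  ⟨.enqueue hX hd ρ v, fun _ _ _ => .enqueue ρ⟩

/-- The R-values of the type of the result. -/
def Prog.Ops.Res : Ops → RVal → Prop
  | .deq, r => ∃ n, r = .int n
  | .enq _, r => r = .unit
  | .par o o', r => ∃ s s', r = .pair s s' ∧ o.Res s ∧ o'.Res s'

theorem Prog.Ops.Res.sem : ∀ {o : Ops} {r : RVal}, o.Res r → o.ty.sem w (V.ofR r) (V.ofR r)
  | .deq, _, ⟨n, h⟩ => ⟨n, by rw [h]; rfl, by rw [h]; rfl⟩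
  | .enq _, _, h => by
    obtain rfl := h
    exact ⟨V.unit_eq.symm, V.unit_eq.symm⟩
  | .par _ _, _, ⟨s, s', h, H, H'⟩ => by
    subst h
    exact ⟨_, _, _, _, (V.pair_ofR s s').symm, (V.pair_ofR s s').symm, H.sem, H'.sem⟩

/-- Single operations come from `Implements`. A parallel composition has no single linearization
point, so the induction carries the weaker statement that relates the languages of the two programs,
which `Triple.par` composes. -/
theorem Prog.Ops.triple (hX : loc nl X ∈ w) (hd : SilentMono w) (b b' : Bool) (ρ : Env) :
    ∀ o : Ops, Triple nl X w (fun Q _ => Lang.of (semC al (o.tm nl X b') ρ) ≤ Q)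
      (semC al (o.tm nl X b) ρ) fun r Q _ => Q.mem [] (V.ofR r) ∧ o.Res r
  | .deq => by
    have e : semC al (.app (dequeue nl X) unitV) ρ =
        V.app (semV al (dequeue nl X) ρ) (V.ofR .unit) := by
      rw [semC]
      simp [semV, unitV]
    have H : ∀ b, Implements nl X w (semC al (Ops.deq.tm nl X b) ρ) (DeqSpec nl X)
        fun r => ∃ n, r = .int n
      | false => by
        change Implements nl X w (semC al (.app (dequeue nl X) unitV) ρ) _ _
        rw [e]
        exact implements_dequeue hX hd ρ
      | true => by
        change Implements nl X w (semC al (.atomic (.app (dequeue nl X) unitV)) ρ) _ _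
        rw [semC, e]
        exact (implements_dequeue hX hd ρ).atomically
    exact (H b).triple_of (H b')
  | .enq v => by
    have e : semC al (.app (enqueue nl X) (.rval (RVal.int v))) ρ =
        V.app (semV al (enqueue nl X) ρ) (V.ofR (.int v)) := by
      rw [semC]
      simp [semV]
    have H : ∀ b, Implements nl X w (semC al ((Ops.enq v).tm nl X b) ρ) (EnqSpec al nl X v)
        fun r => r = .unit
      | false => by
        change Implements nl X w (semC al (.app (enqueue nl X) (.rval (RVal.int v))) ρ) _ _
        rw [e]
        exact implements_enqueue hX hd v ρ
      | true => by
        change Implements nl X w (semC al (.atomic (.app (enqueue nl X) (.rval (RVal.int v)))) ρ) _ _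
        rw [semC, e]
        exact (implements_enqueue hX hd v ρ).atomically
    exact (H b).triple_of (H b')
  | .par o o' => by
    rw [Ops.tm, Ops.tm, semC, semC]
    exact .par hX hd (o.triple hX hd b b' ρ) (o'.triple hX hd b b' ρ)

theorem isFun_lam {ρ : Env} {x : ℕ} {e : Tm} : (semV al (lam x e) ρ).IsFun := by
  rw [lam, semV]
  exact V.isFun_fn _

end Main

theorem mainTheorem6 (al : Allocator) (nl : ℤ) (X : Loc) (w : World)
    (hX : MSQ.loc nl X ∈ w)
    (hdom : ∀ l ∈ w, ∀ h k : Heap, l.step h k → l.strict h k → h.dom ⊆ k.dom) :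
    IsEffSpec w (MSQ.eff nl X) (MSQ.eff nl X) (MSQ.eff nl X) ∧
    (∀ v ∈ ({Prog.dequeue nl X, Prog.atomicV (Prog.dequeue nl X)} : Set Val),
      ∀ v' ∈ ({Prog.dequeue nl X, Prog.atomicV (Prog.dequeue nl X)} : Set Val),
        (Ty.arrow .unit (MSQ.eff nl X) (MSQ.eff nl X) (MSQ.eff nl X) .int).sem w
          (semV al v env₀) (semV al v' env₀)) ∧
    (∀ v ∈ ({Prog.enqueue nl X, Prog.atomicV (Prog.enqueue nl X)} : Set Val),
      ∀ v' ∈ ({Prog.enqueue nl X, Prog.atomicV (Prog.enqueue nl X)} : Set Val),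
        (Ty.arrow .int (MSQ.eff nl X) (MSQ.eff nl X) (MSQ.eff nl X) .unit).sem w
          (semV al v env₀) (semV al v' env₀)) ∧
    ∀ (o : Prog.Ops) (b b' : Bool),
      TRel w (o.ty.sem w) (MSQ.eff nl X) (MSQ.eff nl X) (MSQ.eff nl X)
        (semC al (o.tm nl X b) env₀) (semC al (o.tm nl X b') env₀) := by
  have wf := MSQ.wf_eff hX
  refine ⟨⟨wf, wf, wf, subset_rfl⟩, ?_, ?_, ?_⟩
  · have F : ∀ v ∈ ({Prog.dequeue nl X, Prog.atomicV (Prog.dequeue nl X)} : Set Val),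
        (semV al v env₀).IsFun ∧ Implements nl X w (V.app (semV al v env₀) (V.ofR .unit))
          (MSQ.DeqSpec nl X) fun r => ∃ n, r = .int n := by
      rintro v (rfl | rfl)
      · exact ⟨isFun_lam, implements_dequeue hX hdom _⟩
      · exact ⟨isFun_lam, .atomicV hX hdom (implements_dequeue hX hdom) _⟩
    intro v hv v' hv'
    refine ⟨(F v hv).1, (F v' hv').1, ?_⟩
    rintro x x' ⟨rfl, rfl⟩
    rw [V.unit_eq]
    refine ((F v hv).2.triple_of (F v' hv').2 |>.post hX ?_).tRel hX hdom
    exact fun r Q _ _ _ h => ⟨h.1, Prog.Ops.Res.sem (o := .deq) h.2⟩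
  · have F : ∀ v ∈ ({Prog.enqueue nl X, Prog.atomicV (Prog.enqueue nl X)} : Set Val),
        (semV al v env₀).IsFun ∧ ∀ n, Implements nl X w (V.app (semV al v env₀) (V.ofR (.int n)))
          (MSQ.EnqSpec al nl X n) fun r => r = .unit := by
      rintro v (rfl | rfl)
      · exact ⟨isFun_lam, fun n => implements_enqueue hX hdom n _⟩
      · exact ⟨isFun_lam, fun n => .atomicV hX hdom (implements_enqueue hX hdom n) _⟩
    intro v hv v' hv'
    refine ⟨(F v hv).1, (F v' hv').1, ?_⟩
    rintro x x' ⟨n, rfl, rfl⟩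
    rw [V.int_eq]
    refine (((F v hv).2 n).triple_of ((F v' hv').2 n) |>.post hX ?_).tRel hX hdom
    exact fun r Q _ _ _ h => ⟨h.1, Prog.Ops.Res.sem (o := .enq n) h.2⟩
  · intro o b b'
    refine ((o.triple hX hdom b b' env₀).post hX ?_).tRel hX hdom
    exact fun r Q _ _ _ h => ⟨h.1, h.2.sem⟩
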